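/- Let $n\ge 1$ and let $g\in C^\infty(\mathbb R,\mathbb R)$, with $G(s)=\int_0^s g(s')\,ds'$. Let $\theta\in C^\infty(\mathbb R^n,\mathbb R)$, $\theta\not\equiv 0$, be a stationary solution of the nonlinear wave equation $$-\ddot\psi=-\Delta\psi+g(\psi),\qquad \psi=\psi(x,t)\in\mathbb R,\ x\in\mathbb R^n,$$ that is, $-\Delta\theta+g(\theta)=0$. Assume that $\theta$ has finite energy, in the sense that $|\nabla\theta|^2$ and $G(\theta)$ are integrable on $\mathbb R^n$, and that $\theta$ is localized, in the sense that $\theta(x)\to 0$ as $|x|\to\infty$. Let $L=-\Delta+g'(\theta)$, and let $H^\infty(\mathbb R^n)$ be the space of smooth functions all of whose derivatives of order $\ge 0$ are in $L^2(\mathbb R^n)$. Then $\theta$ is linearly unstable: the linearization of the equation at $\theta$, $$\partial_t\begin{pmatrix} r\\ s\end{pmatrix}=\begin{pmatrix}0&1\\-L&0\end{pmatrix}\begin{pmatrix} r\\ s\end{pmatrix},$$ has an eigenvalue with positive real part, with an eigenvector in $H^\infty(\mathbb R^n,\mathbb C)^2$. More precisely: 1. $\partial_{x_1}\theta$ is a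 zero mode of $L$ (a nonzero element of $H^\infty(\mathbb R^n)$ with $L\,\partial_{x_1}\theta=0$), and it takes both positive and negative values. 2. There are $c>0$ and a nowhere vanishing real-valued $\chi\in H^\infty(\mathbb R^n)$ with $L\chi=-c^2\chi$, and both $c$ and $-c$ are eigenvalues of the linearization at $\theta$, with eigenvectors in $H^\infty(\mathbb R^n,\mathbb C)^2$. -/

import Mathlib

open MeasureTheory Filter Topology
open scoped ContDiff InnerProductSpace

/-- `ψ : ℝⁿ × ℝ → ℝ` is a classical solution of the nonlinear wave equation
`-∂ₜ²ψ = -Δψ + g(ψ)`. -/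
def IsNLWSolution {n : ℕ} (g : ℝ → ℝ) (ψ : EuclideanSpace ℝ (Fin n) → ℝ → ℝ) : Prop :=
  ContDiff ℝ 2 (fun p : EuclideanSpace ℝ (Fin n) × ℝ => ψ p.1 p.2) ∧
    ∀ x t, -iteratedDeriv 2 (ψ x) t = -(Laplacian.laplacian (fun y => ψ y t)) x + g (ψ x t)

/-- `θ` is a stationary solution: `ψ(x, t) = θ(x)` solves the nonlinear wave equation. -/
def IsStationarySolution {n : ℕ} (g : ℝ → ℝ) (θ : EuclideanSpace ℝ (Fin n) → ℝ) : Prop :=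
  IsNLWSolution g (fun x _ => θ x)

/-- The potential `G(s) = ∫₀ˢ g(s') ds'`. -/
noncomputable def nlwPotential (g : ℝ → ℝ) (s : ℝ) : ℝ := ∫ s' in (0 : ℝ)..s, g s'

/-- The state `(ψ, π)` has finite energy
`E(ψ, π) = ∫ (π² / 2 + |∇ψ|² / 2 + G(ψ)) dx`: the kinetic, gradient and potential parts of the
energy density are all integrable. -/
def HasFiniteEnergy {n : ℕ} (g : ℝ → ℝ) (ψ π : EuclideanSpace ℝ (Fin n) → ℝ) : Prop :=
  Integrable (fun x => π x ^ 2 / 2) ∧ Integrable (fun x => ‖gradient ψ x‖ ^ 2 / 2) ∧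
    Integrable (fun x => nlwPotential g (ψ x))

/-- The space `H^∞(ℝⁿ)`: smooth functions all of whose derivatives (including the function
itself) are square integrable. -/
def MemHInfty {n : ℕ} {F : Type*} [NormedAddCommGroup F] [NormedSpace ℝ F]
    (u : EuclideanSpace ℝ (Fin n) → F) : Prop :=
  ContDiff ℝ ∞ u ∧ ∀ k : ℕ, MemLp (iteratedFDeriv ℝ k u) 2 volume

/-- The Schrödinger operator `L = -Δ + g'(θ)`, acting on real- or complex-valued functions. -/
noncomputable def schrodingerOp {n : ℕ} {F : Type*} [NormedAddCommGroup F] [NormedSpace ℝ F]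
    (g : ℝ → ℝ) (θ : EuclideanSpace ℝ (Fin n) → ℝ) (u : EuclideanSpace ℝ (Fin n) → F) :
    EuclideanSpace ℝ (Fin n) → F :=
  fun x => -(Laplacian.laplacian u) x + deriv g (θ x) • u x

/-- `u` is an eigenfunction of `L = -Δ + g'(θ)` in `H^∞(ℝⁿ)` with eigenvalue `μ`. -/
def IsSchrodingerEigenfunction {n : ℕ} (g : ℝ → ℝ) (θ : EuclideanSpace ℝ (Fin n) → ℝ) (μ : ℝ)
    (u : EuclideanSpace ℝ (Fin n) → ℝ) : Prop :=
  MemHInfty u ∧ u ≠ 0 ∧ schrodingerOp g θ u = μ • u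

/-- The matrix operator `[[0, 1], [-L, 0]]` on the right-hand side of the linearization
`∂ₜ(r, s) = (s, -L r)` of the nonlinear wave equation at `θ`, acting on complex-valued pairs. -/
noncomputable def linearizedOp {n : ℕ} (g : ℝ → ℝ) (θ : EuclideanSpace ℝ (Fin n) → ℝ)
    (w : (EuclideanSpace ℝ (Fin n) → ℂ) × (EuclideanSpace ℝ (Fin n) → ℂ)) :
    (EuclideanSpace ℝ (Fin n) → ℂ) × (EuclideanSpace ℝ (Fin n) → ℂ) :=
  (w.2, -schrodingerOp g θ w.1)

/-- `z ∈ ℂ` is an eigenvalue of the linearization at `θ`, with an eigenvector in `H^∞ × H^∞`. -/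
def IsLinearizationEigenvalue {n : ℕ} (g : ℝ → ℝ) (θ : EuclideanSpace ℝ (Fin n) → ℝ)
    (z : ℂ) : Prop :=
  ∃ w : (EuclideanSpace ℝ (Fin n) → ℂ) × (EuclideanSpace ℝ (Fin n) → ℂ),
    MemHInfty w.1 ∧ MemHInfty w.2 ∧ w ≠ 0 ∧ linearizedOp g θ w = z • w

/-- Linear instability: the linearization at `θ` has an eigenvalue with positive real part. -/
def IsLinearlyUnstable {n : ℕ} (g : ℝ → ℝ) (θ : EuclideanSpace ℝ (Fin n) → ℝ) : Prop :=
  ∃ z : ℂ, 0 < z.re ∧ IsLinearizationEigenvalue g θ z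

/-- The first partial derivative `∂_{x₁} θ` of a function on `ℝⁿ`, `n ≥ 1`. -/
noncomputable def firstPartial {n : ℕ} (hn : 1 ≤ n) (θ : EuclideanSpace ℝ (Fin n) → ℝ) :
    EuclideanSpace ℝ (Fin n) → ℝ :=
  fun x => fderiv ℝ θ x (EuclideanSpace.single (⟨0, hn⟩ : Fin n) (1 : ℝ))

/-! Differentiating Δθ = g(θ) shows that u = ∂₁θ lies in the kernel of L. Along each line parallel
to the first axis θ tends to 0 at both ends, so u takes both signs unless θ = 0
(`eq_zero_of_pd_nonneg`). A ground state of a Schrödinger operator has no zeros, so 0 cannot be the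
bottom of the spectrum of L. If the potential g'(θ) has a nonnegative limit at infinity, the
negative part of the spectrum starts with an eigenvalue -c² whose eigenfunction χ has no zeros, and
(χ, cχ), (χ, -cχ) are eigenvectors of the linearization with eigenvalues c and -c.

The limit of the potential is g'(0), so the delicate point is g'(0) ≥ 0. Suppose g'(0) = -k < 0.
Then θ solves Δθ = -kθ + O(θ²), finite energy puts θ in H¹, and a nonlinear version of the absence
of positive eigenvalues (in the manner of Kato and Froese–Herbst) gives θ = 0
(`eq_zero_of_deriv_neg`). Its engine is a Pohozaev identity with weight exp(2F),
`sum_pd_virialField`, whose density is positive up to small errors. Logarithmic F give all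
polynomial moments, hence pointwise decay; then F = τ(1+|x|²)^(1/4) is admissible for every τ, and
letting τ → ∞ in the identity forces ∇θ = 0 away from the origin
(`IsLocalizedSolution.gradSq_eq_zero`).

For the ground state, suppose first that the energy form of L were nonnegative. Then |u| would also
lie in the kernel (`abs_solution`), the strong maximum principle `pos_of_lap_eq` would make it
positive, and u could not change sign. So the form takes negative values, and the direct method
(`exists_minimizer`) yields an eigenfunction: the weak limit of a minimizing sequence is not zero,
since otherwise local compactness would leave only the nonnegative limit of the potential. The same
two lemmas, applied to L shifted by its lowest eigenvalue, make |χ| a positive eigenfunction.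

Regularity enters twice. Bernstein's estimate bounds all derivatives of θ, hence of g'(θ);
multiplication by g'(θ) then preserves Sobolev spaces, and weak L² solutions are smooth with all
derivatives in L². -/

section NonlinearWave

/-! ### Calculus of partial derivatives and the second derivative test -/

variable {n : ℕ}

/-- `ℝⁿ` with its Euclidean norm. -/
abbrev Euc (n : ℕ) := EuclideanSpace ℝ (Fin n)


/-- The `i`-th partial derivative. -/
noncomputable def pd (i : Fin n) (f : Euc n → ℝ) : Euc n → ℝ :=
  fun x => fderiv ℝ f x (EuclideanSpace.single i 1)

/-- The Laplacian as the sum of the pure second partial derivatives. -/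
noncomputable def lap (f : Euc n → ℝ) : Euc n → ℝ := fun x => ∑ i, pd i (pd i f) x

/-- The squared Euclidean norm of the gradient. -/
noncomputable def gradSq (f : Euc n → ℝ) : Euc n → ℝ := fun x => ∑ i, pd i f x ^ 2

theorem ContDiff.pd {f : Euc n → ℝ} (hf : ContDiff ℝ ∞ f) (i : Fin n) : ContDiff ℝ ∞ (pd i f) :=
  (hf.fderiv_right (m := ∞) (by simp)).clm_apply contDiff_const

theorem ContDiff.lap {f : Euc n → ℝ} (hf : ContDiff ℝ ∞ f) : ContDiff ℝ ∞ (lap f) :=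
  ContDiff.sum fun i _ => (hf.pd i).pd i

theorem ContDiff.gradSq {f : Euc n → ℝ} (hf : ContDiff ℝ ∞ f) : ContDiff ℝ ∞ (gradSq f) :=
  ContDiff.sum fun i _ => (hf.pd i).pow 2

theorem gradSq_nonneg (f : Euc n → ℝ) (x : Euc n) : 0 ≤ gradSq f x :=
  Finset.sum_nonneg fun _ _ => sq_nonneg _

theorem sq_pd_le_gradSq (f : Euc n → ℝ) (i : Fin n) (x : Euc n) : pd i f x ^ 2 ≤ gradSq f x :=
  Finset.single_le_sum (f := fun i => pd i f x ^ 2) (fun _ _ => sq_nonneg _) (Finset.mem_univ i)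

theorem abs_pd_le_sqrt_gradSq (f : Euc n → ℝ) (i : Fin n) (x : Euc n) :
    |pd i f x| ≤ √(gradSq f x) :=
  Real.abs_le_sqrt (sq_pd_le_gradSq f i x)

theorem Smooth.differentiable {f : Euc n → ℝ} (hf : ContDiff ℝ ∞ f) : Differentiable ℝ f :=
  hf.differentiable (by simp)

theorem pd_add {f g : Euc n → ℝ} {x : Euc n} (hf : DifferentiableAt ℝ f x)
    (hg : DifferentiableAt ℝ g x) (i : Fin n) :
    pd i (fun y => f y + g y) x = pd i f x + pd i g x := by
  simp [pd, fderiv_fun_add hf hg]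

theorem pd_sub {f g : Euc n → ℝ} {x : Euc n} (hf : DifferentiableAt ℝ f x)
    (hg : DifferentiableAt ℝ g x) (i : Fin n) :
    pd i (fun y => f y - g y) x = pd i f x - pd i g x := by
  simp [pd, fderiv_fun_sub hf hg]

theorem pd_neg (f : Euc n → ℝ) (i : Fin n) (x : Euc n) : pd i (fun y => - f y) x = - pd i f x := by
  simp [pd, fderiv_fun_neg]

theorem pd_mul {f g : Euc n → ℝ} {x : Euc n} (hf : DifferentiableAt ℝ f x)
    (hg : DifferentiableAt ℝ g x) (i : Fin n) :
    pd i (fun y => f y * g y) x = pd i f x * g x + f x * pd i g x := by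
  simp [pd, fderiv_fun_mul hf hg]; ring

theorem pd_const_mul {f : Euc n → ℝ} {x : Euc n} (hf : DifferentiableAt ℝ f x) (c : ℝ)
    (i : Fin n) : pd i (fun y => c * f y) x = c * pd i f x := by
  simp [pd, fderiv_const_mul hf]

@[simp] theorem pd_const (c : ℝ) (i : Fin n) (x : Euc n) : pd i (fun _ => c) x = 0 := by
  simp [pd]

theorem pd_sum {ι : Type*} {s : Finset ι} {f : ι → Euc n → ℝ} {x : Euc n}
    (hf : ∀ j ∈ s, DifferentiableAt ℝ (f j) x) (i : Fin n) :
    pd i (fun y => ∑ j ∈ s, f j y) x = ∑ j ∈ s, pd i (f j) x := by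
  simp [pd, fderiv_fun_sum hf]

theorem pd_comp {φ : ℝ → ℝ} {φ' : ℝ} {f : Euc n → ℝ} {x : Euc n} (hφ : HasDerivAt φ φ' (f x))
    (hf : DifferentiableAt ℝ f x) (i : Fin n) :
    pd i (fun y => φ (f y)) x = φ' * pd i f x := by
  have := (hφ.comp_hasFDerivAt x hf.hasFDerivAt).fderiv
  simp only [Function.comp_def] at this
  simp [pd, this]

theorem pd_sq {f : Euc n → ℝ} {x : Euc n} (hf : DifferentiableAt ℝ f x) (i : Fin n) :
    pd i (fun y => f y ^ 2) x = 2 * f x * pd i f x := by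
  have := pd_mul hf hf i
  simp only [sq]; rw [this]; ring

theorem pd_coord (i j : Fin n) (x : Euc n) :
    pd i (fun y : Euc n => y j) x = if i = j then 1 else 0 := by
  have : HasFDerivAt (fun y : Euc n => y j) (EuclideanSpace.proj j : Euc n →L[ℝ] ℝ) x :=
    (EuclideanSpace.proj j : Euc n →L[ℝ] ℝ).hasFDerivAt
  simp only [pd, this.fderiv]
  simp [EuclideanSpace.proj, eq_comm]

theorem contDiff_coord (j : Fin n) : ContDiff ℝ ∞ (fun y : Euc n => y j) :=
  (EuclideanSpace.proj j : Euc n →L[ℝ] ℝ).contDiff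

theorem pd_pd_eq_fderiv_fderiv {f : Euc n → ℝ} (hf : ContDiff ℝ ∞ f) (i j : Fin n) (x : Euc n) :
    pd i (pd j f) x =
      fderiv ℝ (fderiv ℝ f) x (EuclideanSpace.single i 1) (EuclideanSpace.single j 1) := by
  have hd : DifferentiableAt ℝ (fderiv ℝ f) x :=
    (hf.fderiv_right (m := ∞) (by simp)).differentiable (by simp) x
  have := (hd.hasFDerivAt.clm_apply
    (hasFDerivAt_const (EuclideanSpace.single j (1 : ℝ) : Euc n) x)).fderiv
  simp only [pd] at *
  change fderiv ℝ (fun y => fderiv ℝ f y (EuclideanSpace.single j 1)) x _ = _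
  rw [this]
  simp

theorem pd_comm {f : Euc n → ℝ} (hf : ContDiff ℝ ∞ f) (i j : Fin n) (x : Euc n) :
    pd i (pd j f) x = pd j (pd i f) x := by
  have hd : Differentiable ℝ (fderiv ℝ f) := (hf.fderiv_right (m := ∞) (by simp)).differentiable
    (by simp)
  rw [pd_pd_eq_fderiv_fderiv hf, pd_pd_eq_fderiv_fderiv hf]
  exact second_derivative_symmetric (f := f) (f' := fderiv ℝ f)
    (fun y => (Smooth.differentiable hf y).hasFDerivAt) (hd x).hasFDerivAt _ _

theorem laplacian_eq_lap {f : Euc n → ℝ} (hf : ContDiff ℝ ∞ f) :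
    Laplacian.laplacian f = lap f := by
  rw [InnerProductSpace.laplacian_eq_iteratedFDeriv_orthonormalBasis f
    (EuclideanSpace.basisFun (Fin n) ℝ)]
  ext x
  refine Finset.sum_congr rfl fun i _ => ?_
  rw [iteratedFDeriv_two_apply, pd_pd_eq_fderiv_fderiv hf]
  simp

theorem fderiv_eq_sum_pd (f : Euc n → ℝ) (x v : Euc n) :
    fderiv ℝ f x v = ∑ i, v i * pd i f x := by
  have : v = ∑ i, v i • (EuclideanSpace.single i (1 : ℝ) : Euc n) := by
    ext j; simp [Finset.sum_apply, Pi.single_apply]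
  conv_lhs => rw [this]
  simp [pd]

theorem gradient_apply (f : Euc n → ℝ) (x : Euc n) (i : Fin n) : gradient f x i = pd i f x := by
  have h1 : ⟪gradient f x, (EuclideanSpace.single i (1 : ℝ) : Euc n)⟫_ℝ = pd i f x := by
    simp [gradient, pd]
  rw [← h1, EuclideanSpace.inner_single_right]
  simp

theorem norm_gradient_sq (f : Euc n → ℝ) (x : Euc n) : ‖gradient f x‖ ^ 2 = gradSq f x := by
  simp [EuclideanSpace.norm_sq_eq, gradient_apply, gradSq]

theorem norm_fderiv_eq (f : Euc n → ℝ) (x : Euc n) : ‖fderiv ℝ f x‖ = √(gradSq f x) := by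
  rw [← norm_gradient_sq, Real.sqrt_sq (norm_nonneg _)]
  simp [gradient]

theorem norm_fderiv_sq (f : Euc n → ℝ) (x : Euc n) : ‖fderiv ℝ f x‖ ^ 2 = gradSq f x := by
  rw [norm_fderiv_eq, Real.sq_sqrt (gradSq_nonneg f x)]

theorem norm_sq_eq_sum (x : Euc n) : ‖x‖ ^ 2 = ∑ i, x i ^ 2 := by
  simp [EuclideanSpace.norm_sq_eq]

theorem abs_coord_le (x : Euc n) (i : Fin n) : |x i| ≤ ‖x‖ := by
  simpa using PiLp.norm_apply_le x i

theorem sum_mul_pd_abs_le (v : Euc n) (f : Euc n → ℝ) (x : Euc n) :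
    |∑ i, v i * pd i f x| ≤ ‖v‖ * √(gradSq f x) := by
  rw [← fderiv_eq_sum_pd, ← norm_fderiv_eq, mul_comm, ← Real.norm_eq_abs]
  exact (fderiv ℝ f x).le_opNorm v

theorem pd_norm_sub_sq (z : Euc n) (i : Fin n) (x : Euc n) :
    pd i (fun y => ‖y - z‖ ^ 2) x = 2 * (x i - z i) := by
  have h : (fun y : Euc n => ‖y - z‖ ^ 2) = fun y => ∑ j, (y j - z j) ^ 2 := by
    ext y; simp [norm_sq_eq_sum]
  have hd : ∀ j, DifferentiableAt ℝ (fun y : Euc n => y j - z j) x := fun j =>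
    ((Smooth.differentiable (contDiff_coord j)) x).sub_const _
  rw [h, pd_sum (fun j _ => (hd j).fun_pow 2)]
  simp_rw [fun j => pd_sq (hd j) i,
    fun j => pd_sub (Smooth.differentiable (contDiff_coord j) x)
      (differentiableAt_const (z j)) i, pd_coord, pd_const]
  simp

theorem contDiff_norm_sub_sq (z : Euc n) : ContDiff ℝ ∞ (fun y : Euc n => ‖y - z‖ ^ 2) :=
  (contDiff_id.sub contDiff_const).norm_sq ℝ

theorem lap_mul {f g : Euc n → ℝ} (hf : ContDiff ℝ ∞ f) (hg : ContDiff ℝ ∞ g) (x : Euc n) :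
    lap (fun y => f y * g y) x = lap f x * g x + 2 * ∑ i, pd i f x * pd i g x + f x * lap g x := by
  have d : ∀ {h : Euc n → ℝ}, ContDiff ℝ ∞ h → ∀ y, DifferentiableAt ℝ h y :=
    fun h y => Smooth.differentiable h y
  have h1 : ∀ i, pd i (pd i fun y => f y * g y) x =
      pd i (pd i f) x * g x + 2 * (pd i f x * pd i g x) + f x * pd i (pd i g) x := by
    intro i
    have : pd i (fun y => f y * g y) = fun y => pd i f y * g y + f y * pd i g y :=
      funext fun y => pd_mul (d hf y) (d hg y) i
    rw [this, pd_add ((d (hf.pd i) x).fun_mul (d hg x)) ((d hf x).fun_mul (d (hg.pd i) x)),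
      pd_mul (d (hf.pd i) x) (d hg x), pd_mul (d hf x) (d (hg.pd i) x)]
    ring
  simp only [lap, h1, Finset.sum_add_distrib, Finset.sum_mul, Finset.mul_sum]

theorem lap_add {f g : Euc n → ℝ} (hf : ContDiff ℝ ∞ f) (hg : ContDiff ℝ ∞ g) (x : Euc n) :
    lap (fun y => f y + g y) x = lap f x + lap g x := by
  have d : ∀ {h : Euc n → ℝ}, ContDiff ℝ ∞ h → ∀ y, DifferentiableAt ℝ h y :=
    fun h y => Smooth.differentiable h y
  have h1 : ∀ i, pd i (pd i fun y => f y + g y) x = pd i (pd i f) x + pd i (pd i g) x := by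
    intro i
    rw [funext fun y => pd_add (d hf y) (d hg y) i, pd_add (d (hf.pd i) x) (d (hg.pd i) x)]
  simp only [lap, h1, Finset.sum_add_distrib]

theorem lap_const_mul {f : Euc n → ℝ} (hf : ContDiff ℝ ∞ f) (c : ℝ) (x : Euc n) :
    lap (fun y => c * f y) x = c * lap f x := by
  have d : ∀ {h : Euc n → ℝ}, ContDiff ℝ ∞ h → ∀ y, DifferentiableAt ℝ h y :=
    fun h y => Smooth.differentiable h y
  have h1 : ∀ i, pd i (pd i fun y => c * f y) x = c * pd i (pd i f) x := by
    intro i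
    rw [funext fun y => pd_const_mul (d hf y) c i, pd_const_mul (d (hf.pd i) x)]
  simp only [lap, h1, Finset.mul_sum]

theorem lap_sum {ι : Type*} (s : Finset ι) {f : ι → Euc n → ℝ} (hf : ∀ j, ContDiff ℝ ∞ (f j))
    (x : Euc n) : lap (fun y => ∑ j ∈ s, f j y) x = ∑ j ∈ s, lap (f j) x := by
  have h1 : ∀ i, pd i (pd i fun y => ∑ j ∈ s, f j y) x = ∑ j ∈ s, pd i (pd i (f j)) x := by
    intro i
    have : pd i (fun y => ∑ j ∈ s, f j y) = fun y => ∑ j ∈ s, pd i (f j) y :=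
      funext fun y => pd_sum (fun j _ => Smooth.differentiable (hf j) y) i
    rw [this, pd_sum fun j _ => Smooth.differentiable ((hf j).pd i) x]
  simp only [lap, h1]
  exact Finset.sum_comm

/-- This is what makes differentiation of an equation for Δv yield an equation of the same type for
the partial derivatives of v. -/
theorem lap_pd {f : Euc n → ℝ} (hf : ContDiff ℝ ∞ f) (i : Fin n) (x : Euc n) :
    lap (pd i f) x = pd i (lap f) x := by
  unfold lap
  rw [pd_sum fun j _ => Smooth.differentiable ((hf.pd j).pd j) x]
  refine Finset.sum_congr rfl fun j _ => ?_
  rw [show pd j (pd i f) = pd i (pd j f) from funext fun y => pd_comm hf j i y,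
    pd_comm (hf.pd j) j i]

theorem pd_norm_sub_sq_fun (z : Euc n) (i : Fin n) :
    pd i (fun y : Euc n => ‖y - z‖ ^ 2) = fun x => 2 * (x i - z i) :=
  funext fun x => pd_norm_sub_sq z i x

theorem lap_norm_sub_sq (z x : Euc n) : lap (fun y => ‖y - z‖ ^ 2) x = 2 * n := by
  have : ∀ i : Fin n, pd i (fun y : Euc n => 2 * (y i - z i)) x = 2 := by
    intro i
    have hc := Smooth.differentiable (contDiff_coord i) x
    rw [pd_const_mul (hc.sub_const _), pd_sub hc (differentiableAt_const _), pd_coord, pd_const]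
    simp
  simp only [lap, pd_norm_sub_sq_fun, this]
  simp [mul_comm]

/-- At an interior local maximum the gradient vanishes and the Laplacian is nonpositive. -/
theorem IsLocalMax.pd_eq_zero {f : Euc n → ℝ} {x : Euc n} (h : IsLocalMax f x) (i : Fin n) :
    pd i f x = 0 := by
  simp [pd, h.fderiv_eq_zero]

/-- If a pure second derivative were positive, the restriction to that coordinate line would have a
local minimum as well as a local maximum. It would then be locally constant, with second derivative
zero. -/
theorem IsLocalMax.lap_nonpos {f : Euc n → ℝ} {x : Euc n} (hf : ContDiff ℝ ∞ f)
    (h : IsLocalMax f x) : lap f x ≤ 0 := by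
  refine Finset.sum_nonpos fun i _ => ?_
  by_contra! hpos
  set e : Euc n := EuclideanSpace.single i 1
  set φ : ℝ → ℝ := fun t => f (x + t • e) with hφ
  have hline : ∀ t : ℝ, HasDerivAt (fun t : ℝ => x + t • e) e t := fun t => by
    simpa using ((hasDerivAt_id t).smul_const e).const_add x
  have hd1 : ∀ {u : Euc n → ℝ}, ContDiff ℝ ∞ u → ∀ t : ℝ,
      HasDerivAt (fun t : ℝ => u (x + t • e)) (pd i u (x + t • e)) t := by
    intro u hu t
    exact (Smooth.differentiable hu _).hasFDerivAt.comp_hasDerivAt t (hline t)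
  have e1 : deriv φ = fun t => pd i f (x + t • e) := funext fun t => (hd1 hf t).deriv
  have e2 : deriv (deriv φ) 0 = pd i (pd i f) x := by
    rw [e1]; simpa using (hd1 (hf.pd i) 0).deriv
  have hmin : IsLocalMin φ 0 := by
    apply isLocalMin_of_deriv_deriv_pos
    · rw [e2]; exact hpos
    · rw [e1]; simpa using h.pd_eq_zero i
    · exact (hd1 hf 0).continuousAt
  have hmax : IsLocalMax φ 0 := by
    have hc : Tendsto (fun t : ℝ => x + t • e) (𝓝 0) (𝓝 x) := by
      have := (hline 0).continuousAt.tendsto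
      simpa using this
    have := hc.eventually h
    filter_upwards [this] with t ht
    simpa [hφ] using ht
  have hconst : φ =ᶠ[𝓝 0] fun _ => φ 0 := by
    filter_upwards [hmin, hmax] with t h1 h2 using le_antisymm h2 h1
  have : deriv (deriv φ) 0 = 0 := by
    rw [hconst.deriv.deriv_eq]
    simp
  rw [e2] at this
  exact hpos.ne' this

theorem IsLocalMin.lap_nonneg {f : Euc n → ℝ} {x : Euc n} (hf : ContDiff ℝ ∞ f)
    (h : IsLocalMin f x) : 0 ≤ lap f x := by
  have h1 := IsLocalMax.lap_nonpos (f := fun y => (-1) * f y) (x := x)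
    (contDiff_const.mul hf) (by simpa using h.neg)
  rw [lap_const_mul hf] at h1
  linarith

/-! ### Bounded and square integrable derivatives: algebra of the two classes -/

/-- `f` and all its partial derivatives of order at most `k` are bounded. -/
def BddDeriv : ℕ → (Euc n → ℝ) → Prop
  | 0, f => ∃ C, ∀ x, |f x| ≤ C
  | k + 1, f => (∃ C, ∀ x, |f x| ≤ C) ∧ ∀ i, BddDeriv k (pd i f)

/-- `f` and all its partial derivatives of order at most `k` are square integrable. -/
def L2Deriv : ℕ → (Euc n → ℝ) → Prop
  | 0, f => MemLp f 2 volume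
  | k + 1, f => MemLp f 2 volume ∧ ∀ i, L2Deriv k (pd i f)

theorem BddDeriv.bdd {k : ℕ} {f : Euc n → ℝ} (h : BddDeriv k f) : ∃ C, ∀ x, |f x| ≤ C := by
  cases k with
  | zero => exact h
  | succ k => exact h.1

theorem L2Deriv.memLp {k : ℕ} {f : Euc n → ℝ} (h : L2Deriv k f) : MemLp f 2 volume := by
  cases k with
  | zero => exact h
  | succ k => exact h.1

theorem BddDeriv.pred {k : ℕ} {f : Euc n → ℝ} (h : BddDeriv (k + 1) f) : BddDeriv k f := by
  induction k generalizing f with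
  | zero => exact h.1
  | succ k ih => exact ⟨h.1, fun i => ih (h.2 i)⟩

theorem L2Deriv.pred {k : ℕ} {f : Euc n → ℝ} (h : L2Deriv (k + 1) f) : L2Deriv k f := by
  induction k generalizing f with
  | zero => exact h.1
  | succ k ih => exact ⟨h.1, fun i => ih (h.2 i)⟩

theorem pd_fun_add {f g : Euc n → ℝ} (hf : ContDiff ℝ ∞ f) (hg : ContDiff ℝ ∞ g) (i : Fin n) :
    pd i (fun y => f y + g y) = fun x => pd i f x + pd i g x :=
  funext fun x => pd_add (Smooth.differentiable hf x) (Smooth.differentiable hg x) i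

theorem pd_fun_mul {f g : Euc n → ℝ} (hf : ContDiff ℝ ∞ f) (hg : ContDiff ℝ ∞ g) (i : Fin n) :
    pd i (fun y => f y * g y) = fun x => pd i f x * g x + f x * pd i g x :=
  funext fun x => pd_mul (Smooth.differentiable hf x) (Smooth.differentiable hg x) i

theorem pd_fun_comp {φ : ℝ → ℝ} {f : Euc n → ℝ} (hφ : ContDiff ℝ ∞ φ) (hf : ContDiff ℝ ∞ f)
    (i : Fin n) : pd i (fun y => φ (f y)) = fun x => deriv φ (f x) * pd i f x :=
  funext fun x => pd_comp ((hφ.differentiable (by simp)) (f x)).hasDerivAt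
    (Smooth.differentiable hf x) i

theorem contDiff_deriv {φ : ℝ → ℝ} (hφ : ContDiff ℝ ∞ φ) : ContDiff ℝ ∞ (deriv φ) :=
  (contDiff_infty_iff_deriv.1 hφ).2

theorem bdd_add {f g : Euc n → ℝ} (hf : ∃ C, ∀ x, |f x| ≤ C) (hg : ∃ C, ∀ x, |g x| ≤ C) :
    ∃ C, ∀ x, |f x + g x| ≤ C := by
  obtain ⟨C, hC⟩ := hf
  obtain ⟨D, hD⟩ := hg
  exact ⟨C + D, fun x => (abs_add_le _ _).trans (add_le_add (hC x) (hD x))⟩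

theorem bdd_mul {f g : Euc n → ℝ} (hf : ∃ C, ∀ x, |f x| ≤ C) (hg : ∃ C, ∀ x, |g x| ≤ C) :
    ∃ C, ∀ x, |f x * g x| ≤ C := by
  obtain ⟨C, hC⟩ := hf
  obtain ⟨D, hD⟩ := hg
  refine ⟨C * D, fun x => ?_⟩
  rw [abs_mul]
  exact mul_le_mul (hC x) (hD x) (abs_nonneg _) ((abs_nonneg _).trans (hC x))

theorem BddDeriv.add {k : ℕ} {f g : Euc n → ℝ} (sf : ContDiff ℝ ∞ f) (sg : ContDiff ℝ ∞ g)
    (hf : BddDeriv k f) (hg : BddDeriv k g) : BddDeriv k (fun x => f x + g x) := by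
  induction k generalizing f g with
  | zero => exact bdd_add hf hg
  | succ k ih =>
    refine ⟨bdd_add hf.1 hg.1, fun i => ?_⟩
    rw [pd_fun_add sf sg]
    exact ih (sf.pd i) (sg.pd i) (hf.2 i) (hg.2 i)

theorem BddDeriv.mul {k : ℕ} {f g : Euc n → ℝ} (sf : ContDiff ℝ ∞ f) (sg : ContDiff ℝ ∞ g)
    (hf : BddDeriv k f) (hg : BddDeriv k g) : BddDeriv k (fun x => f x * g x) := by
  induction k generalizing f g with
  | zero => exact bdd_mul hf hg
  | succ k ih =>
    refine ⟨bdd_mul hf.1 hg.1, fun i => ?_⟩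
    rw [pd_fun_mul sf sg]
    exact BddDeriv.add ((sf.pd i).mul sg) (sf.mul (sg.pd i))
      (ih (sf.pd i) sg (hf.2 i) hg.pred) (ih sf (sg.pd i) hf.pred (hg.2 i))

theorem BddDeriv.const (k : ℕ) (c : ℝ) : BddDeriv k (fun _ : Euc n => c) := by
  induction k generalizing c with
  | zero => exact ⟨|c|, fun _ => le_rfl⟩
  | succ k ih =>
    refine ⟨⟨|c|, fun _ => le_rfl⟩, fun i => ?_⟩
    rw [show pd i (fun _ : Euc n => c) = fun _ => 0 from funext fun x => pd_const c i x]
    exact ih 0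

theorem bdd_comp {φ : ℝ → ℝ} {f : Euc n → ℝ} (hφ : Continuous φ) (hf : ∃ C, ∀ x, |f x| ≤ C) :
    ∃ C, ∀ x, |φ (f x)| ≤ C := by
  obtain ⟨C, hC⟩ := hf
  obtain ⟨D, hD⟩ := (isCompact_Icc (a := -C) (b := C)).exists_bound_of_continuousOn
    hφ.continuousOn
  exact ⟨D, fun x => by simpa using hD (f x) (abs_le.1 (hC x))⟩

theorem BddDeriv.comp {k : ℕ} {φ : ℝ → ℝ} {f : Euc n → ℝ} (hφ : ContDiff ℝ ∞ φ)
    (sf : ContDiff ℝ ∞ f) (hf : BddDeriv k f) : BddDeriv k (fun x => φ (f x)) := by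
  induction k generalizing φ with
  | zero => exact bdd_comp hφ.continuous hf
  | succ k ih =>
    refine ⟨bdd_comp hφ.continuous hf.1, fun i => ?_⟩
    rw [pd_fun_comp hφ sf]
    exact BddDeriv.mul ((contDiff_deriv hφ).comp sf) (sf.pd i)
      (ih (contDiff_deriv hφ) hf.pred) (hf.2 i)

theorem L2Deriv.add {k : ℕ} {f g : Euc n → ℝ} (sf : ContDiff ℝ ∞ f) (sg : ContDiff ℝ ∞ g)
    (hf : L2Deriv k f) (hg : L2Deriv k g) : L2Deriv k (fun x => f x + g x) := by
  induction k generalizing f g with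
  | zero => exact MemLp.add hf hg
  | succ k ih =>
    refine ⟨hf.1.add hg.1, fun i => ?_⟩
    rw [pd_fun_add sf sg]
    exact ih (sf.pd i) (sg.pd i) (hf.2 i) (hg.2 i)

theorem MemLp.bdd_mul' {f g : Euc n → ℝ} (sf : Continuous f) (hf : ∃ C, ∀ x, |f x| ≤ C)
    (hg : MemLp g 2 volume) : MemLp (fun x => f x * g x) 2 volume := by
  obtain ⟨C, hC⟩ := hf
  refine (hg.const_mul C).of_le (sf.aestronglyMeasurable.mul hg.1) (ae_of_all _ fun x => ?_)
  have h0 : 0 ≤ C := (abs_nonneg _).trans (hC x)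
  simp only [norm_mul, Real.norm_eq_abs, abs_of_nonneg h0]
  exact mul_le_mul_of_nonneg_right (hC x) (abs_nonneg _)

theorem L2Deriv.bdd_mul {k : ℕ} {f g : Euc n → ℝ} (sf : ContDiff ℝ ∞ f) (sg : ContDiff ℝ ∞ g)
    (hf : BddDeriv k f) (hg : L2Deriv k g) : L2Deriv k (fun x => f x * g x) := by
  induction k generalizing f g with
  | zero => exact MemLp.bdd_mul' sf.continuous hf hg
  | succ k ih =>
    refine ⟨MemLp.bdd_mul' sf.continuous hf.1 hg.1, fun i => ?_⟩
    rw [pd_fun_mul sf sg]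
    exact L2Deriv.add ((sf.pd i).mul sg) (sf.mul (sg.pd i))
      (ih (sf.pd i) sg (hf.2 i) hg.pred) (ih sf (sg.pd i) hf.pred (hg.2 i))

/-! ### Cutoff functions and the divergence theorem -/

/-- Cutoff functions that exhaust space, with gradients bounded by `C / (N + 1)`. -/
theorem exists_cutoff (n : ℕ) : ∃ C : ℝ, 0 ≤ C ∧ ∃ η : ℕ → Euc n → ℝ,
    (∀ N, ContDiff ℝ ∞ (η N)) ∧ (∀ N, HasCompactSupport (η N)) ∧
    (∀ N x, 0 ≤ η N x ∧ η N x ≤ 1) ∧ (∀ (N : ℕ) i x, |pd i (η N) x| ≤ C / (N + 1)) ∧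
    (∀ (N : ℕ) i x, 2 * ((N : ℝ) + 1) < ‖x‖ → pd i (η N) x = 0) ∧
    ∀ x, ∀ᶠ N in atTop, η N x = 1 := by
  -- Equal to 1 on the unit ball and to 0 outside radius 2. Dilation by N + 1 divides the gradient
  -- by N + 1.
  let b : ContDiffBump (0 : Euc n) := ⟨1, 2, one_pos, one_lt_two⟩
  have hb : ContDiff ℝ ∞ b := b.contDiff
  have hcpt : HasCompactSupport (fderiv ℝ b) := b.hasCompactSupport.fderiv (𝕜 := ℝ)
  obtain ⟨C, hC⟩ := hcpt.exists_bound_of_continuous (hb.continuous_fderiv (by simp))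
  have hpos : ∀ N : ℕ, (0 : ℝ) < N + 1 := fun N => by positivity
  have hpd : ∀ (N : ℕ) i x, pd i (fun x => b (((N : ℝ) + 1)⁻¹ • x)) x =
      ((N : ℝ) + 1)⁻¹ * pd i b (((N : ℝ) + 1)⁻¹ • x) := by
    intro N i x
    have h1 : HasFDerivAt (fun x : Euc n => ((N : ℝ) + 1)⁻¹ • x)
        (((N : ℝ) + 1)⁻¹ • ContinuousLinearMap.id ℝ (Euc n)) x :=
      (hasFDerivAt_id (𝕜 := ℝ) x).const_smul (((N : ℝ) + 1)⁻¹)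
    have h2 := ((Smooth.differentiable hb (((N : ℝ) + 1)⁻¹ • x)).hasFDerivAt.comp x h1).fderiv
    simp only [Function.comp_def] at h2
    simp [pd, h2]
  refine ⟨|C|, abs_nonneg _, fun N x => b (((N : ℝ) + 1)⁻¹ • x), fun N => ?_, fun N => ?_,
    fun N x => ⟨b.nonneg, b.le_one⟩, fun N i x => ?_, fun N i x hx => ?_, fun x => ?_⟩
  · exact hb.comp (contDiff_const_smul _)
  · exact b.hasCompactSupport.comp_smul (inv_ne_zero (hpos N).ne')
  · rw [hpd, abs_mul, abs_inv, abs_of_pos (hpos N), inv_mul_eq_div]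
    refine div_le_div_of_nonneg_right ?_ (hpos N).le
    have := (fderiv ℝ b (((N : ℝ) + 1)⁻¹ • x)).le_opNorm (EuclideanSpace.single i 1)
    simp only [PiLp.norm_single, norm_one, mul_one] at this
    exact this.trans ((hC _).trans (le_abs_self C))
  · rw [hpd]
    have : b =ᶠ[𝓝 (((N : ℝ) + 1)⁻¹ • x)] fun _ => 0 := by
      have hlt : 2 < ‖((N : ℝ) + 1)⁻¹ • x‖ := by
        rw [norm_smul, norm_inv, Real.norm_of_nonneg (hpos N).le, inv_mul_eq_div,
          lt_div_iff₀ (hpos N)]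
        exact hx
      filter_upwards [(isOpen_lt continuous_const continuous_norm).mem_nhds hlt] with y hy
      exact b.zero_of_le_dist (by simpa using le_of_lt hy)
    simp [pd, this.fderiv_eq]
  · obtain ⟨M, hM⟩ := exists_nat_ge ‖x‖
    filter_upwards [eventually_ge_atTop M] with N hN
    refine b.one_of_mem_closedBall ?_
    rw [mem_closedBall_zero_iff, norm_smul, norm_inv, Real.norm_of_nonneg (hpos N).le,
      inv_mul_eq_div, div_le_one (hpos N)]
    have : (M : ℝ) ≤ N := by exact_mod_cast hN
    linarith

theorem integral_mul_pd_of_hasCompactSupport {f g : Euc n → ℝ} (sf : ContDiff ℝ ∞ f)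
    (sg : ContDiff ℝ ∞ g) (hf : HasCompactSupport f) (i : Fin n) :
    ∫ x, f x * pd i g x = - ∫ x, pd i f x * g x := by
  have hf' : HasCompactSupport (pd i f) := hf.fderiv_apply (𝕜 := ℝ) _
  refine integral_mul_fderiv_eq_neg_fderiv_mul_of_integrable
    (f := f) (g := g) (v := EuclideanSpace.single i 1) ?_ ?_ ?_
    (fun x _ => Smooth.differentiable sf x) (fun x _ => Smooth.differentiable sg x)
  · exact ((sf.pd i).continuous.mul sg.continuous).integrable_of_hasCompactSupport hf'.mul_right
  · exact (sf.continuous.mul (sg.pd i).continuous).integrable_of_hasCompactSupport hf.mul_right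
  · exact (sf.continuous.mul sg.continuous).integrable_of_hasCompactSupport hf.mul_right

/-- The divergence theorem on `ℝⁿ` for vector fields that are integrable against
`(1 + ‖x‖)⁻¹`. -/
theorem integral_div_eq_zero {Z : Fin n → Euc n → ℝ} {k : Euc n → ℝ}
    (sZ : ∀ i, ContDiff ℝ ∞ (Z i)) (hk : Integrable k)
    (hZ : ∀ i x, |Z i x| ≤ (1 + ‖x‖) * k x)
    (hdiv : Integrable fun x => ∑ i, pd i (Z i) x) : ∫ x, ∑ i, pd i (Z i) x = 0 := by
  obtain ⟨C, hC0, η, sη, cη, bη, dη, zη, eη⟩ := exists_cutoff n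
  -- The index is an argument because for n = 0 the bound on Z says nothing about the sign of k.
  have hk0 : ∀ x, ∀ _ : Fin n, 0 ≤ k x := fun x i =>
    nonneg_of_mul_nonneg_right ((abs_nonneg _).trans (hZ i x)) (by positivity)
  have h1 : Tendsto (fun N => ∫ x, η N x * ∑ i, pd i (Z i) x) atTop
      (𝓝 (∫ x, ∑ i, pd i (Z i) x)) := by
    refine tendsto_integral_of_dominated_convergence (fun x => ‖∑ i, pd i (Z i) x‖)
      (fun N => (sη N).continuous.aestronglyMeasurable.mul hdiv.1) hdiv.norm
      (fun N => ae_of_all _ fun x => ?_) (ae_of_all _ fun x => ?_)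
    · rw [norm_mul, Real.norm_of_nonneg (bη N x).1]
      exact mul_le_of_le_one_left (norm_nonneg _) (bη N x).2
    · refine Tendsto.congr' ?_ tendsto_const_nhds
      filter_upwards [eη x] with N hN
      rw [hN, one_mul]
  -- Where ∇η is nonzero, ‖x‖ ≤ 2(N + 1), so 1 + ‖x‖ ≤ 3(N + 1). The gradient bound C/(N + 1)
  -- compensates exactly this growth and leaves a majorant independent of N.
  have hle : ∀ i N x, |pd i (η N) x * Z i x| ≤ 3 * C * k x := by
    intro i N x
    rw [abs_mul]
    have hp : (0 : ℝ) < N + 1 := by positivity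
    by_cases hx : 2 * ((N : ℝ) + 1) < ‖x‖
    · rw [zη N i x hx]
      have := hk0 x i
      simp; positivity
    · push Not at hx
      calc |pd i (η N) x| * |Z i x| ≤ C / (N + 1) * ((1 + ‖x‖) * k x) :=
            mul_le_mul (dη N i x) (hZ i x) (abs_nonneg _) (by positivity)
        _ ≤ C / (N + 1) * ((3 * (N + 1)) * k x) := by
            have := hk0 x i
            gcongr
            have : (0 : ℝ) ≤ N := by positivity
            linarith
        _ = 3 * C * k x := by field_simp
  have hi : ∀ i, Tendsto (fun N => ∫ x, pd i (η N) x * Z i x) atTop (𝓝 0) := by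
    intro i
    rw [← integral_zero (Euc n) ℝ]
    refine tendsto_integral_of_dominated_convergence (fun x => 3 * C * k x)
      (fun N => (((sη N).pd i).continuous.mul (sZ i).continuous).aestronglyMeasurable)
      (hk.const_mul _) (fun N => ae_of_all _ fun x => hle i N x) (ae_of_all _ fun x => ?_)
    have h0 : Tendsto (fun N : ℕ => C / ((N : ℝ) + 1) * |Z i x|) atTop (𝓝 0) := by
      have : Tendsto (fun N : ℕ => C * (1 / ((N : ℝ) + 1)) * |Z i x|) atTop
          (𝓝 (C * 0 * |Z i x|)) :=
        (tendsto_one_div_add_atTop_nhds_zero_nat.const_mul C).mul_const _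
      simpa [div_eq_mul_inv] using this
    refine squeeze_zero_norm (fun N => ?_) h0
    rw [norm_mul]
    exact mul_le_mul_of_nonneg_right (dη N i x) (abs_nonneg _)
  have hN : ∀ N, ∫ x, η N x * ∑ i, pd i (Z i) x = - ∑ i, ∫ x, pd i (η N) x * Z i x := by
    intro N
    simp_rw [Finset.mul_sum]
    rw [integral_finsetSum _ fun i _ => ?_, ← Finset.sum_neg_distrib]
    · exact Finset.sum_congr rfl fun i _ =>
        integral_mul_pd_of_hasCompactSupport (sη N) (sZ i) (cη N) i
    · exact ((sη N).continuous.mul ((sZ i).pd i).continuous).integrable_of_hasCompactSupport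
        (cη N).mul_right
  have h2 : Tendsto (fun N => ∫ x, η N x * ∑ i, pd i (Z i) x) atTop (𝓝 0) := by
    simp_rw [hN]
    simpa using (tendsto_finsetSum Finset.univ fun i _ => hi i).neg
  exact tendsto_nhds_unique h1 h2

/-! ### Bernstein's estimate and bounds for all derivatives -/

/-- Bernstein's gradient estimate. -/
theorem sum_sq_le_of_lap_bound {v : Euc n → ℝ} (sv : ContDiff ℝ ∞ v) {A B : ℝ} (hB : 0 ≤ B)
    (hv : ∀ x, |v x| ≤ A) (hlap : ∀ x, |lap v x| ≤ A)
    (hgrad : ∀ x, √(gradSq (lap v) x) ≤ B * (1 + √(gradSq v x))) :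
    ∃ C, ∀ x, gradSq v x ≤ C := by
  -- The weight of v² must absorb 4n + 32 from the cutoff η and 3B from ∇v · ∇(Δv): 2B directly, and
  -- B more after 2BD ≤ B + BD² for the linear term.
  set μ : ℝ := 4 * n + 32 + 3 * B + 1 with hμ
  have hμ0 : 0 ≤ μ := by positivity
  refine ⟨B + 2 * μ * A ^ 2 + μ * A ^ 2, fun x₀ => ?_⟩
  set η : Euc n → ℝ := fun y => 1 + (-1) * ‖y - x₀‖ ^ 2 with hη
  have sη : ContDiff ℝ ∞ η := contDiff_const.add (contDiff_const.mul (contDiff_norm_sub_sq x₀))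
  have pη : ∀ i x, pd i η x = -(2 * (x i - x₀ i)) := by
    intro i x
    have hd := Smooth.differentiable (contDiff_norm_sub_sq x₀) x
    rw [hη, pd_add (differentiableAt_const _) (hd.const_mul _), pd_const, pd_const_mul hd,
      pd_norm_sub_sq]
    ring
  have lη : ∀ x, lap η x = -(2 * n) := by
    intro x
    rw [hη, lap_add contDiff_const (contDiff_const.mul (contDiff_norm_sub_sq x₀)),
      lap_const_mul (contDiff_norm_sub_sq x₀), lap_norm_sub_sq]
    have : lap (fun _ : Euc n => (1 : ℝ)) x = 0 := by
      simp only [lap]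
      refine Finset.sum_eq_zero fun i _ => ?_
      rw [show pd i (fun _ : Euc n => (1 : ℝ)) = fun _ => 0 from funext fun y => pd_const 1 i y,
        pd_const]
    rw [this]; ring
  have gη : ∀ x, gradSq η x = 4 * ‖x - x₀‖ ^ 2 := by
    intro x
    simp only [gradSq, pη, norm_sq_eq_sum, Finset.mul_sum]
    exact Finset.sum_congr rfl fun i _ => by simp; ring
  -- Bernstein's auxiliary function η²|∇v|² + μv², maximized over the unit ball around x₀. It
  -- dominates |∇v|² at x₀. On the sphere η = 0 and only μv² is left. At an interior maximum ΔP ≤ 0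
  -- bounds |∇v|².
  set P : Euc n → ℝ := fun x => (∑ j, (η x * pd j v x) * (η x * pd j v x)) + μ * (v x * v x)
    with hP
  have sηv : ∀ j, ContDiff ℝ ∞ (fun x => η x * pd j v x) := fun j => sη.mul (sv.pd j)
  have sP : ContDiff ℝ ∞ P :=
    (ContDiff.sum fun j _ => (sηv j).mul (sηv j)).add (contDiff_const.mul (sv.mul sv))
  have hPeq : ∀ x, P x = η x ^ 2 * gradSq v x + μ * v x ^ 2 := by
    intro x
    simp only [hP, gradSq, Finset.mul_sum]
    congr 1
    · exact Finset.sum_congr rfl fun j _ => by ring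
    · ring
  have hvsq : ∀ x, v x ^ 2 ≤ A ^ 2 := fun x => sq_le_sq' (by linarith [(abs_le.1 (hv x)).1])
    (abs_le.1 (hv x)).2
  have hA : 0 ≤ A := (abs_nonneg _).trans (hv x₀)
  obtain ⟨z, hz, hzmax⟩ := (isCompact_closedBall x₀ 1).exists_isMaxOn
    ⟨x₀, Metric.mem_closedBall_self zero_le_one⟩ sP.continuous.continuousOn
  have hx0 : gradSq v x₀ ≤ P z := by
    have h1 : P x₀ ≤ P z := hzmax (Metric.mem_closedBall_self zero_le_one)
    have h2 : gradSq v x₀ ≤ P x₀ := by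
      rw [hPeq]; simp [hη]; positivity
    linarith
  refine hx0.trans ?_
  rcases (Metric.mem_closedBall.1 hz).lt_or_eq with hlt | heq
  · have hloc : IsLocalMax P z := hzmax.isLocalMax
      (mem_of_superset (Metric.isOpen_ball.mem_nhds hlt) Metric.ball_subset_closedBall)
    have hl := hloc.lap_nonpos sP
    have hr : ‖z - x₀‖ ^ 2 ≤ 1 := by
      rw [← dist_eq_norm]; nlinarith [dist_nonneg (x := z) (y := x₀)]
    have hη0 : 0 ≤ η z := by simp only [hη]; linarith
    have hη1 : η z ≤ 1 := by simp only [hη]; nlinarith [sq_nonneg ‖z - x₀‖]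
    -- Expanding Δ((ηw)²), the cross term 8ηw ∇η·∇w is absorbed in 2η²|∇w|² by completing the
    -- square, at the cost 32w², because |∇η|² ≤ 4. The term 4n comes from Δη = -2n.
    have key : ∀ w : Euc n → ℝ, ContDiff ℝ ∞ w →
        lap (fun x => (η x * w x) * (η x * w x)) z ≥
          -(4 * n + 32) * w z ^ 2 + 2 * η z ^ 2 * (w z * lap w z) := by
      intro w sw
      have hw := sη.mul sw
      rw [lap_mul hw hw, lap_mul sη sw]
      have e1 : ∑ i, pd i (fun x => η x * w x) z * pd i (fun x => η x * w x) z =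
          gradSq η z * w z ^ 2 + 2 * (η z * w z) * (∑ i, pd i η z * pd i w z)
            + η z ^ 2 * gradSq w z := by
        simp only [pd_fun_mul sη sw, gradSq, Finset.mul_sum, Finset.sum_mul,
          ← Finset.sum_add_distrib]
        exact Finset.sum_congr rfl fun i _ => by ring
      rw [e1, lη]
      have hcs : (∑ i, pd i η z * pd i w z) ^ 2 ≤ 4 * gradSq w z := by
        refine (Finset.sum_mul_sq_le_sq_mul_sq _ _ _).trans ?_
        have : ∑ i, pd i η z ^ 2 ≤ 4 := by
          have := gη z; simp only [gradSq] at this; rw [this]; linarith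
        exact mul_le_mul_of_nonneg_right this (gradSq_nonneg w z)
      set T := ∑ i, pd i η z * pd i w z
      have g0 := gradSq_nonneg η z
      have gw := gradSq_nonneg w z
      have h3 : 0 ≤ (η z * T / 2 + 4 * w z) ^ 2 := sq_nonneg _
      have h4 : η z ^ 2 * T ^ 2 ≤ η z ^ 2 * (4 * gradSq w z) :=
        mul_le_mul_of_nonneg_left hcs (sq_nonneg _)
      have h5 : (n : ℝ) * η z * w z ^ 2 ≤ n * w z ^ 2 := by
        have : (0 : ℝ) ≤ n * w z ^ 2 := by positivity
        nlinarith
      nlinarith [mul_nonneg g0 (sq_nonneg (w z))]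
    have hlapP : lap P z ≥ -(4 * n + 32) * gradSq v z +
        2 * η z ^ 2 * (∑ j, pd j v z * pd j (lap v) z) + μ * (2 * v z * lap v z + 2 * gradSq v z) := by
      rw [hP, lap_add (ContDiff.sum fun j _ => (sηv j).mul (sηv j))
        (contDiff_const.mul (sv.mul sv)), lap_sum _ (fun j => (sηv j).mul (sηv j)),
        lap_const_mul (sv.mul sv), lap_mul sv sv]
      have e2 : ∑ i, pd i v z * pd i v z = gradSq v z :=
        Finset.sum_congr rfl fun i _ => by ring
      have e3 : -(4 * (n : ℝ) + 32) * gradSq v z +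
          2 * η z ^ 2 * (∑ j, pd j v z * pd j (lap v) z) =
          ∑ j, (-(4 * n + 32) * pd j v z ^ 2 + 2 * η z ^ 2 * (pd j v z * lap (pd j v) z)) := by
        simp only [gradSq, Finset.sum_add_distrib, Finset.mul_sum, lap_pd sv]
      rw [e2, e3]
      have := Finset.sum_le_sum fun j (_ : j ∈ Finset.univ) => key (pd j v) (sv.pd j)
      linarith
    have hcs2 : |∑ j, pd j v z * pd j (lap v) z| ≤ √(gradSq v z) * √(gradSq (lap v) z) := by
      rw [← Real.sqrt_mul (gradSq_nonneg _ _)]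
      exact Real.abs_le_sqrt (Finset.sum_mul_sq_le_sq_mul_sq _ _ _)
    set D := √(gradSq v z) with hD
    have hDsq : gradSq v z = D ^ 2 := (Real.sq_sqrt (gradSq_nonneg _ _)).symm
    have hD0 : 0 ≤ D := Real.sqrt_nonneg _
    set T := ∑ j, pd j v z * pd j (lap v) z
    have hT : -(B * D + B * D ^ 2) ≤ T := by
      have h6 : |T| ≤ D * (B * (1 + D)) :=
        hcs2.trans (mul_le_mul_of_nonneg_left (hgrad z) hD0)
      have := (abs_le.1 h6).1
      linarith
    have hη2 : η z ^ 2 ≤ 1 := by nlinarith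
    have hT2 : -(B * D + B * D ^ 2) ≤ η z ^ 2 * T := by
      have h0 : 0 ≤ B * D + B * D ^ 2 := by positivity
      nlinarith [sq_nonneg (η z)]
    have hvl : -(A ^ 2) ≤ v z * lap v z := by
      have : |v z * lap v z| ≤ A * A := by
        rw [abs_mul]; exact mul_le_mul (hv z) (hlap z) (abs_nonneg _) hA
      have := (abs_le.1 this).1
      nlinarith
    have hBD : 2 * (B * D) ≤ B + B * D ^ 2 := by nlinarith [mul_nonneg hB (sq_nonneg (D - 1))]
    rw [hDsq] at hlapP
    have hmain : D ^ 2 ≤ B + 2 * μ * A ^ 2 := by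
      have hμv : -(μ * A ^ 2) ≤ μ * (v z * lap v z) := by
        nlinarith
      have hn : (0 : ℝ) ≤ n := by positivity
      have hall : 0 ≥ -(4 * n + 32) * D ^ 2 + 2 * (η z ^ 2 * T) + 2 * (μ * (v z * lap v z))
          + 2 * μ * D ^ 2 := by
        refine le_trans (le_of_eq ?_) (hlapP.le.trans hl); ring
      have hDD := sq_nonneg D
      rw [hμ] at hall ⊢
      rw [hμ] at hμv
      nlinarith [mul_nonneg hn hDD, mul_nonneg hB hDD]
    rw [hPeq, hDsq]
    have : η z ^ 2 * D ^ 2 ≤ D ^ 2 := mul_le_of_le_one_left (sq_nonneg _) hη2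
    have := mul_le_mul_of_nonneg_left (hvsq z) hμ0
    linarith
  · have hηz : η z = 0 := by simp [hη, ← dist_eq_norm, heq]
    rw [hPeq, hηz]
    have := mul_le_mul_of_nonneg_left (hvsq z) hμ0
    have : 0 ≤ 2 * μ * A ^ 2 := by positivity
    nlinarith

theorem bdd_pd_of_gradSq_bdd {v : Euc n → ℝ} (h : ∃ C, ∀ x, gradSq v x ≤ C) (i : Fin n) :
    ∃ C, ∀ x, |pd i v x| ≤ C := by
  obtain ⟨C, hC⟩ := h
  exact ⟨√C, fun x => (abs_pd_le_sqrt_gradSq v i x).trans (Real.sqrt_le_sqrt (hC x))⟩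

theorem sqrt_gradSq_le_sum (v : Euc n → ℝ) (x : Euc n) : √(gradSq v x) ≤ ∑ i, |pd i v x| := by
  refine Real.sqrt_le_iff.2 ⟨Finset.sum_nonneg fun _ _ => abs_nonneg _, ?_⟩
  simp only [gradSq, ← sq_abs (pd _ v x)]
  exact Finset.sum_sq_le_sq_sum_of_nonneg fun _ _ => abs_nonneg _

/-- The gradient of Vv + r grows at most linearly in |∇v|, which is what Bernstein's estimate needs.
-/
theorem gradSq_bdd_of_lap_eq {v V r : Euc n → ℝ} (sv : ContDiff ℝ ∞ v) (sV : ContDiff ℝ ∞ V)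
    (sr : ContDiff ℝ ∞ r) (h : ∀ x, lap v x = V x * v x + r x) (hv : ∃ C, ∀ x, |v x| ≤ C)
    (hV : BddDeriv 1 V) (hr : BddDeriv 1 r) : ∃ C, ∀ x, gradSq v x ≤ C := by
  have hlap : lap v = fun x => V x * v x + r x := funext h
  obtain ⟨A₁, hA₁⟩ := hv
  obtain ⟨A₂, hA₂⟩ := bdd_add (bdd_mul hV.1 ⟨A₁, hA₁⟩) hr.1
  obtain ⟨B₀, hB₀⟩ := hV.1
  have hpd : ∀ i, ∃ C, ∀ x, |pd i V x * v x + pd i r x| ≤ C := fun i =>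
    bdd_add (bdd_mul (hV.2 i) ⟨A₁, hA₁⟩) (hr.2 i)
  choose D hD using hpd
  have hB₀' : 0 ≤ B₀ := (abs_nonneg _).trans (hB₀ 0)
  have hD' : ∀ i, 0 ≤ D i := fun i => (abs_nonneg _).trans (hD i 0)
  have hDs : 0 ≤ ∑ i, D i := Finset.sum_nonneg fun i _ => hD' i
  refine sum_sq_le_of_lap_bound sv (A := max A₁ A₂) (B := n * B₀ + ∑ i, D i) (by positivity)
    (fun x => (hA₁ x).trans (le_max_left _ _)) (fun x => ?_) fun x => ?_
  · rw [h]; exact (hA₂ x).trans (le_max_right _ _)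
  · have h1 : ∀ i, |pd i (lap v) x| ≤ D i + B₀ * √(gradSq v x) := by
      intro i
      rw [hlap, pd_fun_add (sV.mul sv) sr, pd_fun_mul sV sv]
      have e : pd i V x * v x + V x * pd i v x + pd i r x =
        (pd i V x * v x + pd i r x) + V x * pd i v x := by ring
      simp only [e]
      refine (abs_add_le _ _).trans (add_le_add (hD i x) ?_)
      rw [abs_mul]
      exact mul_le_mul (hB₀ x) (abs_pd_le_sqrt_gradSq v i x) (abs_nonneg _) hB₀'
    refine (sqrt_gradSq_le_sum _ _).trans ((Finset.sum_le_sum fun i _ => h1 i).trans ?_)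
    rw [Finset.sum_add_distrib]
    simp only [Finset.sum_const, Finset.card_univ, Fintype.card_fin, nsmul_eq_mul]
    have := Real.sqrt_nonneg (gradSq v x)
    have hn : (0 : ℝ) ≤ n * B₀ := by positivity
    nlinarith [mul_nonneg hDs this]

/-- Induction on the order: ∂ᵢv is bounded by Bernstein's estimate and solves the same equation with
source ∂ᵢV v + ∂ᵢr. That source has one derivative less under control, which suffices. -/
theorem bddDeriv_of_lap_eq {V : Euc n → ℝ} (sV : ContDiff ℝ ∞ V) {k : ℕ} (hV : BddDeriv k V)
    {v r : Euc n → ℝ} (sv : ContDiff ℝ ∞ v)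
    (sr : ContDiff ℝ ∞ r) (h : ∀ x, lap v x = V x * v x + r x) (hv : ∃ C, ∀ x, |v x| ≤ C)
    (hr : BddDeriv k r) : BddDeriv k v := by
  induction k generalizing v r with
  | zero => exact hv
  | succ k ih =>
    have le1 : ∀ {f : Euc n → ℝ}, BddDeriv (k + 1) f → BddDeriv 1 f := fun {f} hf => by
      exact ⟨hf.1, fun i => (hf.2 i).bdd⟩
    have hg := gradSq_bdd_of_lap_eq sv sV sr h hv (le1 hV) (le1 hr)
    have hvk := ih hV.pred sv sr h hv hr.pred
    refine ⟨hv, fun i => ?_⟩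
    refine ih hV.pred (sv.pd i) (r := fun x => pd i V x * v x + pd i r x)
      (((sV.pd i).mul sv).add (sr.pd i)) (fun x => ?_) (bdd_pd_of_gradSq_bdd hg i)
      (BddDeriv.add ((sV.pd i).mul sv) (sr.pd i)
        (BddDeriv.mul (sV.pd i) sv (hV.2 i) hvk) (hr.2 i))
    rw [lap_pd sv, show lap v = fun x => V x * v x + r x from funext h,
      pd_fun_add (sV.mul sv) sr, pd_fun_mul sV sv]
    ring

/-- A bounded solution of `Δθ = g(θ)` has bounded derivatives of all orders. -/
theorem bddDeriv_of_semilinear {g : ℝ → ℝ} (hg : ContDiff ℝ ∞ g) {θ : Euc n → ℝ}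
    (sθ : ContDiff ℝ ∞ θ) (h : ∀ x, lap θ x = g (θ x)) (hb : ∃ C, ∀ x, |θ x| ≤ C) (k : ℕ) :
    BddDeriv k θ := by
  have hlap : lap θ = fun x => g (θ x) := funext h
  have sV : ContDiff ℝ ∞ fun x => deriv g (θ x) := (contDiff_deriv hg).comp sθ
  -- Bernstein's estimate applies directly to the nonlinear equation, since ∇g(θ) = g'(θ)∇θ with
  -- g'(θ) bounded.
  have h1 : ∃ C, ∀ x, gradSq θ x ≤ C := by
    obtain ⟨A₁, hA₁⟩ := hb
    obtain ⟨A₂, hA₂⟩ := bdd_comp hg.continuous ⟨A₁, hA₁⟩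
    obtain ⟨B₀, hB₀⟩ := bdd_comp (contDiff_deriv hg).continuous ⟨A₁, hA₁⟩
    have hB₀' : 0 ≤ B₀ := (abs_nonneg _).trans (hB₀ 0)
    refine sum_sq_le_of_lap_bound sθ (A := max A₁ A₂) (B := B₀) hB₀'
      (fun x => (hA₁ x).trans (le_max_left _ _)) (fun x => ?_) fun x => ?_
    · rw [h]; exact (hA₂ x).trans (le_max_right _ _)
    · have e : gradSq (lap θ) x = deriv g (θ x) ^ 2 * gradSq θ x := by
        simp only [gradSq, hlap, pd_fun_comp hg sθ, mul_pow, Finset.mul_sum]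
      rw [e, Real.sqrt_mul (sq_nonneg _), Real.sqrt_sq_eq_abs]
      have := Real.sqrt_nonneg (gradSq θ x)
      refine mul_le_mul (hB₀ x) (by linarith) this hB₀'
  induction k with
  | zero => exact hb
  | succ k ih =>
    refine ⟨hb, fun i => ?_⟩
    -- ∂ᵢθ solves the linearized equation. Order k bounds on θ give order k bounds on the potential
    -- g'(θ), hence on ∂ᵢθ.
    refine bddDeriv_of_lap_eq sV (BddDeriv.comp (contDiff_deriv hg) sθ ih) (sθ.pd i)
      (r := fun _ => 0) contDiff_const (fun x => ?_) (bdd_pd_of_gradSq_bdd h1 i)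
      (BddDeriv.const k 0)
    rw [lap_pd sθ, hlap, pd_fun_comp hg sθ, add_zero]

/-! ### Square integrability of all derivatives -/

/-- Fatou's lemma. -/
theorem integrable_of_tendsto_of_integral_le {f : ℕ → Euc n → ℝ} {F : Euc n → ℝ} {K : ℝ}
    (hf : ∀ N, Integrable (f N)) (h0 : ∀ N x, 0 ≤ f N x) (hK : ∀ N, ∫ x, f N x ≤ K)
    (hlim : ∀ x, Tendsto (fun N => f N x) atTop (𝓝 (F x))) (hF : Continuous F) :
    Integrable F := by
  have hF0 : ∀ x, 0 ≤ F x := fun x => ge_of_tendsto' (hlim x) fun N => h0 N x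
  refine ⟨hF.aestronglyMeasurable, ?_⟩
  rw [hasFiniteIntegral_iff_ofReal (ae_of_all _ hF0)]
  have h1 : ∀ x, ENNReal.ofReal (F x) = liminf (fun N => ENNReal.ofReal (f N x)) atTop :=
    fun x => ((ENNReal.continuous_ofReal.tendsto _).comp (hlim x)).liminf_eq.symm
  simp_rw [h1]
  refine (lintegral_liminf_le' fun N => (hf N).1.aemeasurable.ennreal_ofReal).trans_lt ?_
  have h2 : ∀ N, ∫⁻ x, ENNReal.ofReal (f N x) ≤ ENNReal.ofReal K := fun N => by
    rw [← ofReal_integral_eq_lintegral_ofReal (hf N) (ae_of_all _ (h0 N))]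
    exact ENNReal.ofReal_le_ofReal (hK N)
  refine lt_of_le_of_lt (liminf_le_of_frequently_le' (Frequently.of_forall h2)) ENNReal.ofReal_lt_top

/-- Caccioppoli's inequality, qualitatively: `u, Δu ∈ L²` implies `∇u ∈ L²`. -/
theorem memLp_pd_of_lap {u : Euc n → ℝ} (su : ContDiff ℝ ∞ u) (hu : MemLp u 2 volume)
    (hl : MemLp (lap u) 2 volume) (i : Fin n) : MemLp (pd i u) 2 volume := by
  obtain ⟨C, hC0, η, sη, cη, bη, dη, -, eη⟩ := exists_cutoff n
  have hi1 : Integrable fun x => u x * lap u x := hu.integrable_mul hl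
  have hi2 : Integrable fun x => u x ^ 2 := hu.integrable_sq
  have hgη : ∀ N x, gradSq (η N) x ≤ n * C ^ 2 := by
    intro N x
    have h1 : ∀ i ∈ Finset.univ, pd i (η N) x ^ 2 ≤ C ^ 2 := by
      intro i _
      have h2 : |pd i (η N) x| ≤ C := (dη N i x).trans
        (div_le_self hC0 (by have : (0 : ℝ) ≤ N := by positivity
                             linarith))
      rw [← sq_abs]
      exact pow_le_pow_left₀ (abs_nonneg _) h2 2
    have := Finset.sum_le_sum h1
    simpa [gradSq] using this
  have hgrad : Integrable (gradSq u) := by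
    refine integrable_of_tendsto_of_integral_le (f := fun N x => η N x ^ 2 * gradSq u x)
      (K := ∫ x, (2 * |u x * lap u x| + 4 * (n * C ^ 2) * u x ^ 2))
      (fun N => ?_) (fun N x => mul_nonneg (sq_nonneg _) (gradSq_nonneg _ _)) (fun N => ?_)
      (fun x => ?_) su.gradSq.continuous
    · refine (((sη N).continuous.pow 2).mul su.gradSq.continuous).integrable_of_hasCompactSupport ?_
      simp only [sq, mul_assoc]
      exact (cη N).mul_right (f' := fun x => η N x * gradSq u x)
    -- The field η²u∇u has divergence η²(|∇u|² + uΔu) + 2ηu∇η·∇u and integral of the divergence 0.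
    · set Z : Fin n → Euc n → ℝ := fun i x => (η N x * η N x) * (u x * pd i u x) with hZ
      have sZ : ∀ i, ContDiff ℝ ∞ (Z i) := fun i =>
        ((sη N).mul (sη N)).mul (su.mul (su.pd i))
      have hZi : ∀ i, ∫ x, pd i (Z i) x = 0 := by
        intro i
        have cZ : HasCompactSupport (Z i) := by
          exact ((cη N).mul_right (f' := η N)).mul_right (f' := fun x => u x * pd i u x)
        have := integral_mul_pd_of_hasCompactSupport (sZ i) (contDiff_const (c := (1 : ℝ))) cZ i
        simpa using this.symm
      have hcs : ∀ f : Euc n → ℝ, Continuous f → Integrable fun x => η N x * f x := fun f hf =>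
        ((sη N).continuous.mul hf).integrable_of_hasCompactSupport (cη N).mul_right
      have hint : ∀ i, Integrable (pd i (Z i)) := by
        intro i
        refine ((sZ i).pd i).continuous.integrable_of_hasCompactSupport ?_
        have cZ : HasCompactSupport (Z i) :=
          ((cη N).mul_right (f' := η N)).mul_right (f' := fun x => u x * pd i u x)
        exact cZ.fderiv_apply (𝕜 := ℝ) _
      have hsum : ∫ x, ∑ i, pd i (Z i) x = 0 := by
        rw [integral_finsetSum _ fun i _ => hint i]
        exact Finset.sum_eq_zero fun i _ => hZi i
      -- Subtracting the divergence twice leaves -η²|∇u|², which absorbs the cross term 4ηu∇η·∇u up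
      -- to a multiple of u².
      have hpt : ∀ x, η N x ^ 2 * gradSq u x - 2 * ∑ i, pd i (Z i) x ≤
          2 * |u x * lap u x| + 4 * (n * C ^ 2) * u x ^ 2 := by
        intro x
        have e1 : ∑ i, pd i (Z i) x = η N x ^ 2 * (gradSq u x + u x * lap u x) +
            2 * (η N x * u x) * ∑ i, pd i (η N) x * pd i u x := by
          simp only [hZ, pd_fun_mul ((sη N).mul (sη N)) (su.mul (su.pd _)),
            pd_fun_mul (sη N) (sη N), pd_fun_mul su (su.pd _), gradSq, lap, mul_add,
            Finset.mul_sum, ← Finset.sum_add_distrib]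
          exact Finset.sum_congr rfl fun i _ => by ring
        rw [e1]
        set T := ∑ i, pd i (η N) x * pd i u x
        have hT : T ^ 2 ≤ n * C ^ 2 * gradSq u x :=
          (Finset.sum_mul_sq_le_sq_mul_sq _ _ _).trans
            (mul_le_mul_of_nonneg_right (hgη N x) (gradSq_nonneg _ _))
        have h1 : η N x ^ 2 * (u x * lap u x) ≥ -|u x * lap u x| := by
          have := (bη N x)
          have h2 : η N x ^ 2 ≤ 1 := by nlinarith
          nlinarith [neg_abs_le (u x * lap u x), sq_nonneg (η N x), abs_nonneg (u x * lap u x)]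
        have hG := gradSq_nonneg u x
        set G := gradSq u x
        have hK : 0 ≤ n * C ^ 2 := by positivity
        have h3 : 4 * |η N x * u x * T| ≤ η N x ^ 2 * G + 4 * (n * C ^ 2) * u x ^ 2 := by
          have h4 : |η N x * u x * T| ≤ √(n * C ^ 2) * |u x| * (|η N x| * √G) := by
            rw [abs_mul, abs_mul]
            have := Real.abs_le_sqrt hT
            rw [Real.sqrt_mul hK] at this
            calc |η N x| * |u x| * |T| ≤ |η N x| * |u x| * (√(n * C ^ 2) * √G) := by gcongr
              _ = _ := by ring
          have h5 := sq_nonneg (2 * (√(n * C ^ 2) * |u x|) - |η N x| * √G)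
          have h6 : (√(n * C ^ 2) * |u x|) ^ 2 = n * C ^ 2 * u x ^ 2 := by
            rw [mul_pow, Real.sq_sqrt hK, sq_abs]
          have h7 : (|η N x| * √G) ^ 2 = η N x ^ 2 * G := by
            rw [mul_pow, Real.sq_sqrt hG, sq_abs]
          nlinarith
        have h8 := neg_abs_le (η N x * u x * T)
        nlinarith
      have hleft : Integrable fun x => η N x ^ 2 * gradSq u x := by
        simp only [sq, mul_assoc]
        exact hcs _ ((sη N).continuous.mul su.gradSq.continuous)
      have hright : Integrable fun x => 2 * |u x * lap u x| + 4 * (n * C ^ 2) * u x ^ 2 :=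
        (hi1.abs.const_mul 2).add (hi2.const_mul _)
      have hs : Integrable fun x => ∑ i, pd i (Z i) x := integrable_finsetSum _ fun i _ => hint i
      have := integral_mono (hleft.sub (hs.const_mul 2)) hright hpt
      simp only [Pi.sub_apply] at this
      rw [integral_sub hleft (hs.const_mul 2), integral_const_mul, hsum] at this
      simpa using this
    · refine Tendsto.congr' ?_ tendsto_const_nhds
      filter_upwards [eη x] with N hN
      rw [hN]; ring
  rw [memLp_two_iff_integrable_sq (su.pd i).continuous.aestronglyMeasurable]
  refine hgrad.mono ((su.pd i).continuous.pow 2).aestronglyMeasurable (ae_of_all _ fun x => ?_)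
  rw [Real.norm_of_nonneg (sq_nonneg _), Real.norm_of_nonneg (gradSq_nonneg _ _)]
  exact sq_pd_le_gradSq u i x

/-- Bootstrap: if u has k derivatives in L², so has Wu = Δu, and the Caccioppoli inequality applied
to successive derivatives of u then gains one order. -/
theorem l2Deriv_of_lap_eq {W u : Euc n → ℝ} (sW : ContDiff ℝ ∞ W) (hW : ∀ k, BddDeriv k W)
    (su : ContDiff ℝ ∞ u) (h : ∀ x, lap u x = W x * u x) (hu : MemLp u 2 volume) (k : ℕ) :
    L2Deriv k u := by
  have H : ∀ k, ∀ v : Euc n → ℝ, ContDiff ℝ ∞ v → MemLp v 2 volume → L2Deriv k (lap v) →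
      L2Deriv (k + 1) v := by
    intro k
    induction k with
    | zero => exact fun v sv hv hl => ⟨hv, fun i => memLp_pd_of_lap sv hv hl i⟩
    | succ k ih =>
      refine fun v sv hv hl => ⟨hv, fun i => ih _ (sv.pd i) (memLp_pd_of_lap sv hv hl.memLp i) ?_⟩
      rw [show lap (pd i v) = pd i (lap v) from funext fun x => lap_pd sv i x]
      exact hl.2 i
  induction k with
  | zero => exact hu
  | succ k ih =>
    refine H k u su hu ?_
    rw [show lap u = fun x => W x * u x from funext h]
    exact L2Deriv.bdd_mul sW su (hW k) ih

/-- Passage from partial derivatives to the total derivative: du is the sum of ∂ᵢu dxᵢ with constant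
covectors dxᵢ, so each further order costs only the constants ‖dxᵢ‖. -/
theorem memLp_iteratedFDeriv {u : Euc n → ℝ} (su : ContDiff ℝ ∞ u) {k : ℕ} (hu : L2Deriv k u) :
    MemLp (iteratedFDeriv ℝ k u) 2 volume := by
  induction k generalizing u with
  | zero =>
    refine MemLp.of_le hu (su.continuous_iteratedFDeriv (by simp)).aestronglyMeasurable
      (ae_of_all _ fun x => ?_)
    simp
  | succ k ih =>
    let P : Fin n → ℝ →L[ℝ] (Euc n →L[ℝ] ℝ) := fun i =>
      (ContinuousLinearMap.id ℝ ℝ).smulRight (EuclideanSpace.proj i : Euc n →L[ℝ] ℝ)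
    have hfd : fderiv ℝ u = fun x => ∑ i, P i (pd i u x) := by
      ext x v
      rw [fderiv_eq_sum_pd]
      simp [P, mul_comm]
    have hsum : MemLp (fun x => ∑ i, ‖P i‖ * ‖iteratedFDeriv ℝ k (pd i u) x‖) 2 volume :=
      memLp_finsetSum _ fun i _ => ((ih (su.pd i) (hu.2 i)).norm).const_mul _
    refine hsum.of_le (su.continuous_iteratedFDeriv (m := k + 1)
      (by exact_mod_cast le_top)).aestronglyMeasurable (ae_of_all _ fun x => ?_)
    rw [← norm_iteratedFDeriv_fderiv, hfd, iteratedFDeriv_fun_sum_apply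
      (f := fun i x => P i (pd i u x)) fun i _ => ((P i).contDiff.comp ((su.pd i).of_le (by exact_mod_cast le_top))).contDiffAt]
    refine (norm_sum_le _ _).trans (le_trans (Finset.sum_le_sum fun i _ => ?_)
      (Real.le_norm_self _))
    exact (P i).norm_iteratedFDeriv_comp_left (su.pd i).contDiffAt (by exact_mod_cast le_top)

theorem memHInfty_of_l2Deriv {u : Euc n → ℝ} (su : ContDiff ℝ ∞ u) (hu : ∀ k, L2Deriv k u) :
    MemHInfty u :=
  ⟨su, fun k => memLp_iteratedFDeriv su (hu k)⟩

/-! ### Sign of the partial derivatives of a localized function -/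

/-- On each line in direction eᵢ the function is monotone and tends to 0 at both ends, hence is 0.
Applied to θ and -θ this gives the sign change of the zero mode. -/
theorem eq_zero_of_pd_nonneg {θ : Euc n → ℝ} (sθ : ContDiff ℝ ∞ θ)
    (hloc : Tendsto θ (cocompact (Euc n)) (𝓝 0)) (i : Fin n) (h : ∀ x, 0 ≤ pd i θ x) :
    θ = 0 := by
  ext x
  set e : Euc n := EuclideanSpace.single i 1
  have hline : ∀ t : ℝ, HasDerivAt (fun t : ℝ => x + t • e) e t := fun t => by
    simpa using ((hasDerivAt_id t).smul_const e).const_add x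
  have hd : ∀ t : ℝ, HasDerivAt (fun t : ℝ => θ (x + t • e)) (pd i θ (x + t • e)) t := fun t =>
    (Smooth.differentiable sθ _).hasFDerivAt.comp_hasDerivAt t (hline t)
  have hm : Monotone fun t : ℝ => θ (x + t • e) :=
    monotone_of_deriv_nonneg (fun t => (hd t).differentiableAt) fun t => by
      rw [(hd t).deriv]; exact h _
  have he : ‖e‖ = 1 := by simp [e]
  have hc : Tendsto (fun t : ℝ => x + t • e) (cocompact ℝ) (cocompact (Euc n)) := by
    rw [← Metric.cobounded_eq_cocompact, ← Metric.cobounded_eq_cocompact,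
      ← tendsto_norm_atTop_iff_cobounded]
    refine tendsto_atTop_mono (f := fun t : ℝ => ‖t‖ - ‖x‖) (fun t => ?_)
      (tendsto_atTop_add_const_right _ _ tendsto_norm_cobounded_atTop)
    have := norm_sub_norm_le (t • e) (-x)
    rw [norm_smul, he, norm_neg, sub_neg_eq_add, mul_one, add_comm (t • e)] at this
    exact this
  have h1 := hm.ge_of_tendsto (hloc.comp (hc.mono_left atTop_le_cocompact)) 0
  have h2 := hm.le_of_tendsto (hloc.comp (hc.mono_left atBot_le_cocompact)) 0
  simp only [zero_smul, add_zero] at h1 h2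
  exact le_antisymm h1 h2

/-! ### Sobolev regularity on the Fourier side -/

section Regularity

open TemperedDistribution FourierTransform LineDeriv Laplacian
open scoped SchwartzMap Real

theorem BddDeriv.iteratedFDeriv_bdd {u : Euc n → ℝ} (su : ContDiff ℝ ∞ u) {k : ℕ}
    (hu : BddDeriv k u) : ∃ C, ∀ x, ‖iteratedFDeriv ℝ k u x‖ ≤ C := by
  induction k generalizing u with
  | zero =>
    obtain ⟨C, hC⟩ := hu
    exact ⟨C, fun x => by simpa using hC x⟩
  | succ k ih =>
    let P : Fin n → ℝ →L[ℝ] (Euc n →L[ℝ] ℝ) := fun i =>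
      (ContinuousLinearMap.id ℝ ℝ).smulRight (EuclideanSpace.proj i : Euc n →L[ℝ] ℝ)
    have hfd : fderiv ℝ u = fun x => ∑ i, P i (pd i u x) := by
      ext x v
      rw [fderiv_eq_sum_pd]
      simp [P, mul_comm]
    choose C hC using fun i => ih (su.pd i) (hu.2 i)
    refine ⟨∑ i, ‖P i‖ * C i, fun x => ?_⟩
    rw [← norm_iteratedFDeriv_fderiv, hfd, iteratedFDeriv_fun_sum_apply
      (f := fun i x => P i (pd i u x)) fun i _ => ((P i).contDiff.comp
      ((su.pd i).of_le (by exact_mod_cast le_top))).contDiffAt]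
    refine (norm_sum_le _ _).trans (Finset.sum_le_sum fun i _ => ?_)
    exact ((P i).norm_iteratedFDeriv_comp_left (su.pd i).contDiffAt
      (by exact_mod_cast le_top)).trans (mul_le_mul_of_nonneg_left (hC i x) (norm_nonneg _))

theorem hasTemperateGrowth_of_bddDeriv {u : Euc n → ℝ} (su : ContDiff ℝ ∞ u)
    (hu : ∀ k, BddDeriv k u) : u.HasTemperateGrowth := by
  refine ⟨su, fun k => ?_⟩
  obtain ⟨C, hC⟩ := (hu k).iteratedFDeriv_bdd su
  exact ⟨0, C, fun x => by simpa using hC x⟩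

theorem hasTemperateGrowth_ofReal_comp {u : Euc n → ℝ} (su : ContDiff ℝ ∞ u)
    (hu : ∀ k, BddDeriv k u) : (fun x => (u x : ℂ)).HasTemperateGrowth :=
  Function.HasTemperateGrowth.comp (g := Complex.ofReal) Function.Complex.hasTemperateGrowth_ofReal
    (hasTemperateGrowth_of_bddDeriv su hu)

/-- The symbol of order 2 is 1 + |ξ|², whereas -Δ has symbol (2π)²|ξ|² in this normalization of the
Fourier transform. -/
theorem besselPotential_two_apply (T : 𝓢'(Euc n, ℂ)) :
    besselPotential (Euc n) ℂ 2 T = T + (((2 * π) ^ 2)⁻¹ : ℝ) • (-Δ T) := by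
  have hc : ((2 * π) ^ 2 : ℝ) ≠ 0 := by positivity
  rw [TemperedDistribution.laplacian_eq_fourierMultiplierCLM]
  have h1 : besselPotential (Euc n) ℂ 2 T =
      fourierMultiplierCLM ℂ (fun x : Euc n => ((1 : ℝ) : ℂ)) T +
        fourierMultiplierCLM ℂ (fun x : Euc n => ((‖x‖ ^ 2 : ℝ) : ℂ)) T := by
    have h2 : smulLeftCLM ℂ (fun x : Euc n => (((1 + ‖x‖ ^ 2) ^ ((2 : ℝ) / 2) : ℝ) : ℂ)) (𝓕 T) =
        smulLeftCLM ℂ (fun x : Euc n => ((1 : ℝ) : ℂ)) (𝓕 T) +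
          smulLeftCLM ℂ (fun x : Euc n => ((‖x‖ ^ 2 : ℝ) : ℂ)) (𝓕 T) := by
      have h3 := smulLeftCLM_add (E := Euc n) (F := ℂ) (g₁ := fun x : Euc n => ((1 : ℝ) : ℂ))
        (g₂ := fun x : Euc n => ((‖x‖ ^ 2 : ℝ) : ℂ)) (by fun_prop) (by fun_prop)
      have h4 := congrArg (fun Φ => Φ (𝓕 T)) h3
      refine Eq.trans ?_ h4
      congr 2
      ext x
      simp
    rw [besselPotential, fourierMultiplierCLM_apply, fourierMultiplierCLM_apply,
      fourierMultiplierCLM_apply, h2, fourierInv_add]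
  rw [h1]
  congr 1
  · simp
  · simp only [neg_smul, neg_neg, smul_smul]
    rw [inv_mul_cancel₀ hc, one_smul]

/-- The Bessel potential of order 2 is a combination of T and ΔT and shifts the Sobolev order by
exactly two. -/
theorem memSobolev_add_two_of_laplacian {s : ℝ} {T : 𝓢'(Euc n, ℂ)} (hT : MemSobolev s 2 T)
    (hL : MemSobolev s 2 (Δ T)) : MemSobolev (s + 2) 2 T := by
  rw [add_comm, ← memSobolev_besselPotential_iff, besselPotential_two_apply]
  refine hT.add ?_
  have := (hL.neg).smul ((((2 * π) ^ 2)⁻¹ : ℝ) : ℂ)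
  exact this

/-- The second derivatives ∂ᵢ∂ᵢT lie in order s - 1, so the gain of two through the Laplacian
applies from s - 1. -/
theorem memSobolev_add_one_of_lineDeriv {s : ℝ} {T : 𝓢'(Euc n, ℂ)} (hT : MemSobolev s 2 T)
    (hd : ∀ i : Fin n, MemSobolev s 2 (∂_{(EuclideanSpace.single i (1 : ℝ) : Euc n)} T)) :
    MemSobolev (s + 1) 2 T := by
  have h1 : MemSobolev (s - 1 + 2) 2 T := by
    refine memSobolev_add_two_of_laplacian (hT.mono (by linarith)) ?_
    rw [TemperedDistribution.laplacian_eq_sum (EuclideanSpace.basisFun (Fin n) ℝ)]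
    have : ∀ t : Finset (Fin n), MemSobolev (s - 1) 2 (∑ i ∈ t,
        ∂_{(EuclideanSpace.basisFun (Fin n) ℝ) i} (∂_{(EuclideanSpace.basisFun (Fin n) ℝ) i} T)) := by
      intro t
      induction t using Finset.induction_on with
      | empty => simp
      | insert i t hi ih =>
        rw [Finset.sum_insert hi]
        refine MemSobolev.add (MemSobolev.lineDerivOp ?_) ih
        simpa using hd i
    exact this _
  exact h1.mono (by linarith)

/-- By duality both sides act on a test function ψ, and the claim reduces to the product rule for
wψ. -/
theorem lineDeriv_smulLeft {w : Euc n → ℝ} (sw : ContDiff ℝ ∞ w) (hw : ∀ k, BddDeriv k w)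
    (i : Fin n) (T : 𝓢'(Euc n, ℂ)) :
    ∂_{(EuclideanSpace.single i (1 : ℝ) : Euc n)} (smulLeftCLM ℂ (fun x => (w x : ℂ)) T) =
      smulLeftCLM ℂ (fun x => (pd i w x : ℂ)) T +
        smulLeftCLM ℂ (fun x => (w x : ℂ))
          (∂_{(EuclideanSpace.single i (1 : ℝ) : Euc n)} T) := by
  have g1 := hasTemperateGrowth_ofReal_comp sw hw
  have g2 := hasTemperateGrowth_ofReal_comp (sw.pd i) fun k => (hw (k + 1)).2 i
  ext ψ
  change T _ = T _ + T _
  rw [← map_add]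
  refine congrArg T ?_
  ext x
  have hd : HasFDerivAt (fun x => (w x : ℂ) * ψ x)
      ((w x : ℂ) • fderiv ℝ ψ x + ψ x • (Complex.ofRealCLM.comp (fderiv ℝ w x))) x := by
    have h1 : HasFDerivAt (fun x => (w x : ℂ)) (Complex.ofRealCLM.comp (fderiv ℝ w x)) x :=
      Complex.ofRealCLM.hasFDerivAt.comp x (Smooth.differentiable sw x).hasFDerivAt
    exact h1.mul ψ.differentiableAt.hasFDerivAt
  have e : (SchwartzMap.smulLeftCLM ℂ (fun x => (w x : ℂ)) ψ : Euc n → ℂ) =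
      fun x => (w x : ℂ) * ψ x := by
    rw [SchwartzMap.smulLeftCLM_apply g1]; rfl
  have e1 : ∂_{(EuclideanSpace.single i (1 : ℝ) : Euc n)}
      (SchwartzMap.smulLeftCLM ℂ (fun x => (w x : ℂ)) ψ) x =
      (w x : ℂ) * fderiv ℝ ψ x (EuclideanSpace.single i 1) + ψ x * (pd i w x : ℂ) := by
    rw [SchwartzMap.lineDerivOp_apply_eq_fderiv, e, hd.fderiv]
    simp [pd]
  have e2 : SchwartzMap.smulLeftCLM ℂ (fun x => (w x : ℂ))
      (-∂_{(EuclideanSpace.single i (1 : ℝ) : Euc n)} ψ) x =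
      (w x : ℂ) * -(fderiv ℝ ψ x (EuclideanSpace.single i 1)) := by
    rw [SchwartzMap.smulLeftCLM_apply_apply g1]; rfl
  have e3 : SchwartzMap.smulLeftCLM ℂ (fun x => (pd i w x : ℂ)) ψ x = (pd i w x : ℂ) * ψ x := by
    rw [SchwartzMap.smulLeftCLM_apply_apply g2]; rfl
  change SchwartzMap.smulLeftCLM ℂ (fun x => (w x : ℂ))
      (-∂_{(EuclideanSpace.single i (1 : ℝ) : Euc n)} ψ) x =
    SchwartzMap.smulLeftCLM ℂ (fun x => (pd i w x : ℂ)) ψ x +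
    -∂_{(EuclideanSpace.single i (1 : ℝ) : Euc n)}
      (SchwartzMap.smulLeftCLM ℂ (fun x => (w x : ℂ)) ψ) x
  rw [e1, e2, e3]
  ring

/-- Induction on the integer order. Order 0 is L^∞ times L²; the step uses the Leibniz rule and the
characterization of order k + 1 by first derivatives. -/
theorem MemSobolev.smulLeft {w : Euc n → ℝ} (sw : ContDiff ℝ ∞ w) (hw : ∀ k, BddDeriv k w)
    {k : ℕ} {T : 𝓢'(Euc n, ℂ)} (hT : MemSobolev k 2 T) :
    MemSobolev k 2 (smulLeftCLM ℂ (fun x => (w x : ℂ)) T) := by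
  induction k generalizing w T with
  | zero =>
    rw [Nat.cast_zero, memSobolev_zero_iff] at hT ⊢
    obtain ⟨f, rfl⟩ := hT
    have g1 := hasTemperateGrowth_ofReal_comp sw hw
    obtain ⟨C, hC⟩ := (hw 0).bdd
    have hm : MemLp (fun x => (w x : ℂ)) ⊤ (volume : Measure (Euc n)) :=
      memLp_top_of_bound g1.1.continuous.aestronglyMeasurable C
        (ae_of_all _ fun x => by simpa using hC x)
    exact ⟨hm.toLp • f, (Lp.toTemperedDistribution_smul_eq g1 hm f).symm⟩
  | succ k ih =>
    push_cast at hT ⊢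
    have hT0 : MemSobolev k 2 T := hT.mono (by linarith)
    refine memSobolev_add_one_of_lineDeriv (ih sw hw hT0) fun i => ?_
    rw [lineDeriv_smulLeft sw hw]
    refine (ih (sw.pd i) (fun k => (hw (k + 1)).2 i) hT0).add (ih sw hw ?_)
    simpa using hT.lineDerivOp (m := (EuclideanSpace.single i (1 : ℝ) : Euc n))

/-- Bootstrap: order k for T gives order k for wT = ΔT, hence order k + 2 for T, of which one step
is kept. -/
theorem memSobolev_of_laplacian_eq {w : Euc n → ℝ} (sw : ContDiff ℝ ∞ w)
    (hw : ∀ k, BddDeriv k w) {T : 𝓢'(Euc n, ℂ)} (h0 : MemSobolev 0 2 T)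
    (h : Δ T = smulLeftCLM ℂ (fun x => (w x : ℂ)) T) (k : ℕ) : MemSobolev k 2 T := by
  induction k with
  | zero => simpa using h0
  | succ k ih =>
    have := memSobolev_add_two_of_laplacian ih (by rw [h]; exact MemSobolev.smulLeft sw hw ih)
    exact this.mono (by push_cast; linarith)

theorem memLp_one_add_norm_sq_rpow {r : ℝ} (hr : (n : ℝ) < 2 * r) :
    MemLp (fun x : Euc n => (1 + ‖x‖ ^ 2) ^ (-r / 2)) 2 volume := by
  have hc : Continuous fun x : Euc n => (1 + ‖x‖ ^ 2) ^ (-r / 2) :=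
    Continuous.rpow_const (by fun_prop) fun x => Or.inl (by positivity)
  rw [memLp_two_iff_integrable_sq hc.aestronglyMeasurable]
  have := integrable_rpow_neg_one_add_norm_sq (E := Euc n) (μ := volume) (r := 2 * r) (by simpa)
  refine this.congr (ae_of_all _ fun x => ?_)
  simp only
  rw [← Real.rpow_mul_natCast (by positivity)]
  congr 1; push_cast; ring

/-- A square integrable function in all Sobolev spaces has a smooth representative. -/
theorem exists_contDiff_ae_eq (f : Lp (α := Euc n) ℂ 2)
    (hf : ∀ k : ℕ, MemSobolev k 2 (f : 𝓢'(Euc n, ℂ))) :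
    ∃ χ : Euc n → ℂ, ContDiff ℝ ∞ χ ∧ f =ᵐ[volume] χ := by
  set v : Lp ℂ 2 (volume : Measure (Euc n)) := 𝓕 f with hv
  have hvT : 𝓕 (f : 𝓢'(Euc n, ℂ)) = (v : 𝓢'(Euc n, ℂ)) := Lp.fourier_toTemperedDistribution_eq f
  have hmom : ∀ m : ℕ, Integrable fun ξ => ‖ξ‖ ^ m * ‖v ξ‖ := by
    intro m
    -- Of the order m + n + 1, the part m absorbs |ξ|^m. The part n + 1 leaves the factor
    -- (1+|ξ|²)^(-(n+1)/2), which is in L², so the product with u ∈ L² is integrable.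
    obtain ⟨u, hu⟩ := memSobolev_iff_exists_smulLeftCLM_fourier.1 (hf (m + n + 1))
    set s : ℝ := ((m + n + 1 : ℕ) : ℝ) with hs
    have hbd : MemLp (fun x : Euc n => (((1 + ‖x‖ ^ 2) ^ (-s / 2) : ℝ) : ℂ)) ⊤ volume := by
      refine memLp_top_of_bound (Continuous.aestronglyMeasurable ?_) 1 (ae_of_all _ fun x => ?_)
      · exact Complex.continuous_ofReal.comp
          (Continuous.rpow_const (by fun_prop) fun x => Or.inl (by positivity))
      · rw [Complex.norm_real, Real.norm_of_nonneg (by positivity)]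
        exact Real.rpow_le_one_of_one_le_of_nonpos (by simp) (by
          have : 0 ≤ s := by positivity
          linarith)
    have e1 : ((hbd.toLp • u : Lp (α := Euc n) ℂ 2) : 𝓢'(Euc n, ℂ)) = (v : 𝓢'(Euc n, ℂ)) := by
      rw [Lp.toTemperedDistribution_smul_eq (by fun_prop), ← hu, ← hvT,
        smulLeftCLM_smulLeftCLM_apply (by fun_prop) (by fun_prop)]
      convert smulLeftCLM_const 1 (𝓕 (f : 𝓢'(Euc n, ℂ))) using 2
      · congr 1
        ext x
        simp only [Pi.mul_apply]
        norm_cast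
        rw [← Real.rpow_add (by positivity)]
        ring_nf
        simp
      · simp
    have e2 : (hbd.toLp • u : Lp (α := Euc n) ℂ 2) = v := by
      have : Function.Injective (Lp.toTemperedDistributionCLM ℂ (volume : Measure (Euc n)) 2) :=
        LinearMap.ker_eq_bot.1
          (Lp.ker_toTemperedDistributionCLM_eq_bot (μ := (volume : Measure (Euc n))))
      exact this e1
    have hae : ∀ᵐ ξ, ‖v ξ‖ = (1 + ‖ξ‖ ^ 2) ^ (-s / 2) * ‖u ξ‖ := by
      rw [← e2]
      filter_upwards [Lp.coeFn_lpSMul (r := 2) hbd.toLp u, hbd.coeFn_toLp] with ξ h1 h2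
      rw [h1, Pi.smul_apply', h2, smul_eq_mul, norm_mul, Complex.norm_real,
        Real.norm_of_nonneg (by positivity)]
    have hw := memLp_one_add_norm_sq_rpow (n := n) (r := n + 1) (by
      have : (0 : ℝ) ≤ n := by positivity
      linarith)
    have hint : Integrable fun ξ => (1 + ‖ξ‖ ^ 2) ^ (-((n : ℝ) + 1) / 2) * ‖u ξ‖ :=
      hw.integrable_mul (Lp.memLp u).norm
    refine hint.mono ((by fun_prop : Continuous fun ξ : Euc n => ‖ξ‖ ^ m).aestronglyMeasurable.mul
      (Lp.aestronglyMeasurable v).norm) ?_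
    filter_upwards [hae] with ξ hξ
    rw [hξ, ← mul_assoc, norm_mul, norm_mul (‖ξ‖ ^ m), norm_mul ((1 + ‖ξ‖ ^ 2) ^ (-((n : ℝ) + 1) / 2))]
    refine mul_le_mul_of_nonneg_right ?_ (norm_nonneg _)
    have h1 : ‖ξ‖ ^ m ≤ (1 + ‖ξ‖ ^ 2) ^ ((m : ℝ) / 2) := by
      rw [div_eq_mul_one_div, mul_comm, Real.rpow_mul (by positivity), ← Real.sqrt_eq_rpow,
        Real.rpow_natCast]
      exact pow_le_pow_left₀ (norm_nonneg _) (Real.le_sqrt_of_sq_le (by linarith)) m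
    rw [Real.norm_of_nonneg (by positivity), Real.norm_of_nonneg (by positivity),
      Real.norm_of_nonneg (by positivity)]
    calc ‖ξ‖ ^ m * (1 + ‖ξ‖ ^ 2) ^ (-s / 2) ≤
        (1 + ‖ξ‖ ^ 2) ^ ((m : ℝ) / 2) * (1 + ‖ξ‖ ^ 2) ^ (-s / 2) := by gcongr
      _ = _ := by
        rw [← Real.rpow_add (by positivity)]
        congr 1; rw [hs]; push_cast; ring
  have hvint : Integrable v := by
    have := hmom 0
    simp only [pow_zero, one_mul] at this
    exact (integrable_norm_iff (Lp.aestronglyMeasurable v)).1 this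
  -- The inverse transform of v, written as the transform of its reflection; integrability of all
  -- moments allows differentiation under the integral.
  have hχ : ContDiff ℝ ∞ (𝓕 fun ξ => v (-ξ)) := by
    refine Real.contDiff_fourier (N := ⊤) fun m _ => ?_
    simpa using (hmom m).comp_neg
  refine ⟨𝓕 fun ξ => v (-ξ), hχ, ?_⟩
  -- The two functions agree when tested against compactly supported smooth φ, by moving the Fourier
  -- transform from one factor of the pairing to the other.
  refine ae_eq_of_integral_contDiff_smul_eq ((Lp.memLp f).locallyIntegrable (by norm_num))
    hχ.continuous.locallyIntegrable fun φ sφ cφ => ?_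
  have cφ' : HasCompactSupport (Complex.ofRealCLM ∘ φ) := cφ.comp_left rfl
  have sφ' : ContDiff ℝ ∞ (Complex.ofRealCLM ∘ φ) := by fun_prop
  set ψ : 𝓢(Euc n, ℂ) := cφ'.toSchwartzMap sφ' with hψ
  have e1 : (f : 𝓢'(Euc n, ℂ)) ψ = ∫ x, φ x • f x := by
    rw [Lp.toTemperedDistribution_apply]
    rfl
  have e2 : (f : 𝓢'(Euc n, ℂ)) ψ = (v : 𝓢'(Euc n, ℂ)) (𝓕⁻ ψ) := by
    rw [← hvT, TemperedDistribution.fourier_apply, fourier_fourierInv_eq]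
  rw [← e1, e2, Lp.toTemperedDistribution_apply]
  have e3 : ∀ ξ, (𝓕⁻ ψ) ξ = 𝓕 (ψ : Euc n → ℂ) (-ξ) := by
    intro ξ
    rw [SchwartzMap.fourierInv_coe, Real.fourierInv_eq_fourier_neg]
  simp_rw [e3]
  rw [← integral_neg_eq_self]
  simp only [neg_neg]
  have := VectorFourier.integral_fourierIntegral_smul_eq_flip (μ := volume) (ν := volume)
    (e := Real.fourierChar) (L := innerₗ (Euc n)) (f := (ψ : Euc n → ℂ)) (g := fun ξ => v (-ξ))
    Real.continuous_fourierChar continuous_inner ψ.integrable hvint.comp_neg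
  rw [flip_innerₗ] at this
  exact this

end Regularity

/-! ### Regularity of weak solutions -/

section WeakSolutions

open TemperedDistribution LineDeriv Laplacian
open scoped SchwartzMap

theorem contDiff_clm_schwartz (A : ℂ →L[ℝ] ℝ) (ψ : 𝓢(Euc n, ℂ)) :
    ContDiff ℝ ∞ fun x => A (ψ x) := A.contDiff.comp (ψ.smooth ⊤)

theorem pd_clm_schwartz (A : ℂ →L[ℝ] ℝ) (ψ : 𝓢(Euc n, ℂ)) (i : Fin n) :
    pd i (fun x => A (ψ x)) =
      fun x => A ((∂_{(EuclideanSpace.single i (1 : ℝ) : Euc n)} ψ) x) := by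
  ext x
  have h : HasFDerivAt (fun x => A (ψ x)) (A.comp (fderiv ℝ ψ x)) x :=
    A.hasFDerivAt.comp x ψ.differentiableAt.hasFDerivAt
  rw [pd, h.fderiv, SchwartzMap.lineDerivOp_apply_eq_fderiv]
  rfl

theorem l2Deriv_clm_schwartz (A : ℂ →L[ℝ] ℝ) (ψ : 𝓢(Euc n, ℂ)) (k : ℕ) :
    L2Deriv k fun x => A (ψ x) := by
  induction k generalizing ψ with
  | zero => exact A.comp_memLp' (ψ.memLp 2)
  | succ k ih =>
    refine ⟨A.comp_memLp' (ψ.memLp 2), fun i => ?_⟩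
    rw [pd_clm_schwartz]
    exact ih _

theorem lap_clm_schwartz (A : ℂ →L[ℝ] ℝ) (ψ : 𝓢(Euc n, ℂ)) (x : Euc n) :
    lap (fun x => A (ψ x)) x = A ((Δ ψ) x) := by
  rw [SchwartzMap.laplacian_eq_sum (EuclideanSpace.basisFun (Fin n) ℝ), lap]
  simp_rw [pd_clm_schwartz]
  rw [← map_sum]
  congr 1
  simp

/-- A weak `L²` solution of `Δ F = W F` is smooth, with all derivatives square integrable. -/
theorem exists_contDiff_of_weak {W F : Euc n → ℝ} (sW : ContDiff ℝ ∞ W)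
    (hW : ∀ k, BddDeriv k W) (hF : MemLp F 2 volume)
    (h : ∀ φ : Euc n → ℝ, ContDiff ℝ ∞ φ → (∀ k, L2Deriv k φ) →
      ∫ x, F x * (lap φ x - W x * φ x) = 0) :
    ∃ χ : Euc n → ℝ, ContDiff ℝ ∞ χ ∧ F =ᵐ[volume] χ ∧ (∀ x, lap χ x = W x * χ x) ∧
      ∀ k, L2Deriv k χ := by
  have gW := hasTemperateGrowth_ofReal_comp sW hW
  set f : Lp ℂ 2 (volume : Measure (Euc n)) := hF.ofReal.toLp with hf
  have hfF : ∀ᵐ x, f x = (F x : ℂ) := hF.ofReal.coeFn_toLp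
  have hΔ : Δ (f : 𝓢'(Euc n, ℂ)) = smulLeftCLM ℂ (fun x => (W x : ℂ)) (f : 𝓢'(Euc n, ℂ)) := by
    ext ψ
    rw [laplacian_apply_apply, smulLeftCLM_apply_apply, Lp.toTemperedDistribution_apply,
      Lp.toTemperedDistribution_apply, ← sub_eq_zero]
    have i1 : ∀ ξ : 𝓢(Euc n, ℂ), Integrable fun x => ξ x • f x := fun ξ =>
      (ξ.memLp 2).integrable_mul (Lp.memLp f)
    rw [← integral_sub (i1 _) (i1 _)]
    -- F and W are real, so the identity for a complex test function splits into those for its real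
    -- and imaginary parts, both admissible in the weak formulation.
    have key : ∀ A : ℂ →L[ℝ] ℝ, (∀ (z : ℂ) (r : ℝ), A (z * r) = A z * r) →
        A (∫ x, ((Δ ψ) x • f x -
          (SchwartzMap.smulLeftCLM ℂ (fun x => (W x : ℂ)) ψ) x • f x)) = 0 := by
      intro A hA
      have i2 : Integrable fun x => (Δ ψ) x • f x -
          (SchwartzMap.smulLeftCLM ℂ (fun x => (W x : ℂ)) ψ) x • f x := (i1 _).sub (i1 _)
      rw [← A.integral_comp_comm i2,
        ← h _ (contDiff_clm_schwartz A ψ) (l2Deriv_clm_schwartz A ψ)]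
      refine integral_congr_ae ?_
      filter_upwards [hfF] with x hx
      rw [lap_clm_schwartz, SchwartzMap.smulLeftCLM_apply_apply gW, hx, smul_eq_mul, smul_eq_mul,
        smul_eq_mul, map_sub, hA, hA, mul_comm (W x : ℂ), hA]
      ring
    refine Complex.ext ?_ ?_
    · exact key Complex.reCLM fun z r => by simp
    · exact key Complex.imCLM fun z r => by simp
  obtain ⟨χ, sχ, hχ⟩ := exists_contDiff_ae_eq f
    fun k => memSobolev_of_laplacian_eq sW hW (memSobolev_zero_iff.2 ⟨f, rfl⟩) hΔ k
  have sr : ContDiff ℝ ∞ fun x => (χ x).re := Complex.reCLM.contDiff.comp sχ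
  have hFχ : F =ᵐ[volume] fun x => (χ x).re := by
    filter_upwards [hfF, hχ] with x h1 h2
    rw [← h2, h1, Complex.ofReal_re]
  set u : Euc n → ℝ := fun x => (χ x).re
  have hu : MemLp u 2 volume := hF.ae_eq hFχ
  -- Once the representative is smooth, two integrations by parts against compactly supported φ turn
  -- the weak equation into the pointwise one.
  have hlap : ∀ x, lap u x = W x * u x := by
    have : lap u =ᵐ[volume] fun x => W x * u x := by
      refine ae_eq_of_integral_contDiff_smul_eq sr.lap.continuous.locallyIntegrable
        (sW.continuous.mul sr.continuous).locallyIntegrable fun φ sφ cφ => ?_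
      have cpd : ∀ {φ : Euc n → ℝ} (i : Fin n), HasCompactSupport φ →
          HasCompactSupport (pd i φ) := fun i hφ => hφ.fderiv_apply ℝ _
      have l2 : ∀ k, ∀ φ : Euc n → ℝ, ContDiff ℝ ∞ φ → HasCompactSupport φ → L2Deriv k φ := by
        intro k
        induction k with
        | zero => exact fun φ s c => s.continuous.memLp_of_hasCompactSupport c
        | succ k ih =>
          exact fun φ s c => ⟨s.continuous.memLp_of_hasCompactSupport c,
            fun i => ih _ (s.pd i) (cpd i c)⟩
      have h0 := h φ sφ fun k => l2 k φ sφ cφ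
      have h1 : ∫ x, u x * (lap φ x - W x * φ x) = 0 := by
        rw [← h0]
        refine integral_congr_ae ?_
        filter_upwards [hFχ] with x hx
        rw [hx]
      have ic : ∀ v w : Euc n → ℝ, Continuous v → Continuous w → HasCompactSupport v →
          Integrable fun x => v x * w x := fun v w hv hw cv =>
        (hv.mul hw).integrable_of_hasCompactSupport cv.mul_right
      have e1 : ∫ x, lap φ x * u x = ∫ x, φ x * lap u x := by
        simp only [lap, Finset.sum_mul, Finset.mul_sum]
        rw [integral_finsetSum _ fun i _ => ic _ _ ((sφ.pd i).pd i).continuous sr.continuous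
            (cpd i (cpd i cφ)),
          integral_finsetSum _ fun i _ => ic _ _ sφ.continuous ((sr.pd i).pd i).continuous cφ]
        refine Finset.sum_congr rfl fun i _ => ?_
        rw [integral_mul_pd_of_hasCompactSupport sφ (sr.pd i) cφ,
          integral_mul_pd_of_hasCompactSupport (sφ.pd i) sr (cpd i cφ), neg_neg]
      have cl : HasCompactSupport (lap φ) := by
        refine cφ.mono' (Function.support_subset_iff'.2 fun x hx => ?_)
        refine Finset.sum_eq_zero fun i _ => ?_
        have : x ∉ tsupport (pd i (pd i φ)) := fun hx' => hx
          ((tsupport_fderiv_apply_subset ℝ _ |>.trans (tsupport_fderiv_apply_subset ℝ _)) hx')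
        exact image_eq_zero_of_notMem_tsupport this
      simp only [smul_eq_mul]
      rw [← e1, ← sub_eq_zero, ← integral_sub (ic _ _ sφ.lap.continuous sr.continuous cl)
        (ic φ (fun x => W x * u x) sφ.continuous (sW.continuous.mul sr.continuous) cφ), ← h1]
      exact integral_congr_ae (ae_of_all _ fun x => by ring)
    exact congrFun ((sr.lap.continuous.ae_eq_iff_eq volume
      (sW.continuous.mul sr.continuous)).1 this)
  exact ⟨u, sr, hFχ, hlap, l2Deriv_of_lap_eq sW hW sr hlap hu⟩

end WeakSolutions

/-! ### The energy form of a Schrödinger operator and its kernel -/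

section EnergyForm

/-- The quadratic form of `-Δ + W`. -/
noncomputable def energyForm (W f : Euc n → ℝ) : ℝ := ∫ x, (gradSq f x + W x * f x ^ 2)

/-- The bilinear form of `-Δ + W`. -/
noncomputable def energyBilin (W f h : Euc n → ℝ) : ℝ :=
  ∫ x, ((∑ i, pd i f x * pd i h x) + W x * (f x * h x))

theorem L2Deriv.memLp_pd {f : Euc n → ℝ} {k : ℕ} (hf : L2Deriv (k + 1) f) (i : Fin n) :
    MemLp (pd i f) 2 volume := (hf.2 i).memLp

theorem L2Deriv.memLp_lap {f : Euc n → ℝ} (hf : L2Deriv 2 f) : MemLp (lap f) 2 volume := by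
  have : lap f = ∑ i, pd i (pd i f) := by
    ext x
    simp [lap]
  rw [this]
  exact memLp_finsetSum' _ fun i _ => (hf.2 i).memLp_pd i

theorem integrable_sum_pd_mul_pd {f h : Euc n → ℝ} (hf : L2Deriv 1 f) (hh : L2Deriv 1 h) :
    Integrable fun x => ∑ i, pd i f x * pd i h x :=
  integrable_finsetSum _ fun i _ => (hf.memLp_pd i).integrable_mul (hh.memLp_pd i)

theorem integrable_gradSq {f : Euc n → ℝ} (hf : L2Deriv 1 f) : Integrable (gradSq f) :=
  integrable_finsetSum _ fun i _ => (hf.memLp_pd i).integrable_sq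

theorem integrable_bdd_mul_mul {W f h : Euc n → ℝ} (cW : Continuous W)
    (hW : ∃ C, ∀ x, |W x| ≤ C) (hf : MemLp f 2 volume) (hh : MemLp h 2 volume) :
    Integrable fun x => W x * (f x * h x) := by
  have := (MemLp.bdd_mul' cW hW hf).integrable_mul hh
  exact this.congr (ae_of_all _ fun x => mul_assoc _ _ _)

theorem integrable_bdd_mul_sq {W f : Euc n → ℝ} (cW : Continuous W)
    (hW : ∃ C, ∀ x, |W x| ≤ C) (hf : MemLp f 2 volume) : Integrable fun x => W x * f x ^ 2 :=
  (integrable_bdd_mul_mul cW hW hf hf).congr (ae_of_all _ fun x => by simp only; ring)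

theorem energyForm_add_mul {W f h : Euc n → ℝ} (cW : Continuous W)
    (hW : ∃ C, ∀ x, |W x| ≤ C) (sf : ContDiff ℝ ∞ f) (sh : ContDiff ℝ ∞ h) (hf : L2Deriv 1 f)
    (hh : L2Deriv 1 h) (t : ℝ) :
    energyForm W (fun x => f x + t * h x) =
      energyForm W h * (t * t) + 2 * energyBilin W f h * t + energyForm W f := by
  have i1 : Integrable fun x => gradSq h x + W x * h x ^ 2 :=
    (integrable_gradSq hh).add (integrable_bdd_mul_sq cW hW hh.memLp)
  have i2 : Integrable fun x => (∑ i, pd i f x * pd i h x) + W x * (f x * h x) :=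
    (integrable_sum_pd_mul_pd hf hh).add (integrable_bdd_mul_mul cW hW hf.memLp hh.memLp)
  have i3 : Integrable fun x => gradSq f x + W x * f x ^ 2 :=
    (integrable_gradSq hf).add (integrable_bdd_mul_sq cW hW hf.memLp)
  have i4 : Integrable fun x => (gradSq h x + W x * h x ^ 2) * (t * t) +
      2 * t * ((∑ i, pd i f x * pd i h x) + W x * (f x * h x)) :=
    (i1.mul_const _).add (i2.const_mul _)
  simp only [energyForm, energyBilin]
  rw [mul_right_comm, ← integral_mul_const, ← integral_const_mul,
    ← integral_add (i1.mul_const _) (i2.const_mul _),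
    ← integral_add i4 i3]
  refine integral_congr_ae (ae_of_all _ fun x => ?_)
  have hp : ∀ i, pd i (fun x => f x + t * h x) x = pd i f x + t * pd i h x := fun i => by
    rw [pd_add (Smooth.differentiable sf x) ((Smooth.differentiable sh x).const_mul t),
      pd_const_mul (Smooth.differentiable sh x)]
  have hg : gradSq (fun x => f x + t * h x) x =
      gradSq f x + 2 * t * (∑ i, pd i f x * pd i h x) + t ^ 2 * gradSq h x := by
    simp only [gradSq, hp, Finset.mul_sum, ← Finset.sum_add_distrib]
    exact Finset.sum_congr rfl fun i _ => by ring
  simp only [hg]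
  ring

theorem L2Deriv.const_mul {k : ℕ} {f : Euc n → ℝ} (sf : ContDiff ℝ ∞ f) (hf : L2Deriv k f)
    (c : ℝ) : L2Deriv k fun x => c * f x :=
  L2Deriv.bdd_mul contDiff_const sf (BddDeriv.const k c) hf

/-- Cauchy–Schwarz for a semidefinite form: the form at f + th is a nonnegative quadratic polynomial
in t, so its discriminant is nonpositive. -/
theorem energyBilin_sq_le {W f h : Euc n → ℝ} (cW : Continuous W)
    (hW : ∃ C, ∀ x, |W x| ≤ C)
    (hQ : ∀ f : Euc n → ℝ, ContDiff ℝ ∞ f → L2Deriv 1 f → 0 ≤ energyForm W f)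
    (sf : ContDiff ℝ ∞ f) (sh : ContDiff ℝ ∞ h) (hf : L2Deriv 1 f) (hh : L2Deriv 1 h) :
    energyBilin W f h ^ 2 ≤ energyForm W h * energyForm W f := by
  have := discrim_le_zero (a := energyForm W h) (b := 2 * energyBilin W f h)
    (c := energyForm W f) fun t => by
      rw [← energyForm_add_mul cW hW sf sh hf hh]
      exact hQ _ (sf.add (contDiff_const.mul sh))
        (L2Deriv.add sf (contDiff_const.mul sh) hf (hh.const_mul sh t))
  rw [discrim] at this
  linarith

/-- Green's formula. The field f∇h is integrable, so its divergence has integral 0. -/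
theorem energyBilin_eq_integral_lap {W f h : Euc n → ℝ} (cW : Continuous W)
    (hW : ∃ C, ∀ x, |W x| ≤ C) (sf : ContDiff ℝ ∞ f) (sh : ContDiff ℝ ∞ h) (hf : L2Deriv 1 f)
    (hh : L2Deriv 2 h) :
    energyBilin W f h = -∫ x, f x * (lap h x - W x * h x) := by
  have hl : MemLp (lap h) 2 volume := hh.memLp_lap
  have hdiv : ∀ x, ∑ i, pd i (fun y => f y * pd i h y) x =
      (∑ i, pd i f x * pd i h x) + f x * lap h x := by
    intro x
    rw [lap, Finset.mul_sum, ← Finset.sum_add_distrib]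
    exact Finset.sum_congr rfl fun i _ =>
      pd_mul (Smooth.differentiable sf x) (Smooth.differentiable (sh.pd i) x) i
  have i1 := integrable_sum_pd_mul_pd hf (L2Deriv.pred hh)
  have i2 : Integrable fun x => f x * lap h x := hf.memLp.integrable_mul hl
  have i3 := integrable_bdd_mul_mul cW hW hf.memLp hh.memLp
  have h0 := integral_div_eq_zero (Z := fun i y => f y * pd i h y)
    (k := fun x => ∑ i, |f x * pd i h x|) (fun i => sf.mul (sh.pd i))
    (integrable_finsetSum _ fun i _ => (hf.memLp.integrable_mul (hh.memLp_pd i)).abs)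
    (fun i x => by
      have h1 : |f x * pd i h x| ≤ ∑ i, |f x * pd i h x| :=
        Finset.single_le_sum (f := fun i => |f x * pd i h x|) (fun j _ => abs_nonneg _)
          (Finset.mem_univ i)
      nlinarith [norm_nonneg x, abs_nonneg (f x * pd i h x)])
    (by simp only [hdiv]; exact i1.add i2)
  simp only [hdiv] at h0
  rw [integral_add i1 i2] at h0
  rw [energyBilin, integral_add i1 i3, ← integral_neg]
  have : ∫ x, -(f x * (lap h x - W x * h x)) = ∫ x, (-(f x * lap h x) + W x * (f x * h x)) :=
    integral_congr_ae (ae_of_all _ fun x => by ring)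
  have i2' : Integrable fun x => -(f x * lap h x) := i2.neg
  rw [this, integral_add i2' i3, integral_neg]
  linarith

/-- The weak limit of a sequence along which a nonnegative energy form tends to zero is a smooth
element of the kernel. -/
theorem exists_contDiff_of_energyForm_tendsto {W F : Euc n → ℝ} (sW : ContDiff ℝ ∞ W)
    (hW : ∀ k, BddDeriv k W)
    (hQ : ∀ f : Euc n → ℝ, ContDiff ℝ ∞ f → L2Deriv 1 f → 0 ≤ energyForm W f)
    {f : ℕ → Euc n → ℝ} (sf : ∀ k, ContDiff ℝ ∞ (f k)) (hf : ∀ k, L2Deriv 1 (f k))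
    (hlim : Tendsto (fun k => energyForm W (f k)) atTop (𝓝 0)) (hF : MemLp F 2 volume)
    (hweak : ∀ h : Euc n → ℝ, MemLp h 2 volume →
      Tendsto (fun k => ∫ x, f k x * h x) atTop (𝓝 (∫ x, F x * h x))) :
    ∃ χ : Euc n → ℝ, ContDiff ℝ ∞ χ ∧ F =ᵐ[volume] χ ∧ (∀ x, lap χ x = W x * χ x) ∧
      ∀ k, L2Deriv k χ := by
  refine exists_contDiff_of_weak sW hW hF fun φ sφ hφ => ?_
  have hl : MemLp (fun x => lap φ x - W x * φ x) 2 volume :=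
    (hφ 2).memLp_lap.sub
      (MemLp.bdd_mul' sW.continuous (hW 0).bdd (hφ 0).memLp)
  have h1 : ∀ k, energyBilin W (f k) φ = -∫ x, f k x * (lap φ x - W x * φ x) := fun k =>
    energyBilin_eq_integral_lap sW.continuous (hW 0).bdd (sf k) sφ (hf k) (hφ 2)
  -- By Cauchy–Schwarz the bilinear form of f k with φ is controlled by the energies of f k, which
  -- tend to 0. Weak convergence identifies its limit with the weak equation for F.
  have h2 : Tendsto (fun k => (∫ x, f k x * (lap φ x - W x * φ x)) ^ 2) atTop (𝓝 0) := by
    refine squeeze_zero (fun k => sq_nonneg _) (fun k => ?_)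
      (by simpa using hlim.const_mul (energyForm W φ))
    have := energyBilin_sq_le sW.continuous (hW 0).bdd hQ (sf k) sφ (hf k) (hφ 1)
    rwa [h1, neg_sq] at this
  exact pow_eq_zero_iff two_ne_zero |>.1 (tendsto_nhds_unique ((hweak _ hl).pow 2) h2)

theorem energyForm_eq_zero_of_lap_eq {W χ : Euc n → ℝ} (cW : Continuous W)
    (hW : ∃ C, ∀ x, |W x| ≤ C) (sχ : ContDiff ℝ ∞ χ) (hχ : L2Deriv 2 χ)
    (h : ∀ x, lap χ x = W x * χ x) : energyForm W χ = 0 := by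
  have h1 := energyBilin_eq_integral_lap cW hW sχ sχ hχ.pred hχ
  simp only [h, sub_self, mul_zero, integral_zero, neg_zero] at h1
  rw [← h1]
  exact integral_congr_ae (ae_of_all _ fun x => by simp [gradSq, sq])

/-- The absolute value of an element of the kernel of a nonnegative Schrödinger operator is
again in the kernel. -/
theorem abs_solution {W χ : Euc n → ℝ} (sW : ContDiff ℝ ∞ W)
    (hW : ∀ k, BddDeriv k W)
    (hQ : ∀ f : Euc n → ℝ, ContDiff ℝ ∞ f → L2Deriv 1 f → 0 ≤ energyForm W f)
    (sχ : ContDiff ℝ ∞ χ) (hχ : ∀ k, L2Deriv k χ) (h : ∀ x, lap χ x = W x * χ x) :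
    ContDiff ℝ ∞ (fun x => |χ x|) ∧ (∀ x, lap (fun x => |χ x|) x = W x * |χ x|) ∧
      ∀ k, L2Deriv k fun x => |χ x| := by
  let ε : ℕ → ℝ := fun k => 1 / ((k : ℝ) + 1)
  have hε : ∀ k, 0 < ε k := fun k => by positivity
  have hε0 : Tendsto ε atTop (𝓝 0) := tendsto_one_div_add_atTop_nhds_zero_nat
  -- Smooth approximations of |s| with slope at most 1. Subtracting ε gives |φ k s| ≤ |s|, so the
  -- composition with χ remains in L².
  let φ : ℕ → ℝ → ℝ := fun k s => √(s ^ 2 + ε k ^ 2) - ε k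
  have hpos : ∀ k s, 0 < s ^ 2 + ε k ^ 2 := fun k s => by have := hε k; positivity
  have sφ : ∀ k, ContDiff ℝ ∞ (φ k) := fun k =>
    (ContDiff.sqrt (by fun_prop) fun s => (hpos k s).ne').sub contDiff_const
  have dφ : ∀ k s, HasDerivAt (φ k) (s / √(s ^ 2 + ε k ^ 2)) s := by
    intro k s
    have h1 : HasDerivAt (fun s : ℝ => s ^ 2 + ε k ^ 2) (2 * s) s := by
      simpa using (hasDerivAt_pow 2 s).add_const (ε k ^ 2)
    have := (h1.sqrt (hpos k s).ne').sub_const (ε k)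
    rwa [mul_div_mul_left _ _ (two_ne_zero' ℝ)] at this
  have bφ : ∀ k s, |φ k s| ≤ |s| := by
    intro k s
    have h1 : ε k ≤ √(s ^ 2 + ε k ^ 2) := Real.le_sqrt_of_sq_le (by nlinarith [sq_nonneg s])
    rw [abs_of_nonneg (sub_nonneg.2 h1), sub_le_iff_le_add, Real.sqrt_le_left
      (by have := hε k; positivity)]
    nlinarith [sq_abs s, abs_nonneg s, hε k]
  have lφ : ∀ s, Tendsto (fun k => φ k s) atTop (𝓝 |s|) := by
    intro s
    have : Tendsto (fun k => √(s ^ 2 + ε k ^ 2) - ε k) atTop (𝓝 (√(s ^ 2 + 0 ^ 2) - 0)) :=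
      ((tendsto_const_nhds.add (hε0.pow 2)).sqrt).sub hε0
    simpa [Real.sqrt_sq_eq_abs] using this
  let f : ℕ → Euc n → ℝ := fun k x => φ k (χ x)
  have sf : ∀ k, ContDiff ℝ ∞ (f k) := fun k => (sφ k).comp sχ
  have pf : ∀ k i x, pd i (f k) x = χ x / √(χ x ^ 2 + ε k ^ 2) * pd i χ x := fun k i x =>
    pd_comp (dφ k (χ x)) (Smooth.differentiable sχ x) i
  have bpf : ∀ k i x, |pd i (f k) x| ≤ |pd i χ x| := by
    intro k i x
    rw [pf, abs_mul, abs_div, abs_of_nonneg (Real.sqrt_nonneg _)]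
    refine mul_le_of_le_one_left (abs_nonneg _) (div_le_one_of_le₀ ?_ (Real.sqrt_nonneg _))
    exact Real.abs_le_sqrt (by nlinarith [hε k])
  have hf : ∀ k, L2Deriv 1 (f k) := fun k =>
    ⟨(hχ 0).memLp.mono (sf k).continuous.aestronglyMeasurable
      (ae_of_all _ fun x => bφ k (χ x)), fun i => ((hχ 1).memLp_pd i).mono
        ((sf k).pd i).continuous.aestronglyMeasurable (ae_of_all _ fun x => bpf k i x)⟩
  have cW := sW.continuous
  have hWb := (hW 0).bdd
  -- The gradients of f k are dominated by that of χ and the potential terms converge, so the upper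
  -- limit of the energies is at most the energy of χ, which is 0.
  have hlim : Tendsto (fun k => energyForm W (f k)) atTop (𝓝 0) := by
    have h1 : Tendsto (fun k => (∫ x, gradSq χ x) + ∫ x, W x * f k x ^ 2) atTop
        (𝓝 ((∫ x, gradSq χ x) + ∫ x, W x * |χ x| ^ 2)) := by
      refine tendsto_const_nhds.add ?_
      refine tendsto_integral_of_dominated_convergence (fun x => |W x * χ x ^ 2|)
        (fun k => (cW.mul ((sf k).continuous.pow 2)).aestronglyMeasurable)
        (integrable_bdd_mul_sq cW hWb (hχ 0).memLp).abs (fun k => ae_of_all _ fun x => ?_)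
        (ae_of_all _ fun x => ((lφ _).pow 2).const_mul _)
      rw [Real.norm_eq_abs, abs_mul, abs_mul, abs_pow, abs_pow]
      exact mul_le_mul_of_nonneg_left (pow_le_pow_left₀ (abs_nonneg _) (bφ k _) 2) (abs_nonneg _)
    have h2 : (∫ x, gradSq χ x) + ∫ x, W x * |χ x| ^ 2 = 0 := by
      simp only [sq_abs]
      rw [← integral_add (integrable_gradSq (hχ 1)) (integrable_bdd_mul_sq cW hWb (hχ 0).memLp)]
      exact energyForm_eq_zero_of_lap_eq cW hWb sχ (hχ 2) h
    rw [h2] at h1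
    refine squeeze_zero (fun k => hQ _ (sf k) (hf k)) (fun k => ?_) h1
    rw [energyForm, integral_add (integrable_gradSq (hf k))
      (integrable_bdd_mul_sq cW hWb (hf k).memLp)]
    refine add_le_add_left ?_ _
    refine integral_mono (integrable_gradSq (hf k)) (integrable_gradSq (hχ 1)) fun x => ?_
    exact Finset.sum_le_sum fun i _ => sq_le_sq.2 (bpf k i x)
  obtain ⟨u, su, hu, hlap, hu2⟩ := exists_contDiff_of_energyForm_tendsto (F := fun x => |χ x|)
    sW hW hQ sf hf hlim (hχ 0).memLp.abs fun h hh => by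
      refine tendsto_integral_of_dominated_convergence (fun x => |χ x * h x|)
        (fun k => (sf k).continuous.aestronglyMeasurable.mul hh.aestronglyMeasurable)
        ((hχ 0).memLp.integrable_mul hh).abs (fun k => ae_of_all _ fun x => ?_)
        (ae_of_all _ fun x => (lφ _).mul_const _)
      rw [Real.norm_eq_abs, abs_mul, abs_mul]
      exact mul_le_mul_of_nonneg_right (bφ k _) (abs_nonneg _)
  have : (fun x => |χ x|) = u := (sχ.continuous.abs.ae_eq_iff_eq volume su.continuous).1 hu
  rw [this]
  exact ⟨su, fun x => by rw [hlap, ← this], hu2⟩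

end EnergyForm

/-! ### The strong maximum principle by Hopf's barrier -/

section StrongMaximumPrinciple

theorem contDiff_exp_norm_sub_sq (α : ℝ) (z : Euc n) :
    ContDiff ℝ ∞ fun y : Euc n => Real.exp (-α * ‖y - z‖ ^ 2) :=
  (contDiff_const.mul (contDiff_norm_sub_sq z)).exp

theorem pd_exp_norm_sub_sq (α : ℝ) (z : Euc n) (i : Fin n) :
    pd i (fun y : Euc n => Real.exp (-α * ‖y - z‖ ^ 2)) =
      fun x => (-2 * α) * ((x i - z i) * Real.exp (-α * ‖x - z‖ ^ 2)) := by
  ext x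
  have d := Smooth.differentiable (contDiff_norm_sub_sq z) x
  rw [pd_comp (φ := Real.exp) (Real.hasDerivAt_exp _) (d.const_mul (-α)), pd_const_mul d,
    pd_norm_sub_sq]
  ring

theorem lap_exp_norm_sub_sq (α : ℝ) (z x : Euc n) :
    lap (fun y : Euc n => Real.exp (-α * ‖y - z‖ ^ 2)) x =
      (4 * α ^ 2 * ‖x - z‖ ^ 2 - 2 * n * α) * Real.exp (-α * ‖x - z‖ ^ 2) := by
  have dc : ∀ i : Fin n, DifferentiableAt ℝ (fun y : Euc n => y i - z i) x := fun i =>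
    (Smooth.differentiable (contDiff_coord i) x).sub_const _
  have de := Smooth.differentiable (contDiff_exp_norm_sub_sq α z) x
  have h : ∀ i, pd i (pd i (fun y : Euc n => Real.exp (-α * ‖y - z‖ ^ 2))) x =
      (4 * α ^ 2 * (x i - z i) ^ 2 - 2 * α) * Real.exp (-α * ‖x - z‖ ^ 2) := by
    intro i
    have dm : DifferentiableAt ℝ (fun y : Euc n => (y i - z i) * Real.exp (-α * ‖y - z‖ ^ 2)) x :=
      (dc i).mul de
    rw [pd_exp_norm_sub_sq, pd_const_mul dm, pd_mul (dc i) de, pd_exp_norm_sub_sq,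
      pd_sub (Smooth.differentiable (contDiff_coord i) x) (differentiableAt_const _), pd_coord,
      pd_const]
    simp only [if_true]
    ring
  simp only [lap, h]
  rw [← Finset.sum_mul, Finset.sum_sub_distrib, ← Finset.mul_sum, norm_sq_eq_sum]
  simp only [Finset.sum_const, Finset.card_univ, Fintype.card_fin, nsmul_eq_mul, PiLp.sub_apply]
  ring

/-- The strong maximum principle for nonnegative solutions of `Δu = Wu`. -/
theorem pos_of_lap_eq {W u : Euc n → ℝ} (hW : ∃ C, ∀ x, |W x| ≤ C) (su : ContDiff ℝ ∞ u)
    (h : ∀ x, lap u x = W x * u x) (h0 : ∀ x, 0 ≤ u x) {p : Euc n} (hp : 0 < u p) (x : Euc n) :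
    0 < u x := by
  by_contra hx
  have hx0 : u x = 0 := le_antisymm (not_lt.1 hx) (h0 x)
  -- x₀ is a zero of u nearest to p, so u > 0 in the open ball around p through x₀.
  obtain ⟨x₀, hx₀, hmin⟩ := (isClosed_singleton.preimage su.continuous :
    IsClosed (u ⁻¹' {0})).exists_infDist_eq_dist ⟨x, hx0⟩ p
  replace hx₀ : u x₀ = 0 := hx₀
  have hball : ∀ y, dist p y < dist p x₀ → 0 < u y := fun y hy =>
    (h0 y).lt_of_ne' fun h => by
      have := Metric.infDist_le_dist_of_mem (x := p) (show y ∈ u ⁻¹' {0} from h)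
      linarith
  set R := dist p x₀ with hR
  have hR0 : 0 < R := dist_pos.2 fun e => by rw [e, hx₀] at hp; exact hp.false
  obtain ⟨C, hC⟩ := hW
  have hC0 : 0 ≤ C := (abs_nonneg _).trans (hC p)
  -- Large α makes the Gaussian barrier satisfy ΔE > CE where ‖y - p‖ > R/2, since there 4α²‖y - p‖²
  -- - 2nα ≥ α²R² - 2nα > C.
  obtain ⟨α, hα0, hα⟩ : ∃ α : ℝ, 0 < α ∧ 2 * n * α + C < α ^ 2 * R ^ 2 := by
    refine ⟨(2 * n + C + 1) / R ^ 2 + 1, by positivity, ?_⟩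
    set a := (2 * n + C + 1) / R ^ 2 with ha
    have ha0 : 0 ≤ a := by positivity
    have : a * R ^ 2 = 2 * n + C + 1 := by rw [ha]; field_simp
    have h2 : (a + 1) ^ 2 * R ^ 2 = (a + 1) * (a * R ^ 2) + (a + 1) * R ^ 2 := by ring
    rw [h2, this]
    nlinarith [mul_pos (show (0 : ℝ) < a + 1 by linarith) (pow_pos hR0 2), mul_nonneg ha0 hC0]
  set E : Euc n → ℝ := fun y => Real.exp (-α * ‖y - p‖ ^ 2) with hE
  have sE : ContDiff ℝ ∞ E := contDiff_exp_norm_sub_sq α p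
  set b := Real.exp (-α * R ^ 2) with hb
  have hb0 : 0 < b := Real.exp_pos _
  obtain ⟨δ, hδ0, hδ⟩ : ∃ δ > 0, ∀ y, dist p y ≤ R / 2 → δ ≤ u y := by
    obtain ⟨q, hq, hqm⟩ := (isCompact_closedBall p (R / 2)).exists_isMinOn
      ⟨p, Metric.mem_closedBall_self (by positivity)⟩ su.continuous.continuousOn
    refine ⟨u q, hball q ?_, fun y hy => hqm (by rwa [Metric.mem_closedBall, dist_comm])⟩
    rw [Metric.mem_closedBall, dist_comm] at hq
    linarith
  -- Nonnegative on the sphere of radius R, where E = b, and on the ball of radius R/2, where u ≥ δ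
  -- ≥ δE. At a negative minimum in between, u < δE, so Δw ≤ CδE - δΔE < 0, which is impossible.
  set w : Euc n → ℝ := fun y => u y - δ * (E y - b) with hw
  have sw : ContDiff ℝ ∞ w := su.sub (contDiff_const.mul (sE.sub contDiff_const))
  have hE1 : ∀ y, E y ≤ 1 := fun y => Real.exp_le_one_iff.2 (by nlinarith [sq_nonneg ‖y - p‖])
  have hlapw : ∀ y, lap w y = W y * u y - δ * lap E y := by
    intro y
    have e1 : w = fun y => u y + (-δ) * (E y + -b) := by ext y; simp only [hw]; ring
    rw [e1, lap_add su (contDiff_const.mul (sE.add contDiff_const)),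
      lap_const_mul (sE.add contDiff_const), lap_add sE contDiff_const, h]
    have : lap (fun _ : Euc n => -b) y = 0 := by
      simp only [lap]
      refine Finset.sum_eq_zero fun i _ => ?_
      have : pd i (fun _ : Euc n => -b) = fun _ => 0 := funext fun y => pd_const _ _ _
      rw [this, pd_const]
    rw [this]; ring
  have hwn : ∀ y ∈ Metric.closedBall p R, 0 ≤ w y := by
    obtain ⟨q, hq, hqm⟩ := (isCompact_closedBall p R).exists_isMinOn
      ⟨p, Metric.mem_closedBall_self hR0.le⟩ sw.continuous.continuousOn
    suffices 0 ≤ w q from fun y hy => this.trans (hqm hy)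
    by_contra! hneg
    have hqR : ‖q - p‖ ≤ R := by rwa [Metric.mem_closedBall, dist_eq_norm] at hq
    have hq1 : ‖q - p‖ < R := by
      refine hqR.lt_of_ne fun e => ?_
      have : w q = u q := by simp only [hw, hE, e, ← hb]; ring
      linarith [h0 q]
    have hq2 : R / 2 < ‖q - p‖ := by
      by_contra! hle
      have := hδ q (by rwa [dist_comm, dist_eq_norm])
      have h3 := hE1 q
      simp only [hw] at hneg
      nlinarith
    have hloc : IsLocalMin w q := hqm.isLocalMin
      (Metric.closedBall_mem_nhds_of_mem (by rwa [Metric.mem_ball, dist_eq_norm]))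
    have h1 := hloc.lap_nonneg sw
    rw [hlapw, lap_exp_norm_sub_sq] at h1
    have hEq : 0 < E q := Real.exp_pos _
    have h2 : W q * u q ≤ C * (δ * E q) := by
      have h3 : u q ≤ δ * E q := by simp only [hw] at hneg; nlinarith
      calc W q * u q ≤ C * u q := mul_le_mul_of_nonneg_right ((le_abs_self _).trans (hC q)) (h0 q)
        _ ≤ _ := mul_le_mul_of_nonneg_left h3 hC0
    have h4 : C < 4 * α ^ 2 * ‖q - p‖ ^ 2 - 2 * n * α := by
      have : α ^ 2 * R ^ 2 ≤ 4 * α ^ 2 * ‖q - p‖ ^ 2 := by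
        have : R ^ 2 ≤ 4 * ‖q - p‖ ^ 2 := by nlinarith
        nlinarith [sq_nonneg α]
      linarith
    have h5 : δ * (C * E q) < δ * ((4 * α ^ 2 * ‖q - p‖ ^ 2 - 2 * n * α) * E q) :=
      mul_lt_mul_of_pos_left (mul_lt_mul_of_pos_right h4 hEq) hδ0
    have h6 : E q = Real.exp (-α * ‖q - p‖ ^ 2) := rfl
    rw [← h6] at h1
    linarith
  have hnx : ‖x₀ - p‖ = R := by rw [hR, dist_comm, dist_eq_norm]
  have hw0 : w x₀ = 0 := by simp only [hw, hE, hx₀, hnx, ← hb]; ring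
  have hgrad : ∀ i, pd i w x₀ = 2 * α * δ * b * (x₀ i - p i) := by
    intro i
    have hmin0 : IsLocalMax (fun y => - u y) x₀ := by
      refine (IsLocalMin.neg ?_)
      exact Filter.Eventually.of_forall fun y => by rw [hx₀]; exact h0 y
    have h1 : pd i u x₀ = 0 := by
      have := hmin0.pd_eq_zero i
      rwa [pd_neg, neg_eq_zero] at this
    rw [hw, pd_sub (Smooth.differentiable su x₀)
      (((Smooth.differentiable sE x₀).sub_const b).const_mul δ),
      pd_const_mul ((Smooth.differentiable sE x₀).sub_const b),
      pd_sub (Smooth.differentiable sE x₀) (differentiableAt_const b), pd_const, h1,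
      hE, pd_exp_norm_sub_sq]
    simp only [hnx, ← hb]
    ring
  -- At x₀ the function u has a minimum, so ∇w comes from the barrier alone. From w x₀ = 0 the
  -- function w decreases strictly towards p, against w ≥ 0 in the ball.
  have hder : HasDerivAt (fun t : ℝ => w (x₀ + t • (p - x₀))) (-(2 * α * δ * b * R ^ 2)) 0 := by
    have h1 : HasDerivAt (fun t : ℝ => x₀ + t • (p - x₀)) (p - x₀) 0 := by
      simpa using ((hasDerivAt_id (0 : ℝ)).smul_const (p - x₀)).const_add x₀
    have h2 : HasFDerivAt w (fderiv ℝ w x₀) (x₀ + (0 : ℝ) • (p - x₀)) := by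
      simpa using (Smooth.differentiable sw x₀).hasFDerivAt
    have h3 := h2.comp_hasDerivAt (0 : ℝ) h1
    suffices h4 : fderiv ℝ w x₀ (p - x₀) = -(2 * α * δ * b * R ^ 2) by rwa [h4] at h3
    rw [fderiv_eq_sum_pd, ← hnx, norm_sq_eq_sum, Finset.mul_sum, ← Finset.sum_neg_distrib]
    refine Finset.sum_congr rfl fun i _ => ?_
    rw [hgrad]
    simp only [PiLp.sub_apply]
    ring
  have hneg : -(2 * α * δ * b * R ^ 2) < 0 := by
    have : 0 < 2 * α * δ * b * R ^ 2 := by positivity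
    linarith
  have hslope := hder.hasDerivWithinAt (s := Set.Ioi 0)
  rw [hasDerivWithinAt_iff_tendsto_slope' (by simp)] at hslope
  have hev := hslope.eventually (gt_mem_nhds hneg)
  have hev2 : ∀ᶠ t : ℝ in 𝓝[>] 0, t < 1 :=
    nhdsWithin_le_nhds (gt_mem_nhds one_pos)
  obtain ⟨t, ht, ht1, ht0⟩ := (hev.and (hev2.and self_mem_nhdsWithin)).exists
  replace ht0 : 0 < t := ht0
  rw [slope_def_field] at ht
  simp only [zero_smul, add_zero, hw0, sub_zero] at ht
  have := hwn (x₀ + t • (p - x₀)) (by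
    rw [Metric.mem_closedBall, dist_eq_norm]
    have : x₀ + t • (p - x₀) - p = (1 - t) • (x₀ - p) := by module
    rw [this, norm_smul, hnx, Real.norm_of_nonneg (by linarith)]
    nlinarith)
  exact absurd ht (not_lt.2 (div_nonneg this ht0.le))

end StrongMaximumPrinciple

/-! ### Weak sequential compactness in L² -/

section WeakCompactness

theorem sq_integral_mul_le {α : Type*} [MeasurableSpace α] {μ : Measure α} {f g : α → ℝ}
    (hf : MemLp f 2 μ) (hg : MemLp g 2 μ) :
    (∫ x, f x * g x ∂μ) ^ 2 ≤ (∫ x, f x ^ 2 ∂μ) * ∫ x, g x ^ 2 ∂μ := by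
  have i1 := hf.integrable_sq
  have i2 := hg.integrable_sq
  have i3 : Integrable (fun x => f x * g x) μ := hf.integrable_mul hg
  have i4 : ∀ t : ℝ, Integrable (fun x => g x ^ 2 * (t * t) + 2 * t * (f x * g x)) μ := fun t =>
    (i2.mul_const (t * t)).add (i3.const_mul (2 * t))
  have := discrim_le_zero (a := ∫ x, g x ^ 2 ∂μ) (b := 2 * ∫ x, f x * g x ∂μ)
    (c := ∫ x, f x ^ 2 ∂μ) fun t => by
      have e : ∫ x, (f x + t * g x) ^ 2 ∂μ = (∫ x, g x ^ 2 ∂μ) * (t * t) +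
          2 * (∫ x, f x * g x ∂μ) * t + ∫ x, f x ^ 2 ∂μ := by
        rw [mul_right_comm, ← integral_mul_const, ← integral_const_mul,
          ← integral_add (i2.mul_const _) (i3.const_mul _),
          ← integral_add (i4 t) i1]
        exact integral_congr_ae (ae_of_all _ fun x => by simp only; ring)
      rw [← e]
      exact integral_nonneg fun x => sq_nonneg _
  rw [discrim] at this
  linarith

theorem abs_integral_mul_le {α : Type*} [MeasurableSpace α] {μ : Measure α} {f g : α → ℝ}
    (hf : MemLp f 2 μ) (hg : MemLp g 2 μ) :
    |∫ x, f x * g x ∂μ| ≤ √(∫ x, f x ^ 2 ∂μ) * √(∫ x, g x ^ 2 ∂μ) := by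
  rw [← Real.sqrt_mul (integral_nonneg fun x => sq_nonneg _)]
  exact Real.abs_le_sqrt (sq_integral_mul_le hf hg)

/-- Bounded sequences in `L²` have weakly convergent subsequences. -/
theorem exists_weak_limit {f : ℕ → Euc n → ℝ} (hf : ∀ k, MemLp (f k) 2 volume) {K : ℝ}
    (hK : ∀ k, ∫ x, f k x ^ 2 ≤ K) :
    ∃ F : Euc n → ℝ, MemLp F 2 volume ∧ ∃ φ : ℕ → ℕ, StrictMono φ ∧
      ∀ h : Euc n → ℝ, MemLp h 2 volume →
        Tendsto (fun k => ∫ x, f (φ k) x * h x) atTop (𝓝 (∫ x, F x * h x)) := by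
  have hin : ∀ {a b : Euc n → ℝ} (ha : MemLp a 2 volume) (hb : MemLp b 2 volume),
      inner ℝ ha.toLp hb.toLp = ∫ x, a x * b x := by
    intro a b ha hb
    rw [L2.inner_def]
    refine integral_congr_ae ?_
    filter_upwards [ha.coeFn_toLp, hb.coeFn_toLp] with x h1 h2
    rw [h1, h2]
    simp [mul_comm]
  have : Fact ((2 : ENNReal) ≠ ⊤) := ⟨by simp⟩
  -- By the Riesz isometry the sequence becomes a bounded sequence of functionals, to which
  -- sequential Banach–Alaoglu applies.
  let T : Lp ℝ 2 (volume : Measure (Euc n)) → WeakDual ℝ (Lp ℝ 2 (volume : Measure (Euc n))) :=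
    fun u => StrongDual.toWeakDual (InnerProductSpace.toDual ℝ _ u)
  have hmem : ∀ k, T (hf k).toLp ∈
      WeakDual.toStrongDual ⁻¹' Metric.closedBall
        (0 : StrongDual ℝ (Lp ℝ 2 (volume : Measure (Euc n)))) (√K) := by
    intro k
    simp only [T, Set.mem_preimage, mem_closedBall_zero_iff]
    change ‖InnerProductSpace.toDual ℝ _ _‖ ≤ _
    rw [LinearIsometryEquiv.norm_map]
    refine Real.le_sqrt_of_sq_le ?_
    rw [← real_inner_self_eq_norm_sq, hin]
    simpa [sq] using hK k
  obtain ⟨ℓ, -, φ, hφ, hlim⟩ := WeakDual.isSeqCompact_closedBall ℝ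
    (Lp ℝ 2 (volume : Measure (Euc n))) 0 (√K) hmem
  set F : Lp ℝ 2 (volume : Measure (Euc n)) :=
    (InnerProductSpace.toDual ℝ _).symm (WeakDual.toStrongDual ℓ) with hF
  refine ⟨F, Lp.memLp F, φ, hφ, fun h hh => ?_⟩
  have h1 := (WeakDual.eval_continuous hh.toLp).tendsto ℓ |>.comp hlim
  have h2 : ℓ hh.toLp = ∫ x, F x * h x := by
    have : ℓ hh.toLp = inner ℝ F hh.toLp := by
      rw [hF, InnerProductSpace.toDual_symm_apply]
      rfl
    rw [this, ← hin (Lp.memLp F) hh, Lp.toLp_coeFn]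
  rw [h2] at h1
  refine h1.congr fun k => ?_
  rw [← hin (hf (φ k)) hh]
  rfl

end WeakCompactness

/-! ### Local compactness under gradient bounds -/

section LocalCompactness

/-- The variance of φ on [0, 1] is nonnegative. -/
theorem sq_integral_le_integral_sq {φ : ℝ → ℝ} (hφ : Continuous φ) :
    (∫ s in (0 : ℝ)..1, φ s) ^ 2 ≤ ∫ s in (0 : ℝ)..1, φ s ^ 2 := by
  set c := ∫ s in (0 : ℝ)..1, φ s with hc
  have h : 0 ≤ ∫ s in (0 : ℝ)..1, (φ s - c) ^ 2 :=
    intervalIntegral.integral_nonneg zero_le_one fun s _ => sq_nonneg _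
  have e : ∫ s in (0 : ℝ)..1, (φ s - c) ^ 2 = (∫ s in (0 : ℝ)..1, φ s ^ 2) - c ^ 2 := by
    have : ∀ s, (φ s - c) ^ 2 = φ s ^ 2 - (2 * c) * φ s + c ^ 2 := fun s => by ring
    have i1 : Continuous fun s => φ s ^ 2 := hφ.pow 2
    have i2 : Continuous fun s => 2 * c * φ s := by fun_prop
    have i3 : Continuous fun s => φ s ^ 2 - 2 * c * φ s := i1.sub i2
    simp only [this]
    rw [intervalIntegral.integral_add (i3.intervalIntegrable _ _)
        (continuous_const.intervalIntegrable _ _),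
      intervalIntegral.integral_sub (i1.intervalIntegrable _ _)
        (i2.intervalIntegrable _ _), intervalIntegral.integral_const_mul, ← hc]
    simp
    ring
  linarith

theorem sq_sub_le_integral_gradSq {f : Euc n → ℝ} (sf : ContDiff ℝ ∞ f) (x y : Euc n) :
    (f (x + y) - f x) ^ 2 ≤ ∫ s in (0 : ℝ)..1, ‖y‖ ^ 2 * gradSq f (x + s • y) := by
  have cl : Continuous fun s : ℝ => x + s • y := by fun_prop
  have cd : Continuous fun s : ℝ => fderiv ℝ f (x + s • y) y :=
    ((sf.continuous_fderiv (by simp)).comp cl).clm_apply continuous_const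
  have hd : ∀ s : ℝ, HasDerivAt (fun s : ℝ => f (x + s • y)) (fderiv ℝ f (x + s • y) y) s := by
    intro s
    have h1 : HasDerivAt (fun t : ℝ => x + t • y) y s := by
      simpa using ((hasDerivAt_id s).smul_const y).const_add x
    exact (Smooth.differentiable sf _).hasFDerivAt.comp_hasDerivAt s h1
  have h := intervalIntegral.integral_eq_sub_of_hasDerivAt (a := 0) (b := 1)
    (fun s _ => hd s) (cd.intervalIntegrable _ _)
  simp only [one_smul, zero_smul, add_zero] at h
  rw [← h]
  refine (sq_integral_le_integral_sq cd).trans ?_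
  refine intervalIntegral.integral_mono_on zero_le_one ((cd.pow 2).intervalIntegrable _ _)
    ((continuous_const.mul (sf.gradSq.continuous.comp cl)).intervalIntegrable _ _) fun s _ => ?_
  rw [← norm_fderiv_sq, ← mul_pow, mul_comm, ← sq_abs]
  exact pow_le_pow_left₀ (abs_nonneg _) ((fderiv ℝ f (x + s • y)).le_opNorm y) 2

theorem memLp_comp_add_right {f : Euc n → ℝ} (hf : MemLp f 2 volume) (y : Euc n) :
    MemLp (fun x => f (x + y)) 2 volume :=
  hf.comp_measurePreserving (measurePreserving_add_right volume y)

/-- The fundamental theorem of calculus along the segment bounds the difference by an average of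
|∇f|² over x + sy. After Tonelli, translation invariance makes the integral in x independent of s.
-/
theorem integral_sq_translate_sub_le {f : Euc n → ℝ} (sf : ContDiff ℝ ∞ f) (hf : L2Deriv 1 f)
    (y : Euc n) : ∫ x, (f (x + y) - f x) ^ 2 ≤ ‖y‖ ^ 2 * ∫ x, gradSq f x := by
  have hg := integrable_gradSq hf
  have hgn : 0 ≤ ∫ x, gradSq f x := integral_nonneg fun x => gradSq_nonneg f x
  have cf := sf.continuous
  have cg := sf.gradSq.continuous
  rw [integral_eq_lintegral_of_nonneg_ae (ae_of_all _ fun x => sq_nonneg _)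
    (by fun_prop : Continuous fun x => (f (x + y) - f x) ^ 2).aestronglyMeasurable]
  refine ENNReal.toReal_le_of_le_ofReal (by positivity) ?_
  calc ∫⁻ x, ENNReal.ofReal ((f (x + y) - f x) ^ 2)
      ≤ ∫⁻ x, ∫⁻ s in Set.Ioc (0 : ℝ) 1, ENNReal.ofReal (‖y‖ ^ 2 * gradSq f (x + s • y)) := by
        refine lintegral_mono fun x => ?_
        rw [← ofReal_integral_eq_lintegral_ofReal]
        · rw [← intervalIntegral.integral_of_le zero_le_one]
          exact ENNReal.ofReal_le_ofReal (sq_sub_le_integral_gradSq sf x y)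
        · exact (intervalIntegrable_iff_integrableOn_Ioc_of_le zero_le_one).1
            ((by fun_prop : Continuous fun s : ℝ =>
              ‖y‖ ^ 2 * gradSq f (x + s • y)).intervalIntegrable _ _)
        · exact ae_of_all _ fun s => mul_nonneg (sq_nonneg _) (gradSq_nonneg _ _)
    _ = ∫⁻ s in Set.Ioc (0 : ℝ) 1, ∫⁻ x, ENNReal.ofReal (‖y‖ ^ 2 * gradSq f (x + s • y)) := by
        refine lintegral_lintegral_swap ?_
        exact (ENNReal.continuous_ofReal.comp
          (by fun_prop : Continuous (Function.uncurry fun (x : Euc n) (s : ℝ) =>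
            ‖y‖ ^ 2 * gradSq f (x + s • y)))).aemeasurable
    _ = ∫⁻ s in Set.Ioc (0 : ℝ) 1, ENNReal.ofReal (‖y‖ ^ 2 * ∫ x, gradSq f x) := by
        refine lintegral_congr fun s => ?_
        rw [lintegral_add_right_eq_self (fun x => ENNReal.ofReal (‖y‖ ^ 2 * gradSq f x)) (s • y),
          ← ofReal_integral_eq_lintegral_ofReal (hg.const_mul _)
            (ae_of_all _ fun s => mul_nonneg (sq_nonneg _) (gradSq_nonneg _ _)),
          integral_const_mul]
    _ = _ := by simp

/-- Replace one factor of f² by f(x + y), with error at most δ‖f‖‖∇f‖ for ‖y‖ ≤ δ, and integrate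
over y. The resulting local average, unlike f², passes to the limit under weak convergence. -/
theorem measureReal_mul_setIntegral_sq_le {f : Euc n → ℝ} (sf : ContDiff ℝ ∞ f)
    (hf : L2Deriv 1 f) {δ R : ℝ} (hδ : 0 ≤ δ) :
    volume.real (Metric.closedBall (0 : Euc n) δ) *
        ∫ x in Metric.closedBall 0 R, f x ^ 2 ≤
      (∫ x in Metric.closedBall 0 R, f x * ∫ y in Metric.closedBall 0 δ, f (x + y)) +
        volume.real (Metric.closedBall (0 : Euc n) δ) *
          (δ * (√(∫ x, f x ^ 2) * √(∫ x, gradSq f x))) := by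
  set S := Metric.closedBall (0 : Euc n) R
  set B := Metric.closedBall (0 : Euc n) δ with hB
  have cS : IsCompact S := isCompact_closedBall _ _
  have cB : IsCompact B := isCompact_closedBall _ _
  have cf := sf.continuous
  have hfB : volume B ≠ ⊤ := cB.measure_lt_top.ne
  have ipt : ∀ y ∈ B, ∫ x in S, f x ^ 2 ≤ (∫ x in S, f x * f (x + y)) +
      δ * (√(∫ x, f x ^ 2) * √(∫ x, gradSq f x)) := by
    intro y hy
    have hyδ : ‖y‖ ≤ δ := by simpa [hB] using hy
    have hm : MemLp (fun x => f (x + y) - f x) 2 volume := (memLp_comp_add_right hf.memLp y).sub hf.memLp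
    have h1 := abs_integral_mul_le (hf.memLp.restrict S) (hm.restrict S)
    have h2 : ∫ x in S, f x ^ 2 ≤ ∫ x, f x ^ 2 :=
      setIntegral_le_integral hf.memLp.integrable_sq (ae_of_all _ fun x => sq_nonneg _)
    have h3 : ∫ x in S, (f (x + y) - f x) ^ 2 ≤ δ ^ 2 * ∫ x, gradSq f x := by
      refine (setIntegral_le_integral hm.integrable_sq (ae_of_all _ fun x => sq_nonneg _)).trans ?_
      refine (integral_sq_translate_sub_le sf hf y).trans ?_
      exact mul_le_mul_of_nonneg_right (pow_le_pow_left₀ (norm_nonneg _) hyδ 2)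
        (integral_nonneg fun x => gradSq_nonneg f x)
    have h4 : √(∫ x in S, (f (x + y) - f x) ^ 2) ≤ δ * √(∫ x, gradSq f x) := by
      refine (Real.sqrt_le_sqrt h3).trans ?_
      rw [Real.sqrt_mul (sq_nonneg _), Real.sqrt_sq hδ]
    have h5 : ∫ x in S, f x * (f (x + y) - f x) =
        (∫ x in S, f x * f (x + y)) - ∫ x in S, f x ^ 2 := by
      rw [← integral_sub]
      · exact integral_congr_ae (ae_of_all _ fun x => by simp only; ring)
      · exact (hf.memLp.integrable_mul (memLp_comp_add_right hf.memLp y)).restrict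
      · exact hf.memLp.integrable_sq.restrict
    have h6 : |∫ x in S, f x * (f (x + y) - f x)| ≤
        √(∫ x, f x ^ 2) * (δ * √(∫ x, gradSq f x)) :=
      h1.trans (mul_le_mul (Real.sqrt_le_sqrt h2) h4 (Real.sqrt_nonneg _) (Real.sqrt_nonneg _))
    rw [h5] at h6
    have := (abs_le.1 h6).1
    linarith
  have hunc : Integrable (Function.uncurry fun (y x : Euc n) => f x * f (x + y))
      ((volume.restrict B).prod (volume.restrict S)) := by
    rw [Measure.prod_restrict]
    exact ((by fun_prop : Continuous (Function.uncurry fun (y x : Euc n) =>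
      f x * f (x + y))).continuousOn).integrableOn_compact (cB.prod cS)
  have hsw := integral_integral_swap hunc
  have hmono := setIntegral_mono_on (integrableOn_const hfB)
    (hunc.integral_prod_left.add (integrableOn_const hfB)) cB.measurableSet ipt
  rw [setIntegral_const, smul_eq_mul] at hmono
  refine hmono.trans (le_of_eq ?_)
  have e := integral_add (μ := volume.restrict B) hunc.integral_prod_left
    (integrableOn_const (C := δ * (√(∫ x, f x ^ 2) * √(∫ x, gradSq f x))) hfB)
  simp only [Function.uncurry] at e
  refine e.trans ?_
  rw [setIntegral_const, smul_eq_mul, hsw]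
  simp only [integral_const_mul]

/-- A weak null sequence in `L²` with bounded gradients tends to zero in `L²` on balls. -/
theorem tendsto_setIntegral_sq_zero {f : ℕ → Euc n → ℝ} (sf : ∀ k, ContDiff ℝ ∞ (f k))
    (hf : ∀ k, L2Deriv 1 (f k)) {K : ℝ} (h1 : ∀ k, ∫ x, f k x ^ 2 ≤ 1)
    (hK : ∀ k, ∫ x, gradSq (f k) x ≤ K)
    (hweak : ∀ h : Euc n → ℝ, MemLp h 2 volume →
      Tendsto (fun k => ∫ x, f k x * h x) atTop (𝓝 0)) (R : ℝ) :
    Tendsto (fun k => ∫ x in Metric.closedBall 0 R, f k x ^ 2) atTop (𝓝 0) := by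
  have hmain : ∀ δ > 0, Tendsto (fun k => ∫ x in Metric.closedBall 0 R,
      f k x * ∫ y in Metric.closedBall 0 δ, f k (x + y)) atTop (𝓝 0) := by
    intro δ hδ
    set B := Metric.closedBall (0 : Euc n) δ
    set S := Metric.closedBall (0 : Euc n) R
    have hfB : volume B ≠ ⊤ := (isCompact_closedBall _ _).measure_lt_top.ne
    have mB : MeasurableSet B := (isCompact_closedBall _ _).measurableSet
    -- Local averages are pairings with a translated indicator, so they tend to 0 pointwise. They
    -- are bounded uniformly, hence tend to 0 in L² of the ball S by dominated convergence.
    set A : ℕ → Euc n → ℝ := fun k x => ∫ y in B, f k (x + y) with hA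
    have cA : ∀ k, Continuous (A k) := fun k =>
      continuous_parametric_integral_of_continuous
        (by have := (sf k).continuous; fun_prop) (isCompact_closedBall _ _)
    have hm : ∀ k x, MemLp (fun y => f k (x + y)) 2 volume := fun k x => by
      simpa only [add_comm] using memLp_comp_add_right (hf k).memLp x
    have : IsFiniteMeasure (volume.restrict B) := ⟨by simpa using hfB.lt_top⟩
    have : IsFiniteMeasure (volume.restrict S) :=
      ⟨by simpa using (isCompact_closedBall (0 : Euc n) R).measure_lt_top⟩
    have hA2 : ∀ k x, A k x ^ 2 ≤ volume.real B := by
      intro k x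
      have h2 := sq_integral_mul_le ((hm k x).restrict B)
        (memLp_const (1 : ℝ) : MemLp _ 2 (volume.restrict B))
      simp only [mul_one, one_pow, integral_const, smul_eq_mul, measureReal_restrict_apply_univ]
        at h2
      refine h2.trans (mul_le_of_le_one_left measureReal_nonneg ?_)
      refine (setIntegral_le_integral (hm k x).integrable_sq
        (ae_of_all _ fun x => sq_nonneg _)).trans ?_
      rw [integral_add_left_eq_self (fun y => f k y ^ 2)]
      exact h1 k
    have hA0 : ∀ x, Tendsto (fun k => A k x) atTop (𝓝 0) := by
      intro x
      have hi : MemLp (B.indicator fun _ => (1 : ℝ)) 2 volume :=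
        memLp_indicator_const 2 mB 1 (Or.inr hfB)
      refine (hweak _ (memLp_comp_add_right hi (-x))).congr fun k => ?_
      rw [← integral_add_left_eq_self _ x]
      simp only [hA]
      rw [← integral_indicator mB]
      refine integral_congr_ae (ae_of_all _ fun y => ?_)
      by_cases hy : y ∈ B <;> simp [hy]
    have hAS : Tendsto (fun k => ∫ x in S, A k x ^ 2) atTop (𝓝 0) := by
      have := tendsto_integral_of_dominated_convergence (μ := volume.restrict S)
        (F := fun k x => A k x ^ 2) (f := fun _ => 0)
        (fun _ => volume.real B) (fun k => ((cA k).pow 2).aestronglyMeasurable)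
        (integrable_const _) (fun k => ae_of_all _ fun x => by
          rw [Real.norm_of_nonneg (sq_nonneg _)]; exact hA2 k x)
        (ae_of_all _ fun x => by simpa using (hA0 x).pow 2)
      simpa using this
    refine squeeze_zero_norm (fun k => ?_) (by simpa using hAS.sqrt)
    have mA : MemLp (A k) 2 (volume.restrict S) :=
      MemLp.of_bound (cA k).aestronglyMeasurable (√(volume.real B))
        (ae_of_all _ fun x => Real.abs_le_sqrt (hA2 k x))
    refine (abs_integral_mul_le ((hf k).memLp.restrict S) mA).trans
      (mul_le_of_le_one_left (Real.sqrt_nonneg _) ?_)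
    exact (Real.sqrt_le_sqrt ((setIntegral_le_integral (hf k).memLp.integrable_sq
      (ae_of_all _ fun x => sq_nonneg _)).trans (h1 k))).trans_eq Real.sqrt_one
  refine tendsto_order.2 ⟨fun a ha => Eventually.of_forall fun k =>
    ha.trans_le (integral_nonneg fun x => sq_nonneg _), fun ε hε => ?_⟩
  -- Makes the averaging error δ√K at most ε/2; the summand 1 keeps the denominator positive when K
  -- = 0.
  set δ := ε / (2 * (√K + 1)) with hδ
  have hK0 : 0 ≤ √K := Real.sqrt_nonneg K
  have hδ0 : 0 < δ := by positivity
  have hv : 0 < volume.real (Metric.closedBall (0 : Euc n) δ) :=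
    ENNReal.toReal_pos (Metric.measure_closedBall_pos volume _ hδ0).ne'
      (isCompact_closedBall _ _).measure_lt_top.ne
  set v := volume.real (Metric.closedBall (0 : Euc n) δ)
  filter_upwards [(hmain δ hδ0).eventually (gt_mem_nhds (show 0 < v * (ε / 2) by positivity))]
    with k hk
  have h2 := measureReal_mul_setIntegral_sq_le (sf k) (hf k) (R := R) hδ0.le
  have h3 : √(∫ x, f k x ^ 2) * √(∫ x, gradSq (f k) x) ≤ √K :=
    (mul_le_of_le_one_left (Real.sqrt_nonneg _) ((Real.sqrt_le_sqrt (h1 k)).trans_eq Real.sqrt_one)).trans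
      (Real.sqrt_le_sqrt (hK k))
  have h4 : δ * (√(∫ x, f k x ^ 2) * √(∫ x, gradSq (f k) x)) ≤ ε / 2 := by
    refine (mul_le_mul_of_nonneg_left h3 hδ0.le).trans ?_
    rw [hδ, div_mul_eq_mul_div, div_le_div_iff₀ (by positivity) two_pos]
    nlinarith
  have h5 := mul_le_mul_of_nonneg_left h4 hv.le
  refine lt_of_mul_lt_mul_left (a := v) ?_ hv.le
  linarith

/-- A weak null sequence in `L²` with bounded gradients does not see a potential that vanishes at
infinity. -/
theorem tendsto_integral_mul_sq_zero {U : Euc n → ℝ} (cU : Continuous U)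
    (hU : Tendsto U (cocompact (Euc n)) (𝓝 0)) (hUb : ∃ C, ∀ x, |U x| ≤ C)
    {f : ℕ → Euc n → ℝ} (sf : ∀ k, ContDiff ℝ ∞ (f k))
    (hf : ∀ k, L2Deriv 1 (f k)) {K : ℝ} (h1 : ∀ k, ∫ x, f k x ^ 2 ≤ 1)
    (hK : ∀ k, ∫ x, gradSq (f k) x ≤ K)
    (hweak : ∀ h : Euc n → ℝ, MemLp h 2 volume →
      Tendsto (fun k => ∫ x, f k x * h x) atTop (𝓝 0)) :
    Tendsto (fun k => ∫ x, U x * f k x ^ 2) atTop (𝓝 0) := by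
  obtain ⟨C, hC⟩ := hUb
  have hC0 : 0 ≤ C := (abs_nonneg _).trans (hC 0)
  rw [Metric.tendsto_atTop']
  intro ε hε
  -- Outside the ball of radius R the potential is small and the L² norms are at most 1; inside,
  -- local compactness applies.
  obtain ⟨R, hR⟩ : ∃ R : ℝ, ∀ x : Euc n, R < ‖x‖ → |U x| ≤ ε / 2 := by
    have := hU.eventually (Metric.closedBall_mem_nhds 0 (half_pos hε))
    rw [← Metric.cobounded_eq_cocompact, Filter.eventually_iff, ← comap_norm_atTop,
      Filter.mem_comap] at this
    obtain ⟨t, ht, hts⟩ := this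
    obtain ⟨R, hR⟩ := mem_atTop_sets.1 ht
    exact ⟨R, fun x hx => by simpa using hts (hR _ hx.le)⟩
  have hS := tendsto_setIntegral_sq_zero sf hf h1 hK hweak R
  obtain ⟨N, hN⟩ := eventually_atTop.1
    ((hS.const_mul C).eventually (gt_mem_nhds (show C * 0 < ε / 2 by simpa using half_pos hε)))
  refine ⟨N, fun k hk => ?_⟩
  have mS : MeasurableSet (Metric.closedBall (0 : Euc n) R) := Metric.isClosed_closedBall.measurableSet
  have hsq := (hf k).memLp.integrable_sq
  have hb : ∀ x, |U x * f k x ^ 2| ≤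
      ε / 2 * f k x ^ 2 + C * (Metric.closedBall (0 : Euc n) R).indicator (fun x => f k x ^ 2) x := by
    intro x
    rw [abs_mul, abs_of_nonneg (sq_nonneg (f k x))]
    by_cases hx : x ∈ Metric.closedBall (0 : Euc n) R
    · rw [Set.indicator_of_mem hx]
      have := mul_le_mul_of_nonneg_right (hC x) (sq_nonneg (f k x))
      have h3 : 0 ≤ ε / 2 * f k x ^ 2 := by positivity
      linarith
    · rw [Set.indicator_of_notMem hx, mul_zero, add_zero]
      exact mul_le_mul_of_nonneg_right (hR x (by simpa using hx)) (sq_nonneg _)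
  rw [dist_zero_right]
  calc ‖∫ x, U x * f k x ^ 2‖ ≤ ∫ x, |U x * f k x ^ 2| := norm_integral_le_integral_norm _
    _ ≤ ∫ x, (ε / 2 * f k x ^ 2 +
        C * (Metric.closedBall (0 : Euc n) R).indicator (fun x => f k x ^ 2) x) :=
      integral_mono (integrable_bdd_mul_sq cU ⟨C, hC⟩ (hf k).memLp).abs
        ((hsq.const_mul _).add ((hsq.indicator mS).const_mul _)) hb
    _ = ε / 2 * (∫ x, f k x ^ 2) + C * ∫ x in Metric.closedBall 0 R, f k x ^ 2 := by
      rw [integral_add (hsq.const_mul _) ((hsq.indicator mS).const_mul _), integral_const_mul,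
        integral_const_mul, integral_indicator mS]
    _ < ε := by
      have := hN k hk.le
      have := mul_le_mul_of_nonneg_left (h1 k) (half_pos hε).le
      linarith

end LocalCompactness

/-! ### Existence and positivity of the ground state -/

section GroundState

theorem energyForm_const_mul (V : Euc n → ℝ) {f : Euc n → ℝ} (sf : ContDiff ℝ ∞ f) (c : ℝ) :
    energyForm V (fun x => c * f x) = c ^ 2 * energyForm V f := by
  rw [energyForm, energyForm, ← integral_const_mul]
  refine integral_congr_ae (ae_of_all _ fun x => ?_)
  simp only [gradSq, pd_const_mul (Smooth.differentiable sf x), mul_add, Finset.mul_sum, mul_pow]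
  ring

theorem energyForm_sub_const {V f : Euc n → ℝ} (cV : Continuous V) (hV : ∃ C, ∀ x, |V x| ≤ C)
    (hf : L2Deriv 1 f) (c : ℝ) :
    energyForm (fun x => V x - c) f = energyForm V f - c * ∫ x, f x ^ 2 := by
  have i : Integrable fun x => gradSq f x + V x * f x ^ 2 :=
    (integrable_gradSq hf).add (integrable_bdd_mul_sq cV hV hf.memLp)
  rw [energyForm, energyForm, ← integral_const_mul,
    ← integral_sub i (hf.memLp.integrable_sq.const_mul c)]
  exact integral_congr_ae (ae_of_all _ fun x => by simp only; ring)

theorem energyForm_eq_add {V f : Euc n → ℝ} (cV : Continuous V) (hV : ∃ C, ∀ x, |V x| ≤ C)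
    (hf : L2Deriv 1 f) :
    energyForm V f = (∫ x, gradSq f x) + ∫ x, V x * f x ^ 2 :=
  integral_add (integrable_gradSq hf) (integrable_bdd_mul_sq cV hV hf.memLp)

theorem energyForm_eq_zero_of_integral_sq {V f : Euc n → ℝ} (sf : ContDiff ℝ ∞ f)
    (hf : L2Deriv 1 f) (h : ∫ x, f x ^ 2 = 0) : energyForm V f = 0 := by
  rw [integral_eq_zero_iff_of_nonneg (fun x => sq_nonneg _) hf.memLp.integrable_sq] at h
  have h0 := ((sf.continuous.pow 2).ae_eq_iff_eq volume continuous_zero).1 h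
  have : f = fun _ => 0 := funext fun x => by simpa using congrFun h0 x
  simp [this, energyForm, gradSq, pd_const]

/-- A Schrödinger operator `-Δ + V` whose energy form takes a negative value, with a potential
of nonnegative limit at infinity, has an eigenfunction at the bottom of its spectrum. -/
theorem exists_minimizer {V : Euc n → ℝ} (sV : ContDiff ℝ ∞ V) (hV : ∀ k, BddDeriv k V)
    {m : ℝ} (hm : 0 ≤ m) (hlim : Tendsto V (cocompact (Euc n)) (𝓝 m))
    {f₀ : Euc n → ℝ} (sf₀ : ContDiff ℝ ∞ f₀) (hf₀ : L2Deriv 1 f₀) (hneg : energyForm V f₀ < 0) :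
    ∃ lam < 0, (∀ f : Euc n → ℝ, ContDiff ℝ ∞ f → L2Deriv 1 f →
        0 ≤ energyForm (fun x => V x - lam) f) ∧
      ∃ χ : Euc n → ℝ, ContDiff ℝ ∞ χ ∧ χ ≠ 0 ∧ (∀ x, lap χ x = (V x - lam) * χ x) ∧
        ∀ k, L2Deriv k χ := by
  have cV := sV.continuous
  have hVb := (hV 0).bdd
  obtain ⟨C, hC⟩ := hVb
  have hlow : ∀ f : Euc n → ℝ, L2Deriv 1 f →
      (∫ x, gradSq f x) - C * ∫ x, f x ^ 2 ≤ energyForm V f := by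
    intro f hf
    rw [energyForm_eq_add cV ⟨C, hC⟩ hf]
    have : -C * ∫ x, f x ^ 2 ≤ ∫ x, V x * f x ^ 2 := by
      rw [← integral_const_mul]
      refine integral_mono (hf.memLp.integrable_sq.const_mul _)
        (integrable_bdd_mul_sq cV ⟨C, hC⟩ hf.memLp) fun x => ?_
      exact mul_le_mul_of_nonneg_right (abs_le.1 (hC x)).1 (sq_nonneg _)
    linarith
  -- The energies of normalized functions. Their infimum is the eigenvalue sought, and it is
  -- negative because of f₀.
  set S : Set ℝ := {q | ∃ f : Euc n → ℝ, ContDiff ℝ ∞ f ∧ L2Deriv 1 f ∧ ∫ x, f x ^ 2 = 1 ∧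
    energyForm V f = q} with hS
  have hbdd : BddBelow S := by
    refine ⟨-C, ?_⟩
    rintro q ⟨f, sf, hf, h1, rfl⟩
    have := hlow f hf
    have h2 : 0 ≤ ∫ x, gradSq f x := integral_nonneg fun x => gradSq_nonneg f x
    rw [h1] at this
    linarith
  have hnorm : ∀ f : Euc n → ℝ, ContDiff ℝ ∞ f → L2Deriv 1 f → 0 < ∫ x, f x ^ 2 →
      energyForm V f / (∫ x, f x ^ 2) ∈ S := by
    intro f sf hf hp
    set c := (√(∫ x, f x ^ 2))⁻¹ with hc
    have hc2 : c ^ 2 = (∫ x, f x ^ 2)⁻¹ := by rw [hc, inv_pow, Real.sq_sqrt hp.le]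
    refine ⟨fun x => c * f x, contDiff_const.mul sf, hf.const_mul sf c, ?_, ?_⟩
    · simp only [mul_pow]
      rw [integral_const_mul, hc2, inv_mul_cancel₀ hp.ne']
    · rw [energyForm_const_mul V sf, hc2, div_eq_inv_mul]
  have hpos : ∀ f : Euc n → ℝ, ContDiff ℝ ∞ f → L2Deriv 1 f → energyForm V f ≠ 0 →
      0 < ∫ x, f x ^ 2 := fun f sf hf h =>
    (integral_nonneg fun x => sq_nonneg _).lt_of_ne' fun e =>
      h (energyForm_eq_zero_of_integral_sq sf hf e)
  have hmem := hnorm f₀ sf₀ hf₀ (hpos f₀ sf₀ hf₀ hneg.ne)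
  have hlam : sInf S < 0 :=
    (csInf_le hbdd hmem).trans_lt (div_neg_of_neg_of_pos hneg (hpos f₀ sf₀ hf₀ hneg.ne))
  set lam := sInf S with hlamdef
  have sW : ContDiff ℝ ∞ fun x => V x - lam := sV.sub contDiff_const
  have hW : ∀ k, BddDeriv k fun x => V x - lam := fun k => by
    simpa only [sub_eq_add_neg] using BddDeriv.add sV contDiff_const (hV k) (BddDeriv.const k (-lam))
  have hQ : ∀ f : Euc n → ℝ, ContDiff ℝ ∞ f → L2Deriv 1 f →
      0 ≤ energyForm (fun x => V x - lam) f := by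
    intro f sf hf
    rw [energyForm_sub_const cV ⟨C, hC⟩ hf]
    by_cases h : ∫ x, f x ^ 2 = 0
    · rw [h, energyForm_eq_zero_of_integral_sq sf hf h]; simp
    · have hp : 0 < ∫ x, f x ^ 2 := (integral_nonneg fun x => sq_nonneg _).lt_of_ne' h
      have := csInf_le hbdd (hnorm f sf hf hp)
      rw [le_div_iff₀ hp] at this
      linarith
  refine ⟨lam, hlam, hQ, ?_⟩
  obtain ⟨q, -, hq, hqS⟩ := exists_seq_tendsto_sInf ⟨_, hmem⟩ hbdd
  choose f sf hf h1 hfq using hqS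
  obtain ⟨F, hF, φ, hφ, hweak⟩ := exists_weak_limit (fun k => (hf k).memLp) (fun k => (h1 k).le)
  have hq' : Tendsto (fun k => energyForm V (f (φ k))) atTop (𝓝 lam) := by
    simp only [hfq]
    exact hq.comp hφ.tendsto_atTop
  -- After the shift by lam the form is nonnegative and tends to 0 along the minimizing sequence, so
  -- the weak limit solves the eigenvalue equation.
  have hW0 : Tendsto (fun k => energyForm (fun x => V x - lam) (f (φ k))) atTop (𝓝 0) := by
    have : Tendsto (fun k => energyForm V (f (φ k)) - lam) atTop (𝓝 (lam - lam)) :=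
      hq'.sub_const lam
    rw [sub_self] at this
    refine this.congr fun k => ?_
    rw [energyForm_sub_const cV ⟨C, hC⟩ (hf _), h1, mul_one]
  obtain ⟨χ, sχ, hFχ, hlap, hχ⟩ := exists_contDiff_of_energyForm_tendsto sW hW hQ
    (fun k => sf (φ k)) (fun k => hf (φ k)) hW0 hF hweak
  refine ⟨χ, sχ, fun h0 => ?_, hlap, hχ⟩
  -- The weak limit cannot be 0: otherwise the integrals of (V - m)f² tend to 0, and since they are
  -- bounded above by the energies (because m ≥ 0), the limit lam would be nonnegative.
  have hweak0 : ∀ h : Euc n → ℝ, MemLp h 2 volume →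
      Tendsto (fun k => ∫ x, f (φ k) x * h x) atTop (𝓝 0) := by
    intro h hh
    have : ∫ x, F x * h x = 0 := by
      refine integral_eq_zero_of_ae ?_
      filter_upwards [hFχ] with x hx
      rw [hx, h0]
      simp
    rw [← this]
    exact hweak h hh
  obtain ⟨K, hK⟩ := hq'.bddAbove_range
  have hU : Tendsto (fun x => V x - m) (cocompact (Euc n)) (𝓝 0) := by
    simpa using hlim.sub_const m
  have hUb : ∃ B, ∀ x, |V x - m| ≤ B :=
    ⟨C + |m|, fun x => (abs_sub _ _).trans (add_le_add_left (hC x) _)⟩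
  have h3 := tendsto_integral_mul_sq_zero (U := fun x => V x - m) (cV.sub continuous_const) hU hUb
    (fun k => sf (φ k)) (fun k => hf (φ k)) (K := K + C) (fun k => (h1 _).le) (fun k => by
      have h4 := hlow _ (hf (φ k))
      have h5 := hK ⟨k, rfl⟩
      simp only [h1] at h4 h5
      linarith) hweak0
  have h6 : ∀ k, ∫ x, (V x - m) * f (φ k) x ^ 2 ≤ energyForm V (f (φ k)) := by
    intro k
    have e := energyForm_sub_const cV ⟨C, hC⟩ (hf (φ k)) m
    rw [energyForm_eq_add (V := fun x => V x - m) (cV.sub continuous_const) hUb (hf (φ k)),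
      h1] at e
    have : 0 ≤ ∫ x, gradSq (f (φ k)) x := integral_nonneg fun x => gradSq_nonneg _ x
    linarith
  have := le_of_tendsto_of_tendsto' h3 hq' h6
  linarith

/-- If the kernel of `-Δ + V` contains a function that changes sign, and `V` has a nonnegative
limit at infinity, then `-Δ + V` has a negative eigenvalue with a positive eigenfunction. -/
theorem exists_pos_eigenfunction {V : Euc n → ℝ} (sV : ContDiff ℝ ∞ V) (hV : ∀ k, BddDeriv k V)
    {m : ℝ} (hm : 0 ≤ m) (hlim : Tendsto V (cocompact (Euc n)) (𝓝 m))
    {u : Euc n → ℝ} (su : ContDiff ℝ ∞ u) (hu : ∀ k, L2Deriv k u)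
    (hlap : ∀ x, lap u x = V x * u x) (hup : ∃ x, 0 < u x) (hun : ∃ x, u x < 0) :
    ∃ c : ℝ, 0 < c ∧ ∃ χ : Euc n → ℝ, ContDiff ℝ ∞ χ ∧ (∀ k, L2Deriv k χ) ∧ (∀ x, 0 < χ x) ∧
      ∀ x, lap χ x = (V x + c ^ 2) * χ x := by
  obtain ⟨f₀, sf₀, hf₀, hneg⟩ : ∃ f₀ : Euc n → ℝ, ContDiff ℝ ∞ f₀ ∧ L2Deriv 1 f₀ ∧
      energyForm V f₀ < 0 := by
    -- Were the form nonnegative, |u| would be a positive element of the kernel, whereas u vanishes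
    -- somewhere by the intermediate value theorem.
    by_contra! hQ
    obtain ⟨sa, ha, -⟩ := abs_solution sV hV hQ su hu hlap
    obtain ⟨p, hp⟩ := hup
    obtain ⟨q, hq⟩ := hun
    have hpos := pos_of_lap_eq (hV 0).bdd sa ha (fun x => abs_nonneg _) (abs_pos.2 hp.ne')
    obtain ⟨x, hx⟩ := mem_range_of_exists_le_of_exists_ge su.continuous ⟨q, hq.le⟩ ⟨p, hp.le⟩
    have := hpos x
    simp [hx] at this
  obtain ⟨lam, hlam, hQ, χ, sχ, hχ0, hχlap, hχ⟩ := exists_minimizer sV hV hm hlim sf₀ hf₀ hneg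
  have sW : ContDiff ℝ ∞ fun x => V x - lam := sV.sub contDiff_const
  have hW : ∀ k, BddDeriv k fun x => V x - lam := fun k => by
    simpa only [sub_eq_add_neg] using BddDeriv.add sV contDiff_const (hV k) (BddDeriv.const k (-lam))
  obtain ⟨sa, ha, ha2⟩ := abs_solution sW hW hQ sχ hχ hχlap
  obtain ⟨p, hp⟩ := Function.ne_iff.1 hχ0
  -- The form of V - lam is nonnegative, so |χ| is again an eigenfunction, positive by the strong
  -- maximum principle.
  refine ⟨√(-lam), Real.sqrt_pos.2 (by linarith), _, sa, ha2,
    pos_of_lap_eq (hW 0).bdd sa ha (fun x => abs_nonneg _) (abs_pos.2 hp), fun x => ?_⟩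
  rw [ha, Real.sq_sqrt (by linarith)]
  ring

end GroundState

/-! ### The weighted virial identity -/

section Virial

theorem hasDerivAt_nlwPotential {g : ℝ → ℝ} (hg : Continuous g) (s : ℝ) :
    HasDerivAt (nlwPotential g) (g s) s :=
  intervalIntegral.integral_hasDerivAt_right (hg.intervalIntegrable _ _)
    (hg.stronglyMeasurableAtFilter _ _) hg.continuousAt

theorem contDiff_nlwPotential {g : ℝ → ℝ} (hg : ContDiff ℝ ∞ g) :
    ContDiff ℝ ∞ (nlwPotential g) := by
  have h := hasDerivAt_nlwPotential hg.continuous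
  rw [contDiff_infty_iff_deriv]
  exact ⟨fun s => (h s).differentiableAt, by rwa [funext fun s => (h s).deriv]⟩

/-- The radial derivative `x · ∇θ`. -/
noncomputable def radial (θ : Euc n → ℝ) (x : Euc n) : ℝ := ∑ j, x j * pd j θ x

/-- The weighted virial vector field with weight `exp (2 F)`, where `∇F = γ x` and `∇γ = b x`. -/
noncomputable def virialField (g : ℝ → ℝ) (θ F γ b : Euc n → ℝ) (i : Fin n) (x : Euc n) : ℝ :=
  Real.exp (2 * F x) *
    (radial θ x * pd i θ x - (1 / 2 * gradSq θ x + nlwPotential g (θ x)) * x i +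
      (n / 2 + γ x * ‖x‖ ^ 2 - 7 / 8) * θ x * pd i θ x +
      (γ x * (γ x * ‖x‖ ^ 2) - 1 / 2 * b x * ‖x‖ ^ 2 - (n / 2 + 1 / 8) * γ x) * θ x ^ 2 * x i)

/-- The coefficient of `θ²` in the divergence of the virial field. -/
noncomputable def virialCoeff (γ b b₁ : Euc n → ℝ) (x : Euc n) : ℝ :=
  γ x * ‖x‖ ^ 2 * (b x * ‖x‖ ^ 2 + 7 / 4 * γ x) - 1 / 2 * b₁ x * ‖x‖ ^ 4 -
    (n + 9 / 8) * b x * ‖x‖ ^ 2 - n * (n / 2 + 1 / 8) * γ x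

/-- The divergence of the virial field, without the weight. -/
noncomputable def virialDensity (g : ℝ → ℝ) (θ γ b b₁ : Euc n → ℝ) (x : Euc n) : ℝ :=
  1 / 8 * gradSq θ x + (-(7 / 8) * (θ x * g (θ x)) -
    (n + 2 * (γ x * ‖x‖ ^ 2)) * (nlwPotential g (θ x) - θ x * g (θ x) / 2)) +
    2 * γ x * (radial θ x + γ x * ‖x‖ ^ 2 * θ x) ^ 2 + virialCoeff γ b b₁ x * θ x ^ 2

theorem ContDiff.radial {θ : Euc n → ℝ} (hθ : ContDiff ℝ ∞ θ) : ContDiff ℝ ∞ (radial θ) :=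
  ContDiff.sum fun j _ => (contDiff_coord j).mul (hθ.pd j)

theorem contDiff_norm_sq_euc : ContDiff ℝ ∞ fun x : Euc n => ‖x‖ ^ 2 := by
  simpa using contDiff_norm_sub_sq (0 : Euc n)

theorem pd_norm_sq (i : Fin n) (x : Euc n) : pd i (fun y => ‖y‖ ^ 2) x = 2 * x i := by
  simpa using pd_norm_sub_sq (0 : Euc n) i x

theorem contDiff_virialField {g : ℝ → ℝ} (hg : ContDiff ℝ ∞ g) {θ F γ b : Euc n → ℝ}
    (sθ : ContDiff ℝ ∞ θ) (sF : ContDiff ℝ ∞ F) (sγ : ContDiff ℝ ∞ γ) (sb : ContDiff ℝ ∞ b)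
    (i : Fin n) : ContDiff ℝ ∞ (virialField g θ F γ b i) := by
  have h1 := sθ.radial
  have h2 := sθ.pd i
  have h3 := sθ.gradSq
  have h4 : ContDiff ℝ ∞ fun x => nlwPotential g (θ x) := (contDiff_nlwPotential hg).comp sθ
  have h5 := contDiff_coord i
  have h6 := contDiff_norm_sq_euc (n := n)
  unfold virialField
  fun_prop

theorem pd_radial {θ : Euc n → ℝ} (sθ : ContDiff ℝ ∞ θ) (i : Fin n) (x : Euc n) :
    pd i (radial θ) x = pd i θ x + ∑ j, x j * pd i (pd j θ) x := by
  have h : ∀ j, pd i (fun y : Euc n => y j * pd j θ y) x =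
      (if i = j then 1 else 0) * pd j θ x + x j * pd i (pd j θ) x := fun j => by
    rw [pd_mul (Smooth.differentiable (contDiff_coord j) x) (Smooth.differentiable (sθ.pd j) x),
      pd_coord]
  have := pd_sum (s := Finset.univ) (f := fun j (y : Euc n) => y j * pd j θ y) (x := x)
    (fun j _ => Smooth.differentiable ((contDiff_coord j).mul (sθ.pd j)) x) i
  refine this.trans ?_
  simp [h, Finset.sum_add_distrib]

theorem pd_gradSq {θ : Euc n → ℝ} (sθ : ContDiff ℝ ∞ θ) (i : Fin n) (x : Euc n) :
    pd i (gradSq θ) x = 2 * ∑ j, pd j θ x * pd i (pd j θ) x := by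
  have := pd_sum (s := Finset.univ) (f := fun j (y : Euc n) => pd j θ y ^ 2) (x := x)
    (fun j _ => Smooth.differentiable ((sθ.pd j).pow 2) x) i
  refine this.trans ?_
  rw [Finset.mul_sum]
  refine Finset.sum_congr rfl fun j _ => ?_
  rw [pd_sq (Smooth.differentiable (sθ.pd j) x)]
  ring

/-- The dilation multiplier x·∇θ is combined with a multiple of θ. The constant 7/8 leaves 1/8 of
|∇θ|² and -7/8 of θg(θ), both of good sign at infinity when g'(0) < 0. The term γ|x|² in the
coefficient of θ∇θ cancels the contribution -γ|x|²|∇θ|² of the weight. The coefficient of θ²x is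
such that the cross term of θ and x·∇θ becomes 4γ²|x|² and completes the square 2γ(x·∇θ + γ|x|²θ)².
-/
theorem sum_pd_virialField {g : ℝ → ℝ} (hg : ContDiff ℝ ∞ g) {θ F γ b b₁ : Euc n → ℝ}
    (sθ : ContDiff ℝ ∞ θ) (hlap : ∀ x, lap θ x = g (θ x)) (sF : ContDiff ℝ ∞ F)
    (sγ : ContDiff ℝ ∞ γ) (sb : ContDiff ℝ ∞ b) (dF : ∀ i x, pd i F x = γ x * x i)
    (dγ : ∀ i x, pd i γ x = b x * x i) (db : ∀ i x, pd i b x = b₁ x * x i) (x : Euc n) :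
    ∑ i, pd i (virialField g θ F γ b i) x =
      Real.exp (2 * F x) * virialDensity g θ γ b b₁ x := by
  set w := Real.exp (2 * F x) with hw
  set R := radial θ x with hR
  set r2 := ‖x‖ ^ 2 with hr2
  set e := 1 / 2 * gradSq θ x + nlwPotential g (θ x) with he
  set p := γ x * r2 with hp
  set q := n / 2 + p - 7 / 8 with hq
  set ρ := γ x * p - 1 / 2 * b x * r2 - (n / 2 + 1 / 8) * γ x with hρ
  set c := b x * r2 + 2 * γ x with hc
  set ρ₁ := b x * p + γ x * c - 1 / 2 * b₁ x * r2 - b x - (n / 2 + 1 / 8) * b x with hρ₁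
  have D : ∀ {f : Euc n → ℝ}, ContDiff ℝ ∞ f → DifferentiableAt ℝ f x := fun hf =>
    Smooth.differentiable hf x
  have sr := contDiff_norm_sq_euc (n := n)
  have sp : ContDiff ℝ ∞ fun y => γ y * ‖y‖ ^ 2 := sγ.mul sr
  have sE : ContDiff ℝ ∞ fun y => Real.exp (2 * F y) := (contDiff_const.mul sF).exp
  have sG : ContDiff ℝ ∞ fun y => nlwPotential g (θ y) := (contDiff_nlwPotential hg).comp sθ
  have se : ContDiff ℝ ∞ fun y => 1 / 2 * gradSq θ y + nlwPotential g (θ y) :=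
    (contDiff_const.mul sθ.gradSq).add sG
  have sq : ContDiff ℝ ∞ fun y => (n : ℝ) / 2 + γ y * ‖y‖ ^ 2 - 7 / 8 :=
    (contDiff_const.add sp).sub contDiff_const
  have sρ : ContDiff ℝ ∞ fun y =>
      γ y * (γ y * ‖y‖ ^ 2) - 1 / 2 * b y * ‖y‖ ^ 2 - ((n : ℝ) / 2 + 1 / 8) * γ y := by fun_prop
  have dE : ∀ i, pd i (fun y => Real.exp (2 * F y)) x = w * (2 * (γ x * x i)) := fun i => by
    rw [pd_comp (φ := Real.exp) (Real.hasDerivAt_exp _) (D (contDiff_const.mul sF)),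
      pd_const_mul (D sF), dF]
  have dp : ∀ i, pd i (fun y => γ y * ‖y‖ ^ 2) x = c * x i := fun i => by
    rw [pd_mul (D sγ) (D sr), dγ, pd_norm_sq]; ring
  have dq : ∀ i, pd i (fun y => (n : ℝ) / 2 + γ y * ‖y‖ ^ 2 - 7 / 8) x = c * x i := fun i => by
    rw [pd_sub (D (contDiff_const.add sp)) (D contDiff_const), pd_const,
      pd_add (D contDiff_const) (D sp), pd_const, dp]; ring
  have dρ : ∀ i, pd i (fun y =>
      γ y * (γ y * ‖y‖ ^ 2) - 1 / 2 * b y * ‖y‖ ^ 2 - ((n : ℝ) / 2 + 1 / 8) * γ y) x =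
      ρ₁ * x i := fun i => by
    rw [pd_sub (D ((sγ.mul sp).sub ((contDiff_const.mul sb).mul sr))) (D (contDiff_const.mul sγ)),
      pd_sub (D (sγ.mul sp)) (D ((contDiff_const.mul sb).mul sr)), pd_mul (D sγ) (D sp), dp, dγ,
      pd_mul (D (contDiff_const.mul sb)) (D sr), pd_const_mul (D sb), db, pd_norm_sq,
      pd_const_mul (D sγ), dγ]
    ring
  have de : ∀ i, pd i (fun y => 1 / 2 * gradSq θ y + nlwPotential g (θ y)) x =
      (∑ j, pd j θ x * pd i (pd j θ) x) + g (θ x) * pd i θ x := fun i => by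
    rw [pd_add (D (contDiff_const.mul sθ.gradSq)) (D sG), pd_const_mul (D sθ.gradSq),
      pd_gradSq sθ, pd_comp (hasDerivAt_nlwPotential hg.continuous _) (D sθ)]
    ring
  have main : ∀ i, pd i (virialField g θ F γ b i) x =
      w * ((2 * γ x * (-e + ρ * θ x ^ 2) + ρ₁ * θ x ^ 2) * x i ^ 2 +
        (2 * γ x * R + 2 * γ x * q * θ x - g (θ x) + c * θ x + 2 * ρ * θ x) * (x i * pd i θ x) +
        (1 + q) * pd i θ x ^ 2 + (R + q * θ x) * pd i (pd i θ) x +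
        pd i θ x * (∑ j, x j * pd i (pd j θ) x) - x i * (∑ j, pd j θ x * pd i (pd j θ) x) +
        (-e + ρ * θ x ^ 2)) := by
    intro i
    have s1 := sθ.radial.mul (sθ.pd i)
    have s2 := se.mul (contDiff_coord i)
    have s3 := (sq.mul sθ).mul (sθ.pd i)
    have s4 := (sρ.mul (sθ.pow 2)).mul (contDiff_coord i)
    unfold virialField
    rw [pd_mul (D sE) (D (((s1.sub s2).add s3).add s4)), dE,
      pd_add (D ((s1.sub s2).add s3)) (D s4), pd_add (D (s1.sub s2)) (D s3), pd_sub (D s1) (D s2),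
      pd_mul (D sθ.radial) (D (sθ.pd i)), pd_mul (D se) (D (contDiff_coord i)),
      pd_mul (D (sq.mul sθ)) (D (sθ.pd i)), pd_mul (D sq) (D sθ),
      pd_mul (D (sρ.mul (sθ.pow 2))) (D (contDiff_coord i)), pd_mul (D sρ) (D (sθ.pow 2)),
      dq, dρ, de, pd_radial sθ, pd_coord, pd_sq (D sθ)]
    simp only [if_true]
    ring
  -- By symmetry of the Hessian the second derivatives cancel, apart from Δθ = g(θ).
  have hM : ∑ i, x i * (∑ j, pd j θ x * pd i (pd j θ) x) =
      ∑ i, pd i θ x * (∑ j, x j * pd i (pd j θ) x) := by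
    simp only [Finset.mul_sum]
    rw [Finset.sum_comm]
    refine Finset.sum_congr rfl fun i _ => Finset.sum_congr rfl fun j _ => ?_
    rw [pd_comm sθ j i]
    ring
  simp only [main]
  rw [← Finset.mul_sum]
  congr 1
  simp only [Finset.sum_add_distrib, Finset.sum_sub_distrib, ← Finset.mul_sum]
  rw [hM, ← norm_sq_eq_sum]
  simp only [Finset.sum_const, Finset.card_univ, Fintype.card_fin, nsmul_eq_mul]
  have e1 : ∑ i, x i * pd i θ x = R := rfl
  have e2 : ∑ i, pd i θ x ^ 2 = gradSq θ x := rfl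
  have e3 : ∑ i, pd i (pd i θ) x = g (θ x) := hlap x
  have e4 : ‖x‖ ^ 4 = r2 ^ 2 := by rw [hr2]; ring
  rw [e1, e2, e3]
  simp only [virialDensity, virialCoeff, e4, ← hr2, ← hR, ← hp]
  simp only [he, hq, hρ₁, hρ, hc, hp]
  ring

end Virial

/-! ### The nonlinearity near zero -/

section Nonlinearity

theorem abs_le_of_deriv_bound {φ φ' : ℝ → ℝ} (hφ : ∀ s, HasDerivAt φ (φ' s) s) (h0 : φ 0 = 0)
    {s B : ℝ} (hB : ∀ t, |t| ≤ |s| → |φ' t| ≤ B) : |φ s| ≤ B * |s| := by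
  have := (convex_Icc (-|s|) |s|).norm_image_sub_le_of_norm_hasDerivWithin_le (f := φ) (f' := φ')
    (C := B) (x := 0) (y := s) (fun t _ => (hφ t).hasDerivWithinAt)
    (fun t ht => hB t (abs_le.2 ⟨ht.1, ht.2⟩)) ⟨neg_nonpos.2 (abs_nonneg s), abs_nonneg s⟩
    ⟨neg_abs_le s, le_abs_self s⟩
  simpa [h0] using this

/-- The quadratic Taylor terms of G(s) and sg(s)/2 coincide, so their difference is cubic. The
bounds follow by integrating the bound on g'' successively. -/
theorem exists_nonlinearity_bound {g : ℝ → ℝ} (hg : ContDiff ℝ ∞ g) (h0 : g 0 = 0) (M : ℝ) :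
    ∃ C, 0 ≤ C ∧ ∀ s, |s| ≤ M → |s * g s - deriv g 0 * s ^ 2| ≤ C * |s| ^ 3 ∧
      |nlwPotential g s - s * g s / 2| ≤ C * |s| ^ 3 := by
  have hd : ∀ s, HasDerivAt g (deriv g s) s := fun s =>
    (hg.differentiable (by simp) s).hasDerivAt
  have sd := contDiff_deriv hg
  have hd2 : ∀ s, HasDerivAt (deriv g) (deriv (deriv g) s) s := fun s =>
    (sd.differentiable (by simp) s).hasDerivAt
  obtain ⟨C, hC⟩ := (isCompact_Icc (a := -M) (b := M)).exists_bound_of_continuousOn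
    (contDiff_deriv sd).continuous.continuousOn
  have hC' : ∀ t, |t| ≤ M → |deriv (deriv g) t| ≤ |C| := fun t ht =>
    (hC t (abs_le.1 ht)).trans (le_abs_self C)
  have b1 : ∀ s, |s| ≤ M → |deriv g s - deriv g 0| ≤ |C| * |s| := fun s hs =>
    abs_le_of_deriv_bound (φ := fun s => deriv g s - deriv g 0) (fun t => (hd2 t).sub_const _)
      (sub_self _) fun t ht => hC' t (ht.trans hs)
  have b2 : ∀ s, |s| ≤ M → |g s - deriv g 0 * s| ≤ |C| * |s| * |s| := fun s hs =>
    abs_le_of_deriv_bound (φ := fun s => g s - deriv g 0 * s)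
      (φ' := fun s => deriv g s - deriv g 0)
      (fun t => by
        have := (hd t).sub ((hasDerivAt_id t).const_mul (deriv g 0))
        rw [mul_one] at this
        exact this)
      (by simp [h0]) fun t ht => (b1 t (ht.trans hs)).trans (by gcongr)
  have b3 : ∀ s, |s| ≤ M → |nlwPotential g s - s * g s / 2| ≤ |C| * |s| ^ 2 * |s| := fun s hs =>
    abs_le_of_deriv_bound (φ := fun s => nlwPotential g s - s * g s / 2)
      (φ' := fun s => g s - (1 * g s + s * deriv g s) / 2)
      (fun t => (hasDerivAt_nlwPotential hg.continuous t).sub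
        (((hasDerivAt_id t).mul (hd t)).div_const 2))
      (by simp [nlwPotential]) fun t ht => by
        have e : g t - (1 * g t + t * deriv g t) / 2 =
            ((g t - deriv g 0 * t) - t * (deriv g t - deriv g 0)) / 2 := by ring
        have h1 := b2 t (ht.trans hs)
        have h2 : |t * (deriv g t - deriv g 0)| ≤ |t| * (|C| * |t|) := by
          rw [abs_mul]
          exact mul_le_mul_of_nonneg_left (b1 t (ht.trans hs)) (abs_nonneg _)
        rw [e, abs_div, abs_two]
        have h3 := abs_sub (g t - deriv g 0 * t) (t * (deriv g t - deriv g 0))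
        have h4 : |C| * |t| ^ 2 ≤ |C| * |s| ^ 2 := by gcongr
        rw [div_le_iff₀ two_pos]
        nlinarith
  refine ⟨|C|, abs_nonneg C, fun s hs => ⟨?_, ?_⟩⟩
  · have e : s * g s - deriv g 0 * s ^ 2 = s * (g s - deriv g 0 * s) := by ring
    rw [e, abs_mul]
    calc |s| * |g s - deriv g 0 * s| ≤ |s| * (|C| * |s| * |s|) :=
          mul_le_mul_of_nonneg_left (b2 s hs) (abs_nonneg _)
      _ = _ := by ring
  · calc _ ≤ |C| * |s| ^ 2 * |s| := b3 s hs
      _ = _ := by ring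

theorem exists_norm_gt_of_eventually {P : Euc n → Prop}
    (h : ∀ᶠ x in cocompact (Euc n), P x) : ∃ R : ℝ, ∀ x : Euc n, R < ‖x‖ → P x := by
  rw [← Metric.cobounded_eq_cocompact, Filter.eventually_iff, ← comap_norm_atTop,
    Filter.mem_comap] at h
  obtain ⟨t, ht, hts⟩ := h
  obtain ⟨R, hR⟩ := mem_atTop_sets.1 ht
  exact ⟨R, fun x hx => hts (hR _ hx.le)⟩

/-- On a unit ball far out, compare with a paraboloid: θ - c‖y - x₀‖² with c = a/(4n) has Laplacian
at least a/2 > 0, so it has no interior maximum. Since |θ| < ε = c/4, its values on the sphere are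
below the value at the centre. -/
theorem not_lap_ge_of_tendsto_zero (hn : 1 ≤ n) {θ : Euc n → ℝ} (sθ : ContDiff ℝ ∞ θ)
    (hloc : Tendsto θ (cocompact (Euc n)) (𝓝 0)) {a : ℝ} (ha : 0 < a)
    (h : ∀ᶠ x in cocompact (Euc n), a ≤ lap θ x) : False := by
  have hn0 : (0 : ℝ) < n := by exact_mod_cast hn
  set ε := a / (16 * n) with hε
  have hε0 : 0 < ε := by positivity
  have hsmall : ∀ᶠ x in cocompact (Euc n), |θ x| < ε := by
    simpa using hloc.eventually (Metric.ball_mem_nhds 0 hε0)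
  obtain ⟨R, hR⟩ := exists_norm_gt_of_eventually (h.and hsmall)
  set x₀ : Euc n := EuclideanSpace.single ⟨0, hn⟩ (|R| + 2) with hx₀
  have hnx : ‖x₀‖ = |R| + 2 := by
    rw [hx₀, PiLp.norm_single, Real.norm_of_nonneg (by positivity)]
  have hfar : ∀ y ∈ Metric.closedBall x₀ 1, R < ‖y‖ := fun y hy => by
    rw [Metric.mem_closedBall, dist_eq_norm] at hy
    have h1 := norm_sub_norm_le x₀ y
    rw [norm_sub_rev] at h1
    have := le_abs_self R
    linarith
  set c := a / (4 * n) with hc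
  have hc4 : c = 4 * ε := by rw [hc, hε]; field_simp; ring
  set w : Euc n → ℝ := fun y => θ y + (-c) * ‖y - x₀‖ ^ 2 with hw
  have sw : ContDiff ℝ ∞ w := sθ.add (contDiff_const.mul (contDiff_norm_sub_sq x₀))
  have hlw : ∀ y, lap w y = lap θ y - a / 2 := by
    intro y
    rw [hw, lap_add sθ (contDiff_const.mul (contDiff_norm_sub_sq x₀)),
      lap_const_mul (contDiff_norm_sub_sq x₀), lap_norm_sub_sq, hc]
    field_simp
    ring
  have hmem : x₀ ∈ Metric.closedBall x₀ 1 := Metric.mem_closedBall_self zero_le_one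
  obtain ⟨q, hq, hqm⟩ := (isCompact_closedBall x₀ 1).exists_isMaxOn ⟨x₀, hmem⟩
    sw.continuous.continuousOn
  have h1 : w x₀ ≤ w q := hqm hmem
  have h2 := (abs_lt.1 (hR x₀ (hfar x₀ hmem)).2).1
  have h3 := (abs_lt.1 (hR q (hfar q hq)).2).2
  simp only [hw, sub_self, norm_zero] at h1
  rw [Metric.mem_closedBall, dist_eq_norm] at hq
  have hq1 : ‖q - x₀‖ < 1 := by
    refine hq.lt_of_ne fun e => ?_
    rw [e] at h1
    nlinarith
  have hloc' : IsLocalMax w q := hqm.isLocalMax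
    (Metric.closedBall_mem_nhds_of_mem (by rwa [Metric.mem_ball, dist_eq_norm]))
  have h4 := hloc'.lap_nonpos sw
  rw [hlw] at h4
  have h5 := (hR q (hfar q (by rwa [Metric.mem_closedBall, dist_eq_norm]))).1
  linarith

/-- Δθ = g(θ) tends to g(0) at infinity, and a nonzero limit of the Laplacian is incompatible with θ
→ 0. -/
theorem nonlinearity_zero (hn : 1 ≤ n) {g : ℝ → ℝ} (hg : ContDiff ℝ ∞ g) {θ : Euc n → ℝ}
    (sθ : ContDiff ℝ ∞ θ) (hlap : ∀ x, lap θ x = g (θ x))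
    (hloc : Tendsto θ (cocompact (Euc n)) (𝓝 0)) : g 0 = 0 := by
  have ht : Tendsto (fun x => g (θ x)) (cocompact (Euc n)) (𝓝 (g 0)) :=
    (hg.continuous.tendsto 0).comp hloc
  by_contra h
  rcases lt_or_gt_of_ne h with h | h
  · refine not_lap_ge_of_tendsto_zero hn (θ := fun x => (-1) * θ x) (contDiff_const.mul sθ)
      (by simpa using hloc.const_mul (-1)) (a := -(g 0) / 2) (by linarith) ?_
    filter_upwards [ht.eventually (gt_mem_nhds (show g 0 < g 0 / 2 by linarith))] with x hx
    rw [lap_const_mul sθ, hlap]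
    linarith
  · refine not_lap_ge_of_tendsto_zero hn sθ hloc (half_pos h) ?_
    filter_upwards [ht.eventually (lt_mem_nhds (show g 0 / 2 < g 0 by linarith))] with x hx
    rw [hlap]
    exact hx.le

theorem integrable_of_le_add_indicator {f h : Euc n → ℝ} (cf : Continuous f) (hh : Integrable h)
    (h0 : ∀ x, 0 ≤ f x) {R : ℝ} (hfh : ∀ x, R < ‖x‖ → f x ≤ h x) : Integrable f := by
  set B := Metric.closedBall (0 : Euc n) R
  have hi : Integrable (B.indicator f) :=
    (cf.continuousOn.integrableOn_compact (isCompact_closedBall _ _)).integrable_indicator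
      Metric.isClosed_closedBall.measurableSet
  refine (hi.add hh.abs).mono' cf.aestronglyMeasurable (ae_of_all _ fun x => ?_)
  rw [Real.norm_of_nonneg (h0 x)]
  by_cases hx : x ∈ B
  · simp [hx]
  · have := hfh x (by simpa [B] using hx)
    simpa [hx] using this.trans (le_abs_self _)

theorem bdd_of_tendsto_zero {θ : Euc n → ℝ} (cθ : Continuous θ)
    (hloc : Tendsto θ (cocompact (Euc n)) (𝓝 0)) : ∃ C, ∀ x, |θ x| ≤ C := by
  let f : ZeroAtInftyContinuousMap (Euc n) ℝ := ⟨⟨θ, cθ⟩, hloc⟩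
  exact ⟨‖f.toBCF‖, fun x => f.toBCF.norm_coe_le_norm x⟩

/-- Finite potential energy forces square integrability when `g' (0) < 0`. -/
theorem integrable_sq_of_potential {g : ℝ → ℝ} (hg : ContDiff ℝ ∞ g)
    (h0 : g 0 = 0) (hm : deriv g 0 < 0) {θ : Euc n → ℝ} (cθ : Continuous θ)
    (hloc : Tendsto θ (cocompact (Euc n)) (𝓝 0))
    (hG : Integrable fun x => nlwPotential g (θ x)) : Integrable fun x => θ x ^ 2 := by
  obtain ⟨M, hM⟩ := bdd_of_tendsto_zero cθ hloc
  obtain ⟨C, hC0, hC⟩ := exists_nonlinearity_bound hg h0 M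
  set k := -deriv g 0 with hk
  have hk0 : 0 < k := by linarith
  -- G(θ) differs from -kθ²/2 by at most (3/2)C|θ|³. The factor 6 makes this at most kθ²/4, so G(θ)
  -- ≤ -kθ²/4 far out.
  have hev : ∀ᶠ x in cocompact (Euc n), |θ x| < k / (6 * (C + 1)) := by
    simpa using hloc.eventually (Metric.ball_mem_nhds 0 (ε := k / (6 * (C + 1))) (by positivity))
  obtain ⟨R, hR⟩ := exists_norm_gt_of_eventually hev
  refine integrable_of_le_add_indicator (cθ.pow 2) (hG.const_mul (-(4 / k)))
    (fun x => sq_nonneg _) (R := R) fun x hx => ?_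
  obtain ⟨h1, h2⟩ := hC (θ x) (hM x)
  have h3 := hR x hx
  rw [lt_div_iff₀ (by positivity)] at h3
  have h4 : 6 * (C * |θ x| ^ 3) ≤ k * θ x ^ 2 := by
    rw [← sq_abs (θ x)]
    nlinarith [sq_nonneg |θ x|, abs_nonneg (θ x), mul_nonneg hC0 (abs_nonneg (θ x))]
  have h5 := (abs_le.1 h1).2
  have h6 := (abs_le.1 h2).2
  have h7 : deriv g 0 = -k := by rw [hk]; ring
  rw [h7] at h5
  have h8 : nlwPotential g (θ x) ≤ -(k / 4) * θ x ^ 2 := by linarith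
  have h9 := mul_le_mul_of_nonneg_left h8 (show 0 ≤ 4 / k by positivity)
  have h10 : 4 / k * (-(k / 4) * θ x ^ 2) = -θ x ^ 2 := by field_simp
  linarith

end Nonlinearity

/-! ### Bounds for the virial field and its divergence -/

section VirialBounds

theorem abs_radial_le (θ : Euc n → ℝ) (x : Euc n) : |radial θ x| ≤ ‖x‖ * √(gradSq θ x) :=
  sum_mul_pd_abs_le x θ x

/-- The hypotheses scale γ, b, b₁ like successive derivatives in |x|² of one weight, so every term
carries a factor (1+|x|²)⁻¹. For slowly growing A the coefficient is a small error at infinity. -/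
theorem abs_virialCoeff_le {γ b b₁ : Euc n → ℝ} {A : ℝ} {x : Euc n}
    (hγ : |γ x| * (1 + ‖x‖ ^ 2) ≤ A) (hb : |b x| * (1 + ‖x‖ ^ 2) ^ 2 ≤ A)
    (hb₁ : |b₁ x| * (1 + ‖x‖ ^ 2) ^ 3 ≤ A) :
    |virialCoeff γ b b₁ x| ≤ (n + 2) ^ 2 * ((A + A ^ 2) / (1 + ‖x‖ ^ 2)) := by
  set y := 1 + ‖x‖ ^ 2 with hy
  have hy1 : 1 ≤ y := by rw [hy]; nlinarith [sq_nonneg ‖x‖]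
  have hy0 : 0 < y := by linarith
  have hr : ‖x‖ ^ 2 ≤ y := by rw [hy]; linarith
  have hr0 := sq_nonneg ‖x‖
  have hA0 : 0 ≤ A := (by positivity : 0 ≤ |γ x| * y).trans hγ
  have g1 : |γ x| ≤ A / y := by rwa [le_div_iff₀ hy0]
  have g2 : |γ x * ‖x‖ ^ 2| ≤ A := by
    rw [abs_mul, abs_of_nonneg hr0]
    exact (mul_le_mul_of_nonneg_left hr (abs_nonneg _)).trans hγ
  have g3 : |b x * ‖x‖ ^ 2| ≤ A / y := by
    rw [abs_mul, abs_of_nonneg hr0, le_div_iff₀ hy0]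
    refine le_trans ?_ hb
    rw [mul_assoc, sq y]
    gcongr
  have g4 : |b₁ x * ‖x‖ ^ 4| ≤ A / y := by
    rw [abs_mul, abs_of_nonneg (by positivity : (0 : ℝ) ≤ ‖x‖ ^ 4), le_div_iff₀ hy0]
    refine le_trans ?_ hb₁
    have : ‖x‖ ^ 4 ≤ y ^ 2 := by
      calc ‖x‖ ^ 4 = (‖x‖ ^ 2) ^ 2 := by ring
        _ ≤ y ^ 2 := by gcongr
    calc |b₁ x| * ‖x‖ ^ 4 * y ≤ |b₁ x| * y ^ 2 * y := by gcongr
      _ = _ := by ring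
  set D := A / y with hD
  have hD0 : 0 ≤ D := by positivity
  have e : (A + A ^ 2) / y = D + A * D := by rw [hD]; ring
  have t1 : |γ x * ‖x‖ ^ 2 * (b x * ‖x‖ ^ 2 + 7 / 4 * γ x)| ≤ A * (D + 7 / 4 * D) := by
    rw [abs_mul]
    refine mul_le_mul g2 ((abs_add_le _ _).trans (add_le_add g3 ?_)) (abs_nonneg _) hA0
    rw [abs_mul, abs_of_pos (by norm_num : (0 : ℝ) < 7 / 4)]
    gcongr
  have t1' := abs_le.1 t1
  have g3' := abs_le.1 g3
  have g4' := abs_le.1 g4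
  have g1' := abs_le.1 g1
  have hn0 : (0 : ℝ) ≤ n := Nat.cast_nonneg n
  have hc1 : (0 : ℝ) ≤ n + 9 / 8 := by positivity
  have hc2 : (0 : ℝ) ≤ n * (n / 2 + 1 / 8) := by positivity
  have u1 := mul_le_mul_of_nonneg_left g3'.1 hc1
  have u2 := mul_le_mul_of_nonneg_left g3'.2 hc1
  have v1 := mul_le_mul_of_nonneg_left g1'.1 hc2
  have v2 := mul_le_mul_of_nonneg_left g1'.2 hc2
  have hAD := mul_nonneg hA0 hD0
  have hnD := mul_nonneg hn0 hD0
  have hnnD := mul_nonneg hn0 hnD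
  have hnAD := mul_nonneg hn0 hAD
  have hnnAD := mul_nonneg hn0 hnAD
  rw [e, virialCoeff, abs_le]
  constructor <;> linarith

/-- This feeds the divergence theorem: only the factor 1 + ‖x‖ of the dilation field exceeds the
weighted energy density. -/
theorem abs_virialField_le {g : ℝ → ℝ} {θ F γ b : Euc n → ℝ} {A M : ℝ} {x : Euc n} (hM : 0 ≤ M)
    (hG : |nlwPotential g (θ x)| ≤ M * θ x ^ 2)
    (hγ : |γ x| * (1 + ‖x‖ ^ 2) ≤ A) (hb : |b x| * (1 + ‖x‖ ^ 2) ^ 2 ≤ A) (i : Fin n) :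
    |virialField g θ F γ b i x| ≤ (1 + ‖x‖) *
      ((M + n + 5) * (Real.exp (2 * F x) * ((1 + A) ^ 3 * (gradSq θ x + θ x ^ 2)))) := by
  set y := 1 + ‖x‖ ^ 2 with hy
  have hy1 : 1 ≤ y := by rw [hy]; nlinarith [sq_nonneg ‖x‖]
  have hr : ‖x‖ ^ 2 ≤ y := by rw [hy]; linarith
  have hr0 := sq_nonneg ‖x‖
  have hA0 : 0 ≤ A := (by positivity : 0 ≤ |γ x| * y).trans hγ
  have g0 : |γ x| ≤ A := le_trans (le_mul_of_one_le_right (abs_nonneg _) hy1) hγ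
  have g2 : |γ x * ‖x‖ ^ 2| ≤ A := by
    rw [abs_mul, abs_of_nonneg hr0]
    exact (mul_le_mul_of_nonneg_left hr (abs_nonneg _)).trans hγ
  have g3 : |b x * ‖x‖ ^ 2| ≤ A := by
    rw [abs_mul, abs_of_nonneg hr0]
    refine le_trans ?_ hb
    refine mul_le_mul_of_nonneg_left (hr.trans ?_) (abs_nonneg _)
    nlinarith
  set T := gradSq θ x with hT
  have hT0 : 0 ≤ T := gradSq_nonneg θ x
  have hpd := abs_pd_le_sqrt_gradSq θ i x
  have hsq : √T * √T = T := Real.mul_self_sqrt hT0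
  have hR := abs_radial_le θ x
  have hx := abs_coord_le x i
  set E := T + θ x ^ 2 with hE
  have hE0 : 0 ≤ E := by positivity
  have hθE : θ x ^ 2 ≤ E := by rw [hE]; linarith
  have hTE : T ≤ E := by rw [hE]; nlinarith [sq_nonneg (θ x)]
  have hn0 : (0 : ℝ) ≤ n := Nat.cast_nonneg n
  have a1 : |radial θ x * pd i θ x| ≤ ‖x‖ * E := by
    rw [abs_mul]
    calc |radial θ x| * |pd i θ x| ≤ (‖x‖ * √T) * √T := by gcongr
      _ = ‖x‖ * T := by rw [mul_assoc, hsq]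
      _ ≤ _ := by gcongr
  have a2 : |(1 / 2 * T + nlwPotential g (θ x)) * x i| ≤ ((1 + M) * E) * ‖x‖ := by
    rw [abs_mul]
    refine mul_le_mul ((abs_add_le _ _).trans ?_) hx (abs_nonneg _) (by positivity)
    rw [abs_of_nonneg (by positivity : 0 ≤ 1 / 2 * T)]
    nlinarith
  have a3 : |(n / 2 + γ x * ‖x‖ ^ 2 - 7 / 8) * θ x * pd i θ x| ≤ (n + A + 1) * E := by
    rw [mul_assoc, abs_mul]
    refine mul_le_mul ?_ ?_ (abs_nonneg _) (by positivity)
    · have := abs_le.1 g2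
      rw [abs_le]
      constructor <;> linarith
    · rw [abs_mul]
      have : |θ x| * |pd i θ x| ≤ |θ x| * √T := by gcongr
      nlinarith [sq_abs (θ x), sq_nonneg (|θ x| - √T)]
  have a4 : |(γ x * (γ x * ‖x‖ ^ 2) - 1 / 2 * b x * ‖x‖ ^ 2 - (n / 2 + 1 / 8) * γ x) *
      θ x ^ 2 * x i| ≤ ((A * A + (n + 1) * A) * E) * ‖x‖ := by
    rw [abs_mul, abs_mul, abs_of_nonneg (sq_nonneg (θ x))]
    refine mul_le_mul (mul_le_mul ?_ hθE (sq_nonneg _) (by positivity)) hx (abs_nonneg _)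
      (by positivity)
    have h1 : |γ x * (γ x * ‖x‖ ^ 2)| ≤ A * A := by
      rw [abs_mul]
      exact mul_le_mul g0 g2 (abs_nonneg _) hA0
    have h1' := abs_le.1 h1
    have h3' := abs_le.1 g3
    have h0' := abs_le.1 g0
    have hc : (0 : ℝ) ≤ n / 2 + 1 / 8 := by positivity
    have u1 := mul_le_mul_of_nonneg_left h0'.1 hc
    have u2 := mul_le_mul_of_nonneg_left h0'.2 hc
    have hnA := mul_nonneg hn0 hA0
    rw [abs_le]
    constructor <;> linarith
  have hexp := Real.exp_pos (2 * F x)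
  rw [virialField, abs_mul, abs_of_pos hexp]
  have key : |radial θ x * pd i θ x - (1 / 2 * T + nlwPotential g (θ x)) * x i +
      (n / 2 + γ x * ‖x‖ ^ 2 - 7 / 8) * θ x * pd i θ x +
      (γ x * (γ x * ‖x‖ ^ 2) - 1 / 2 * b x * ‖x‖ ^ 2 - (n / 2 + 1 / 8) * γ x) *
        θ x ^ 2 * x i| ≤ (1 + ‖x‖) * ((M + n + 5) * ((1 + A) ^ 3 * E)) := by
    refine (abs_add_le _ _).trans ((add_le_add ((abs_add_le _ _).trans (add_le_add
      ((abs_sub _ _).trans (add_le_add a1 a2)) a3)) a4).trans ?_)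
    have hxn := norm_nonneg x
    have e1 : ‖x‖ * E + (1 + M) * E * ‖x‖ + (n + A + 1) * E + (A * A + (n + 1) * A) * E * ‖x‖ ≤
        (1 + ‖x‖) * ((1 + (1 + M) + (n + A + 1) + (A * A + (n + 1) * A)) * E) := by
      have p1 : 0 ≤ (1 + (1 + M) + (A * A + (n + 1) * A)) * E := by positivity
      have p2 : 0 ≤ ‖x‖ * ((n + A + 1) * E) := by positivity
      have p3 : (1 + ‖x‖) * ((1 + (1 + M) + (n + A + 1) + (A * A + (n + 1) * A)) * E) =
          (‖x‖ * E + (1 + M) * E * ‖x‖ + (n + A + 1) * E + (A * A + (n + 1) * A) * E * ‖x‖) +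
            ((1 + (1 + M) + (A * A + (n + 1) * A)) * E + ‖x‖ * ((n + A + 1) * E)) := by ring
      linarith
    refine e1.trans ?_
    rw [← mul_assoc (M + n + 5 : ℝ)]
    gcongr
    have p4 : (M + n + 5) * (1 + A) ^ 3 = (1 + (1 + M) + (n + A + 1) + (A * A + (n + 1) * A)) +
        (2 + (3 * M + 2 * n + 13) * A + (3 * M + 3 * n + 14) * A ^ 2 + (M + n + 5) * A ^ 3) := by
      ring
    have p5 : 0 ≤ 2 + (3 * M + 2 * n + 13) * A + (3 * M + 3 * n + 14) * A ^ 2 +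
        (M + n + 5) * A ^ 3 := by positivity
    linarith
  calc _ ≤ Real.exp (2 * F x) * ((1 + ‖x‖) * ((M + n + 5) * ((1 + A) ^ 3 * E))) :=
        mul_le_mul_of_nonneg_left key hexp.le
    _ = _ := by ring

/-- The power (1 + A)³ is needed for γ(γ|x|²θ)². The majorant is that of the field, so one
integrability hypothesis serves both. -/
theorem abs_virialDensity_le {g : ℝ → ℝ} {θ γ b b₁ : Euc n → ℝ} {A M : ℝ} {x : Euc n}
    (hM : 0 ≤ M) (hG : |nlwPotential g (θ x)| ≤ M * θ x ^ 2)
    (hg : |θ x * g (θ x)| ≤ M * θ x ^ 2)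
    (hγ : |γ x| * (1 + ‖x‖ ^ 2) ≤ A) (hb : |b x| * (1 + ‖x‖ ^ 2) ^ 2 ≤ A)
    (hb₁ : |b₁ x| * (1 + ‖x‖ ^ 2) ^ 3 ≤ A) :
    |virialDensity g θ γ b b₁ x| ≤
      (6 + 3 * M * (n + 2) + (n + 2) ^ 2) * ((1 + A) ^ 3 * (gradSq θ x + θ x ^ 2)) := by
  have hK := abs_virialCoeff_le (n := n) hγ hb hb₁
  set y := 1 + ‖x‖ ^ 2 with hy
  have hy1 : 1 ≤ y := by rw [hy]; nlinarith [sq_nonneg ‖x‖]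
  have hr : ‖x‖ ^ 2 ≤ y := by rw [hy]; linarith
  have hr0 := sq_nonneg ‖x‖
  have hA0 : 0 ≤ A := (by positivity : 0 ≤ |γ x| * y).trans hγ
  have g0 : |γ x| ≤ A := le_trans (le_mul_of_one_le_right (abs_nonneg _) hy1) hγ
  have g2' : |γ x| * ‖x‖ ^ 2 ≤ A := (mul_le_mul_of_nonneg_left hr (abs_nonneg _)).trans hγ
  have g2 : |γ x * ‖x‖ ^ 2| ≤ A := by rwa [abs_mul, abs_of_nonneg hr0]
  set T := gradSq θ x with hT
  have hT0 : 0 ≤ T := gradSq_nonneg θ x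
  have hR2 : radial θ x ^ 2 ≤ ‖x‖ ^ 2 * T := by
    rw [← sq_abs, ← Real.sq_sqrt hT0, ← mul_pow]
    exact pow_le_pow_left₀ (abs_nonneg _) (abs_radial_le θ x) 2
  set K := virialCoeff γ b b₁ x with hKdef
  have hK' : |K| ≤ (n + 2) ^ 2 * (A + A ^ 2) := by
    refine hK.trans ?_
    gcongr
    exact div_le_self (by positivity) hy1
  have hn0 : (0 : ℝ) ≤ n := Nat.cast_nonneg n
  have hθ0 := sq_nonneg (θ x)
  have c1 : |1 / 8 * T| ≤ T := by
    rw [abs_of_nonneg (by positivity)]; linarith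
  have c2 : |-(7 / 8) * (θ x * g (θ x)) - (n + 2 * (γ x * ‖x‖ ^ 2)) *
      (nlwPotential g (θ x) - θ x * g (θ x) / 2)| ≤
      M * θ x ^ 2 + (n + 2 * A) * (2 * (M * θ x ^ 2)) := by
    refine (abs_sub _ _).trans (add_le_add ?_ ?_)
    · rw [abs_mul, abs_neg, abs_of_pos (by norm_num : (0 : ℝ) < 7 / 8)]
      nlinarith [abs_nonneg (θ x * g (θ x))]
    · rw [abs_mul]
      refine mul_le_mul ?_ ?_ (abs_nonneg _) (by positivity)
      · have := abs_le.1 g2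
        rw [abs_le]
        constructor <;> linarith
      · have h1 := abs_le.1 hG
        have h2 := abs_le.1 hg
        rw [abs_le]
        constructor <;> linarith
  have c3 : |2 * γ x * (radial θ x + γ x * ‖x‖ ^ 2 * θ x) ^ 2| ≤
      4 * (A * T + A ^ 3 * θ x ^ 2) := by
    rw [abs_mul, abs_mul, abs_two, abs_of_nonneg (sq_nonneg (radial θ x + _))]
    have h1 : (radial θ x + γ x * ‖x‖ ^ 2 * θ x) ^ 2 ≤
        2 * (‖x‖ ^ 2 * T + A ^ 2 * θ x ^ 2) := by
      have h2 : (γ x * ‖x‖ ^ 2 * θ x) ^ 2 ≤ A ^ 2 * θ x ^ 2 := by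
        rw [mul_pow]
        exact mul_le_mul_of_nonneg_right (sq_le_sq' (abs_le.1 g2).1 (abs_le.1 g2).2) hθ0
      nlinarith [sq_nonneg (radial θ x - γ x * ‖x‖ ^ 2 * θ x)]
    have h3 := mul_le_mul_of_nonneg_left h1 (abs_nonneg (γ x))
    have h4 := mul_le_mul_of_nonneg_right g2' hT0
    have h5 := mul_le_mul_of_nonneg_right g0 (show 0 ≤ A ^ 2 * θ x ^ 2 by positivity)
    nlinarith
  have c4 : |K * θ x ^ 2| ≤ (n + 2) ^ 2 * (A + A ^ 2) * θ x ^ 2 := by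
    rw [abs_mul, abs_of_nonneg hθ0]
    gcongr
  rw [virialDensity]
  refine (abs_add_le _ _).trans ((add_le_add ((abs_add_le _ _).trans (add_le_add
      ((abs_add_le _ _).trans (add_le_add c1 c2)) c3)) c4).trans ?_)
  set X := (1 + A) ^ 3 with hX
  have hX1 : 1 + A ≤ X := le_self_pow₀ (by linarith) (by norm_num)
  have hXA : A ^ 3 ≤ X := pow_le_pow_left₀ hA0 (by linarith) 3
  have hX2 : A + A ^ 2 ≤ X := by
    have : X = A + A ^ 2 + (1 + 2 * A + 2 * A ^ 2 + A ^ 3) := by rw [hX]; ring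
    have h2 : 0 ≤ 1 + 2 * A + 2 * A ^ 2 + A ^ 3 := by positivity
    linarith
  have hX0 : 0 ≤ X := by linarith
  have q1 : T + 4 * (A * T) ≤ 6 * (X * T) := by
    have := mul_le_mul_of_nonneg_right hX1 hT0
    have h2 := mul_nonneg hA0 hT0
    linarith
  have q2 : A ^ 3 * θ x ^ 2 ≤ X * θ x ^ 2 := mul_le_mul_of_nonneg_right hXA hθ0
  have q3 : M * θ x ^ 2 + (n + 2 * A) * (2 * (M * θ x ^ 2)) ≤
      3 * M * (n + 2) * (X * θ x ^ 2) := by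
    have h1 : 1 + (n + 2 * A) * 2 ≤ 3 * (n + 2) * X := by
      have h2 := mul_le_mul_of_nonneg_left hX1 (show (0 : ℝ) ≤ 3 * (n + 2) by positivity)
      have hnA := mul_nonneg hn0 hA0
      linarith
    have := mul_le_mul_of_nonneg_right h1 (mul_nonneg hM hθ0)
    linarith
  have q4 : (n + 2) ^ 2 * (A + A ^ 2) * θ x ^ 2 ≤ (n + 2) ^ 2 * (X * θ x ^ 2) := by
    rw [mul_assoc]
    gcongr
  have q5 : 0 ≤ (3 * M * (n + 2) + (n + 2) ^ 2) * (X * T) := by positivity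
  have q6 : 0 ≤ X * θ x ^ 2 := by positivity
  have q7 : (6 + 3 * M * (n + 2) + (n + 2) ^ 2) * (X * (T + θ x ^ 2)) =
      6 * (X * T) + 6 * (X * θ x ^ 2) + 3 * M * (n + 2) * (X * θ x ^ 2) +
        (n + 2) ^ 2 * (X * θ x ^ 2) + (3 * M * (n + 2) + (n + 2) ^ 2) * (X * T) := by ring
  rw [q7]
  linarith

end VirialBounds

/-! ### From the virial identity to weighted integrability -/

section WeightedVirial

/-- A localized solution of `Δθ = g(θ)` with finite `H¹` norm, where `g` has slope `-k < 0` at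
the origin, together with constants in the bounds of the nonlinearity along `θ`. -/
structure IsLocalizedSolution (g : ℝ → ℝ) (θ : Euc n → ℝ) (k C : ℝ) : Prop where
  smooth_g : ContDiff ℝ ∞ g
  smooth : ContDiff ℝ ∞ θ
  lap_eq : ∀ x, lap θ x = g (θ x)
  tendsto : Tendsto θ (cocompact (Euc n)) (𝓝 0)
  k_pos : 0 < k
  C_nonneg : 0 ≤ C
  cubic : ∀ x, |θ x * g (θ x) + k * θ x ^ 2| ≤ C * |θ x| ^ 3
  cubic_potential : ∀ x, |nlwPotential g (θ x) - θ x * g (θ x) / 2| ≤ C * |θ x| ^ 3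
  integrable : Integrable fun x => gradSq θ x + θ x ^ 2

theorem IsLocalizedSolution.exists_quadratic {g : ℝ → ℝ} {θ : Euc n → ℝ} {k C : ℝ}
    (H : IsLocalizedSolution g θ k C) :
    ∃ M, 0 ≤ M ∧ ∀ x, |nlwPotential g (θ x)| ≤ M * θ x ^ 2 ∧ |θ x * g (θ x)| ≤ M * θ x ^ 2 := by
  obtain ⟨B, hB⟩ := bdd_of_tendsto_zero H.smooth.continuous H.tendsto
  have hB0 : 0 ≤ B := (abs_nonneg _).trans (hB 0)
  have hC := H.C_nonneg
  have hk := H.k_pos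
  refine ⟨2 * (C * B) + k, by positivity, fun x => ?_⟩
  have h1 := abs_le.1 (H.cubic x)
  have h2 := abs_le.1 (H.cubic_potential x)
  have h3 : C * |θ x| ^ 3 ≤ C * B * θ x ^ 2 := by
    rw [← sq_abs (θ x)]
    calc C * |θ x| ^ 3 = C * |θ x| * |θ x| ^ 2 := by ring
      _ ≤ C * B * |θ x| ^ 2 := by gcongr; exact hB x
  have h4 : 0 ≤ C * B * θ x ^ 2 := by positivity
  have h5 : 0 ≤ k * θ x ^ 2 := by positivity
  constructor
  · rw [abs_le]; constructor <;> linarith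
  · rw [abs_le]; constructor <;> linarith

/-- For γ ≥ 0 the square is discarded; -7/8 θg(θ) gives 7/8 kθ², and the remaining nonlinear terms
are cubic in θ. -/
theorem IsLocalizedSolution.virialDensity_ge {g : ℝ → ℝ} {θ : Euc n → ℝ} {k C : ℝ}
    (H : IsLocalizedSolution g θ k C) {γ b b₁ : Euc n → ℝ} {A : ℝ} {x : Euc n} (hγ : 0 ≤ γ x)
    (hA : γ x * ‖x‖ ^ 2 ≤ A) :
    1 / 8 * gradSq θ x + (7 / 8 * k - C * (n + 2) * (1 + A) * |θ x|) * θ x ^ 2 +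
      virialCoeff γ b b₁ x * θ x ^ 2 ≤ virialDensity g θ γ b b₁ x := by
  have h1 := abs_le.1 (H.cubic x)
  have h2 := H.cubic_potential x
  have hC := H.C_nonneg
  have hp0 : 0 ≤ γ x * ‖x‖ ^ 2 := by positivity
  have hA0 := hp0.trans hA
  have hn0 : (0 : ℝ) ≤ n := Nat.cast_nonneg n
  have h3 : 0 ≤ 2 * γ x * (radial θ x + γ x * ‖x‖ ^ 2 * θ x) ^ 2 := by positivity
  have h4 : (n + 2 * (γ x * ‖x‖ ^ 2)) * (nlwPotential g (θ x) - θ x * g (θ x) / 2) ≤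
      (n + 2 * A) * (C * |θ x| ^ 3) :=
    (mul_le_mul_of_nonneg_left ((le_abs_self _).trans h2) (by positivity)).trans
      (mul_le_mul_of_nonneg_right (by linarith) (by positivity))
  have h5 : (C * (n + 2) * (1 + A) * |θ x|) * θ x ^ 2 = (n + 2) * (1 + A) * (C * |θ x| ^ 3) := by
    rw [← sq_abs (θ x)]; ring
  have h6 : 0 ≤ C * |θ x| ^ 3 := by positivity
  have h7 := mul_nonneg (mul_nonneg hn0 hA0) h6
  rw [virialDensity, sub_mul, h5]
  linarith

theorem IsLocalizedSolution.integral_virial {g : ℝ → ℝ} {θ : Euc n → ℝ} {k C : ℝ}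
    (H : IsLocalizedSolution g θ k C) {F γ b b₁ A : Euc n → ℝ} (sF : ContDiff ℝ ∞ F)
    (sγ : ContDiff ℝ ∞ γ) (sb : ContDiff ℝ ∞ b)
    (dF : ∀ i x, pd i F x = γ x * x i) (dγ : ∀ i x, pd i γ x = b x * x i)
    (db : ∀ i x, pd i b x = b₁ x * x i)
    (hγ : ∀ x, |γ x| * (1 + ‖x‖ ^ 2) ≤ A x) (hb : ∀ x, |b x| * (1 + ‖x‖ ^ 2) ^ 2 ≤ A x)
    (hb₁ : ∀ x, |b₁ x| * (1 + ‖x‖ ^ 2) ^ 3 ≤ A x)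
    (hint : Integrable fun x => Real.exp (2 * F x) * ((1 + A x) ^ 3 * (gradSq θ x + θ x ^ 2))) :
    Integrable (fun x => Real.exp (2 * F x) * virialDensity g θ γ b b₁ x) ∧
      ∫ x, Real.exp (2 * F x) * virialDensity g θ γ b b₁ x = 0 := by
  obtain ⟨M, hM0, hM⟩ := H.exists_quadratic
  have hdiv := sum_pd_virialField H.smooth_g H.smooth H.lap_eq sF sγ sb dF dγ db
  have sZ : ∀ i, ContDiff ℝ ∞ (virialField g θ F γ b i) := fun i =>
    contDiff_virialField H.smooth_g H.smooth sF sγ sb i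
  have hi : Integrable fun x => ∑ i, pd i (virialField g θ F γ b i) x := by
    refine (hint.const_mul (6 + 3 * M * (n + 2) + (n + 2) ^ 2)).mono'
      (Continuous.aestronglyMeasurable (continuous_finsetSum _ fun i _ =>
        ((sZ i).pd i).continuous)) (ae_of_all _ fun x => ?_)
    rw [hdiv, Real.norm_eq_abs, abs_mul, abs_of_pos (Real.exp_pos _)]
    calc _ ≤ Real.exp (2 * F x) * ((6 + 3 * M * (n + 2) + (n + 2) ^ 2) *
          ((1 + A x) ^ 3 * (gradSq θ x + θ x ^ 2))) :=
          mul_le_mul_of_nonneg_left (abs_virialDensity_le hM0 (hM x).1 (hM x).2 (hγ x) (hb x)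
            (hb₁ x)) (Real.exp_pos _).le
      _ = _ := by ring
  have h0 := integral_div_eq_zero sZ (hint.const_mul (M + n + 5))
    (fun i x => abs_virialField_le hM0 (hM x).1 (hγ x) (hb x) i) hi
  simp only [hdiv] at hi h0
  exact ⟨hi, h0⟩

/-- Weighted integrability from a family of bounded weights with slowly growing gradients. -/
theorem IsLocalizedSolution.integrable_of_weights {g : ℝ → ℝ} {θ : Euc n → ℝ} {k C : ℝ}
    (H : IsLocalizedSolution g θ k C) {F γ b b₁ : ℕ → Euc n → ℝ} {A Fl : Euc n → ℝ}
    (sF : ∀ N, ContDiff ℝ ∞ (F N)) (sγ : ∀ N, ContDiff ℝ ∞ (γ N)) (sb : ∀ N, ContDiff ℝ ∞ (b N))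
    (dF : ∀ N i x, pd i (F N) x = γ N x * x i) (dγ : ∀ N i x, pd i (γ N) x = b N x * x i)
    (db : ∀ N i x, pd i (b N) x = b₁ N x * x i) (γ0 : ∀ N x, 0 ≤ γ N x)
    (hγ : ∀ N x, |γ N x| * (1 + ‖x‖ ^ 2) ≤ A x)
    (hb : ∀ N x, |b N x| * (1 + ‖x‖ ^ 2) ^ 2 ≤ A x)
    (hb₁ : ∀ N x, |b₁ N x| * (1 + ‖x‖ ^ 2) ^ 3 ≤ A x)
    (hB : ∀ N, ∃ B, ∀ x, |γ N x| * (1 + ‖x‖ ^ 2) ≤ B ∧ |b N x| * (1 + ‖x‖ ^ 2) ^ 2 ≤ B ∧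
      |b₁ N x| * (1 + ‖x‖ ^ 2) ^ 3 ≤ B ∧ F N x ≤ B)
    (hF : ∀ N x, F N x ≤ Fl x) (hlim : ∀ x, Tendsto (fun N => F N x) atTop (𝓝 (Fl x)))
    (cF : Continuous Fl) (cA : Continuous A)
    (hA1 : Tendsto (fun x => (1 + A x) * |θ x|) (cocompact (Euc n)) (𝓝 0))
    (hA2 : Tendsto (fun x => (A x + A x ^ 2) / (1 + ‖x‖ ^ 2)) (cocompact (Euc n)) (𝓝 0)) :
    Integrable fun x => Real.exp (2 * Fl x) * (gradSq θ x + θ x ^ 2) := by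
  have hk := H.k_pos
  have cθ := H.smooth.continuous
  have cg := H.smooth.gradSq.continuous
  have hE0 : ∀ x, 0 ≤ gradSq θ x + θ x ^ 2 := fun x =>
    add_nonneg (gradSq_nonneg θ x) (sq_nonneg _)
  -- The error terms relative to θ². They tend to 0 at infinity, so outside a ball they use up at
  -- most half of 7/8 k.
  set ε : Euc n → ℝ := fun x => C * (n + 2) * ((1 + A x) * |θ x|) +
    (n + 2) ^ 2 * ((A x + A x ^ 2) / (1 + ‖x‖ ^ 2)) with hε
  have cε : Continuous ε := by
    have : ∀ x : Euc n, 1 + ‖x‖ ^ 2 ≠ 0 := fun x => by positivity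
    fun_prop (disch := assumption)
  have hε0 : Tendsto ε (cocompact (Euc n)) (𝓝 0) := by
    simpa using (hA1.const_mul (C * (n + 2))).add (hA2.const_mul (((n : ℝ) + 2) ^ 2))
  obtain ⟨R, hR⟩ := exists_norm_gt_of_eventually
    (hε0.eventually (gt_mem_nhds (show 0 < 7 / 16 * k by positivity)))
  set S := Metric.closedBall (0 : Euc n) R with hS
  have cS : IsCompact S := isCompact_closedBall _ _
  obtain ⟨D, hD⟩ := cS.exists_bound_of_continuousOn cε.continuousOn
  set c := min (1 / 8) (7 / 16 * k) with hc
  have hc0 : 0 < c := by positivity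
  have hc1 : c ≤ 1 / 8 := min_le_left _ _
  have hc2 : c ≤ 7 / 16 * k := min_le_right _ _
  have hlow : ∀ N x, c * (gradSq θ x + θ x ^ 2) - S.indicator (fun x => |D| * θ x ^ 2) x ≤
      virialDensity g θ (γ N) (b N) (b₁ N) x := by
    intro N x
    have hp : γ N x * ‖x‖ ^ 2 ≤ A x := by
      refine le_trans ?_ (hγ N x)
      rw [abs_of_nonneg (γ0 N x)]
      exact mul_le_mul_of_nonneg_left (by linarith) (γ0 N x)
    have h1 := H.virialDensity_ge (b := b N) (b₁ := b₁ N) (γ0 N x) hp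
    have h2 := (abs_le.1 (abs_virialCoeff_le (hγ N x) (hb N x) (hb₁ N x))).1
    have h3 := mul_le_mul_of_nonneg_right h2 (sq_nonneg (θ x))
    have hT := gradSq_nonneg θ x
    have h4 : c * gradSq θ x ≤ 1 / 8 * gradSq θ x := mul_le_mul_of_nonneg_right hc1 hT
    have h5 : c * θ x ^ 2 ≤ 7 / 16 * k * θ x ^ 2 := mul_le_mul_of_nonneg_right hc2 (sq_nonneg _)
    have h6 : ε x * θ x ^ 2 ≤ 7 / 16 * k * θ x ^ 2 + S.indicator (fun x => |D| * θ x ^ 2) x := by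
      by_cases hx : x ∈ S
      · rw [Set.indicator_of_mem hx]
        have h7 : ε x ≤ |D| := (le_abs_self _).trans ((hD x hx).trans (le_abs_self _))
        have h8 := mul_le_mul_of_nonneg_right h7 (sq_nonneg (θ x))
        have h9 : 0 ≤ 7 / 16 * k * θ x ^ 2 := by positivity
        linarith
      · rw [Set.indicator_of_notMem hx, add_zero]
        exact mul_le_mul_of_nonneg_right (hR x (by simpa [hS] using hx)).le (sq_nonneg _)
    simp only [hε] at h6
    nlinarith
  have hWi : ∀ N, Integrable fun x => Real.exp (2 * F N x) * (gradSq θ x + θ x ^ 2) := by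
    intro N
    obtain ⟨B, hB⟩ := hB N
    refine H.integrable.bdd_mul (c := Real.exp (2 * B))
      (by have := (sF N).continuous; fun_prop) (ae_of_all _ fun x => ?_)
    rw [Real.norm_of_nonneg (Real.exp_pos _).le]
    exact Real.exp_le_exp.2 (by linarith [(hB x).2.2.2])
  have hVi : ∀ N, Integrable (fun x => Real.exp (2 * F N x) *
      virialDensity g θ (γ N) (b N) (b₁ N) x) ∧
      ∫ x, Real.exp (2 * F N x) * virialDensity g θ (γ N) (b N) (b₁ N) x = 0 := by
    intro N
    obtain ⟨B, hB⟩ := hB N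
    refine H.integral_virial (A := fun _ => B) (sF N) (sγ N) (sb N) (dF N) (dγ N) (db N)
      (fun x => (hB x).1) (fun x => (hB x).2.1) (fun x => (hB x).2.2.1) ?_
    refine ((hWi N).const_mul ((1 + B) ^ 3)).congr (ae_of_all _ fun x => ?_)
    simp only
    ring
  have mS : MeasurableSet S := cS.measurableSet
  have hI : Integrable (S.indicator fun x => Real.exp (2 * Fl x) * (|D| * θ x ^ 2)) :=
    ((by fun_prop : Continuous fun x => Real.exp (2 * Fl x) * (|D| * θ x ^ 2)).continuousOn
      |>.integrableOn_compact cS).integrable_indicator mS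
  -- The virial integral vanishes, so the positive part of the density is controlled by the error on
  -- the ball S. There F N ≤ Fl bounds it uniformly in N, and Fatou's lemma removes the cutoff.
  refine integrable_of_tendsto_of_integral_le
    (K := c⁻¹ * ∫ x, S.indicator (fun x => Real.exp (2 * Fl x) * (|D| * θ x ^ 2)) x) hWi
    (fun N x => mul_nonneg (Real.exp_pos _).le (hE0 x)) (fun N => ?_)
    (fun x => ((Real.continuous_exp.tendsto _).comp ((hlim x).const_mul 2)).mul_const _)
    (by fun_prop)
  rw [inv_mul_eq_div, le_div_iff₀ hc0, mul_comm, ← integral_const_mul, ← sub_nonpos,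
    ← integral_sub ((hWi N).const_mul c) hI, ← (hVi N).2]
  refine integral_mono (((hWi N).const_mul c).sub hI) (hVi N).1 fun x => ?_
  have h1 := mul_le_mul_of_nonneg_left (hlow N x) (Real.exp_pos (2 * F N x)).le
  refine le_trans ?_ h1
  simp only
  have h2 : Real.exp (2 * F N x) * S.indicator (fun x => |D| * θ x ^ 2) x ≤
      S.indicator (fun x => Real.exp (2 * Fl x) * (|D| * θ x ^ 2)) x := by
    by_cases hx : x ∈ S
    · rw [Set.indicator_of_mem hx, Set.indicator_of_mem hx]
      exact mul_le_mul_of_nonneg_right (Real.exp_le_exp.2 (by linarith [hF N x])) (by positivity)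
    · rw [Set.indicator_of_notMem hx, Set.indicator_of_notMem hx, mul_zero]
  linarith

end WeightedVirial

/-! ### Bounded approximations of logarithmic and power weights -/

section Weights

/-- The smooth radial variable `1 + |x|²`. -/
noncomputable def radSq (x : Euc n) : ℝ := 1 + ‖x‖ ^ 2

theorem one_le_radSq (x : Euc n) : 1 ≤ radSq x := by
  unfold radSq; nlinarith [sq_nonneg ‖x‖]

theorem radSq_pos (x : Euc n) : 0 < radSq x := one_pos.trans_le (one_le_radSq x)

theorem contDiff_radSq : ContDiff ℝ ∞ (radSq : Euc n → ℝ) :=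
  contDiff_const.add contDiff_norm_sq_euc

theorem continuous_radSq : Continuous (radSq : Euc n → ℝ) := contDiff_radSq.continuous

theorem pd_comp_radSq {f : ℝ → ℝ} {f' : ℝ} {x : Euc n} (hf : HasDerivAt f f' (radSq x))
    (i : Fin n) : pd i (fun x => f (radSq x)) x = 2 * f' * x i := by
  have h : pd i (radSq : Euc n → ℝ) x = 2 * x i := by
    have := pd_add (x := x) (differentiableAt_const (1 : ℝ))
      (Smooth.differentiable contDiff_norm_sq_euc x) i
    rw [pd_const, pd_norm_sq, zero_add] at this
    exact this
  rw [pd_comp hf (Smooth.differentiable contDiff_radSq x), h]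
  ring

theorem tendsto_radSq : Tendsto (radSq : Euc n → ℝ) (cocompact (Euc n)) atTop :=
  tendsto_atTop_add_const_left _ _
    ((tendsto_pow_atTop two_ne_zero).comp (tendsto_norm_cocompact_atTop (E := Euc n)))

/-- The cutoff factor `S / (S + y)`. -/
noncomputable def cutoffRatio (S y : ℝ) : ℝ := S / (S + y)

theorem cutoffRatio_pos {S y : ℝ} (hS : 0 < S) (hy : 0 < y) : 0 < cutoffRatio S y := by
  unfold cutoffRatio; positivity

theorem cutoffRatio_le_one {S y : ℝ} (hS : 0 < S) (hy : 0 < y) : cutoffRatio S y ≤ 1 :=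
  div_le_one_of_le₀ (by linarith) (by linarith)

theorem mul_cutoffRatio_le {S y : ℝ} (hS : 0 < S) (hy : 0 < y) : y * cutoffRatio S y ≤ S := by
  rw [cutoffRatio, mul_div_assoc', div_le_iff₀ (by linarith)]
  nlinarith

theorem hasDerivAt_cutoffRatio {S y : ℝ} (hS : 0 < S) (hy : 0 < y) :
    HasDerivAt (cutoffRatio S) (-(cutoffRatio S y * (1 - cutoffRatio S y)) / y) y := by
  have h1 : HasDerivAt (fun y => S + y) 1 y := (hasDerivAt_id y).const_add S
  have h := (hasDerivAt_const y S).div h1 (by positivity)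
  refine h.congr_deriv ?_
  rw [cutoffRatio]
  field_simp
  ring

theorem tendsto_cutoffRatio (y : ℝ) :
    Tendsto (fun N : ℕ => cutoffRatio ((N : ℝ) + 1) y) atTop (𝓝 1) := by
  have h1 : Tendsto (fun N : ℕ => (N : ℝ) + 1) atTop atTop :=
    tendsto_atTop_add_const_right _ _ tendsto_natCast_atTop_atTop
  have h2 : Tendsto (fun N : ℕ => 1 - y / ((N : ℝ) + 1 + y)) atTop (𝓝 (1 - 0)) :=
    tendsto_const_nhds.sub (tendsto_const_nhds.div_atTop (tendsto_atTop_add_const_right _ _ h1))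
  rw [sub_zero] at h2
  refine h2.congr' ?_
  filter_upwards [(tendsto_atTop_add_const_right _ y h1).eventually (eventually_gt_atTop 0)]
    with N hN
  rw [cutoffRatio, eq_div_iff hN.ne']
  field_simp
  ring

/-- The functions `a (yσ)ˢ Q(σ) / yʲ`, with `y = 1 + |x|²` and `σ = S / (S + y)`. -/
noncomputable def cutoffWeight (a s S : ℝ) (Q : ℝ → ℝ) (j : ℕ) (x : Euc n) : ℝ :=
  a * (radSq x * cutoffRatio S (radSq x)) ^ s * Q (cutoffRatio S (radSq x)) / radSq x ^ j

theorem contDiff_cutoffWeight (a s : ℝ) {S : ℝ} (hS : 0 < S) {Q : ℝ → ℝ} (hQ : ContDiff ℝ ∞ Q)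
    (j : ℕ) : ContDiff ℝ ∞ (cutoffWeight a s S Q j : Euc n → ℝ) := by
  have h0 : ∀ x : Euc n, S + radSq x ≠ 0 := fun x => by have := radSq_pos x; positivity
  have h1 : ContDiff ℝ ∞ fun x : Euc n => cutoffRatio S (radSq x) :=
    contDiff_const.div (contDiff_const.add contDiff_radSq) h0
  have h2 : ContDiff ℝ ∞ fun x : Euc n => (radSq x * cutoffRatio S (radSq x)) ^ s :=
    (contDiff_radSq.mul h1).rpow_const_of_ne fun x =>
      (mul_pos (radSq_pos x) (cutoffRatio_pos hS (radSq_pos x))).ne'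
  exact ((contDiff_const.mul h2).mul (hQ.comp h1)).div (contDiff_radSq.pow j)
    fun x => pow_ne_zero _ (radSq_pos x).ne'

/-- With yσ' = -σ(1 - σ) and (yσ)' = σ², differentiation preserves the form a(yσ)^s Q(σ)/y^j. It
raises j by one and transforms Q, so all derivatives of the weights are estimated at once. -/
theorem hasDerivAt_cutoffWeight (a s : ℝ) {S : ℝ} (hS : 0 < S) {Q : ℝ → ℝ} (hQ : Differentiable ℝ Q)
    (j : ℕ) {y : ℝ} (hy : 0 < y) :
    HasDerivAt (fun y => a * (y * cutoffRatio S y) ^ s * Q (cutoffRatio S y) / y ^ j)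
      (a * (y * cutoffRatio S y) ^ s * ((s * cutoffRatio S y - j) * Q (cutoffRatio S y) -
        deriv Q (cutoffRatio S y) * (cutoffRatio S y * (1 - cutoffRatio S y))) / y ^ (j + 1)) y := by
  have hσ := cutoffRatio_pos hS hy
  have dσ := hasDerivAt_cutoffRatio hS hy
  set σ := cutoffRatio S y with hσdef
  have hu : HasDerivAt (fun y => y * cutoffRatio S y) (σ ^ 2) y := by
    refine ((hasDerivAt_id y).mul dσ).congr_deriv ?_
    simp only [id, ← hσdef]
    field_simp
    ring
  have hr := hu.rpow_const (p := s) (Or.inl (by positivity))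
  have hq := (hQ (cutoffRatio S y)).hasDerivAt.comp y dσ
  have hp : HasDerivAt (fun y : ℝ => y ^ j) (j * y ^ (j - 1)) y := hasDerivAt_pow j y
  have hp' : (j : ℝ) * y ^ (j - 1) = j * y ^ j / y := by
    cases j with
    | zero => simp
    | succ j =>
      rw [Nat.add_sub_cancel, pow_succ]
      field_simp
  rw [hp'] at hp
  refine (((hr.const_mul a).mul hq).div hp (by positivity)).congr_deriv ?_
  rw [Real.rpow_sub_one (by positivity)]
  simp only [← hσdef, Function.comp, Pi.mul_apply]
  field_simp
  ring

theorem pd_cutoffWeight (a s : ℝ) {S : ℝ} (hS : 0 < S) {Q : ℝ → ℝ} (hQ : Differentiable ℝ Q)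
    (j : ℕ) (i : Fin n) (x : Euc n) :
    pd i (cutoffWeight a s S Q j) x =
      2 * cutoffWeight a s S (fun t => (s * t - j) * Q t - deriv Q t * (t * (1 - t))) (j + 1) x *
        x i :=
  pd_comp_radSq (f := fun y => a * (y * cutoffRatio S y) ^ s * Q (cutoffRatio S y) / y ^ j)
    (hasDerivAt_cutoffWeight a s hS hQ j (radSq_pos x)) i

theorem abs_cutoffWeight_mul_le {a s S : ℝ} (ha : 0 ≤ a) (hS : 0 < S) {Q : ℝ → ℝ} {q : ℝ}
    (hQ : ∀ t, 0 ≤ t → t ≤ 1 → |Q t| ≤ q) (j : ℕ) (x : Euc n) :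
    |cutoffWeight a s S Q j x| * radSq x ^ j ≤
      q * (a * (radSq x * cutoffRatio S (radSq x)) ^ s) := by
  have hy := radSq_pos x
  have hσ := cutoffRatio_pos hS hy
  have hr : 0 ≤ (radSq x * cutoffRatio S (radSq x)) ^ s := by positivity
  rw [cutoffWeight, abs_div, abs_of_pos (pow_pos hy j), div_mul_cancel₀ _ (pow_pos hy j).ne',
    abs_mul, abs_mul, abs_of_nonneg ha, abs_of_nonneg hr, mul_comm q]
  exact mul_le_mul_of_nonneg_left (hQ _ hσ.le (cutoffRatio_le_one hS hy)) (by positivity)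

/-- Here A = 48a(1+|x|²)^s. The restriction s ≤ 1/4 makes A² at most a multiple of (1+|x|²)^(1/2),
so (A + A²)/(1+|x|²) tends to 0. The case s = 0 serves logarithmic F, s = 1/4 fractional powers. -/
theorem IsLocalizedSolution.integrable_of_cutoffWeights {g : ℝ → ℝ} {θ : Euc n → ℝ} {k C : ℝ}
    (H : IsLocalizedSolution g θ k C) {a s : ℝ} (ha : 0 ≤ a) (hs0 : 0 ≤ s) (hs1 : s ≤ 1 / 4)
    {F : ℕ → Euc n → ℝ} {Fl : Euc n → ℝ} (sF : ∀ N, ContDiff ℝ ∞ (F N))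
    (dF : ∀ N i x, pd i (F N) x = 2 * cutoffWeight a s ((N : ℝ) + 1) (fun t => t) 1 x * x i)
    (hB : ∀ N, ∃ B, ∀ x, F N x ≤ B)
    (hF : ∀ N x, F N x ≤ Fl x) (hlim : ∀ x, Tendsto (fun N => F N x) atTop (𝓝 (Fl x)))
    (cF : Continuous Fl)
    (hθ : Tendsto (fun x => radSq x ^ s * |θ x|) (cocompact (Euc n)) (𝓝 0)) :
    Integrable fun x => Real.exp (2 * Fl x) * (gradSq θ x + θ x ^ 2) := by
  -- Obtained from Q(t) = t with j = 1 by applying the differentiation rule once, and then again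
  -- with j = 2.
  set Q₂ : ℝ → ℝ := fun t => (s * t - 1) * t - 1 * (t * (1 - t)) with hQ₂
  set Q₃ : ℝ → ℝ := fun t => (s * t - 2) * Q₂ t - (2 * (s + 1) * t - 2) * (t * (1 - t)) with hQ₃
  have sQ₂ : ContDiff ℝ ∞ Q₂ := by fun_prop
  have sQ₃ : ContDiff ℝ ∞ Q₃ := by fun_prop
  have dQ₂ : deriv Q₂ = fun t => 2 * (s + 1) * t - 2 := by
    have e : Q₂ = fun t => (s + 1) * t ^ 2 - 2 * t := by ext t; simp only [hQ₂]; ring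
    ext t
    rw [e]
    have := ((hasDerivAt_pow 2 t).const_mul (s + 1)).sub ((hasDerivAt_id t).const_mul 2)
    refine this.deriv.trans ?_
    simp
    ring
  have b1 : ∀ t : ℝ, 0 ≤ t → t ≤ 1 → |t| ≤ 1 := fun t h0 h1 => by rwa [abs_of_nonneg h0]
  have b2 : ∀ t, 0 ≤ t → t ≤ 1 → |Q₂ t| ≤ 2 := fun t h0 h1 => by
    have e : Q₂ t = -(t * (2 - (s + 1) * t)) := by simp only [hQ₂]; ring
    have h2 : 0 ≤ 2 - (s + 1) * t := by nlinarith
    have h3 : 2 - (s + 1) * t ≤ 2 := by nlinarith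
    rw [e, abs_neg, abs_of_nonneg (mul_nonneg h0 h2)]
    nlinarith
  have b3 : ∀ t, 0 ≤ t → t ≤ 1 → |Q₃ t| ≤ 6 := fun t h0 h1 => by
    have e1 : |s * t - 2| ≤ 2 := abs_le.2 ⟨by nlinarith, by nlinarith⟩
    have e2 : |2 * (s + 1) * t - 2| ≤ 2 := abs_le.2 ⟨by nlinarith, by nlinarith⟩
    have e3 : |t * (1 - t)| ≤ 1 := abs_le.2 ⟨by nlinarith, by nlinarith⟩
    simp only [hQ₃]
    refine (abs_sub _ _).trans ?_
    rw [abs_mul, abs_mul (2 * (s + 1) * t - 2)]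
    have h4 := mul_le_mul e1 (b2 t h0 h1) (abs_nonneg _) zero_le_two
    have h5 := mul_le_mul e2 e3 (abs_nonneg _) zero_le_two
    linarith
  have hS : ∀ N : ℕ, (0 : ℝ) < N + 1 := fun N => by positivity
  -- The constant 48 = 8 · 6 is the largest of the products 2 · 1, 4 · 2, 8 · 6 of prefactor and
  -- bound for t, Q₂, Q₃.
  have gb : ∀ (N : ℕ) (x : Euc n) (c : ℝ), 0 ≤ c → ∀ (Q : ℝ → ℝ) (q : ℝ) (j : ℕ),
      (∀ t, 0 ≤ t → t ≤ 1 → |Q t| ≤ q) → c * q ≤ 48 →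
      |c * cutoffWeight a s ((N : ℝ) + 1) Q j x| * radSq x ^ j ≤
        48 * (a * (radSq x * cutoffRatio (N + 1) (radSq x)) ^ s) := by
    intro N x c hc Q q j hQ hcq
    have hy := radSq_pos x
    have hσ := cutoffRatio_pos (hS N) hy
    rw [abs_mul, abs_of_nonneg hc, mul_assoc]
    refine (mul_le_mul_of_nonneg_left (abs_cutoffWeight_mul_le ha (hS N) hQ j x) hc).trans ?_
    rw [← mul_assoc]
    exact mul_le_mul_of_nonneg_right hcq (by positivity)
  have up : ∀ (N : ℕ) (x : Euc n), 48 * (a * (radSq x * cutoffRatio (N + 1) (radSq x)) ^ s) ≤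
      48 * (a * radSq x ^ s) := by
    intro N x
    have hy := radSq_pos x
    have hσ := cutoffRatio_pos (hS N) hy
    gcongr
    exact mul_le_of_le_one_right hy.le (cutoffRatio_le_one (hS N) hy)
  have upN : ∀ (N : ℕ) (x : Euc n), 48 * (a * (radSq x * cutoffRatio (N + 1) (radSq x)) ^ s) ≤
      48 * (a * ((N : ℝ) + 1) ^ s) := by
    intro N x
    have hy := radSq_pos x
    have hσ := cutoffRatio_pos (hS N) hy
    gcongr
    exact mul_cutoffRatio_le (hS N) hy
  have g1 := fun N x => gb N x 2 (by norm_num) (fun t => t) 1 1 b1 (by norm_num)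
  have g2 := fun N x => gb N x 4 (by norm_num) Q₂ 2 2 b2 (by norm_num)
  have g3 := fun N x => gb N x 8 (by norm_num) Q₃ 6 3 b3 (by norm_num)
  simp only [pow_one] at g1
  refine H.integrable_of_weights (F := F)
    (γ := fun N x => 2 * cutoffWeight a s ((N : ℝ) + 1) (fun t => t) 1 x)
    (b := fun N x => 4 * cutoffWeight a s ((N : ℝ) + 1) Q₂ 2 x)
    (b₁ := fun N x => 8 * cutoffWeight a s ((N : ℝ) + 1) Q₃ 3 x)
    (A := fun x => 48 * (a * radSq x ^ s)) sF
    (fun N => contDiff_const.mul (contDiff_cutoffWeight a s (hS N) contDiff_fun_id 1))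
    (fun N => contDiff_const.mul (contDiff_cutoffWeight a s (hS N) sQ₂ 2)) dF ?_ ?_ ?_
    (fun N x => (g1 N x).trans (up N x)) (fun N x => (g2 N x).trans (up N x))
    (fun N x => (g3 N x).trans (up N x)) ?_ hF hlim cF ?_ ?_ ?_
  · intro N i x
    rw [pd_const_mul (Smooth.differentiable (contDiff_cutoffWeight a s (hS N) contDiff_fun_id 1) x),
      pd_cutoffWeight a s (hS N) differentiable_fun_id]
    simp only [deriv_id'', Nat.cast_one]
    ring
  · intro N i x
    rw [pd_const_mul (Smooth.differentiable (contDiff_cutoffWeight a s (hS N) sQ₂ 2) x),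
      pd_cutoffWeight a s (hS N) (sQ₂.differentiable (by simp)), dQ₂]
    simp only [Nat.cast_ofNat]
    ring
  · intro N x
    have hy := radSq_pos x
    have hσ := cutoffRatio_pos (hS N) hy
    unfold cutoffWeight
    positivity
  · intro N
    obtain ⟨B, hB⟩ := hB N
    exact ⟨max B (48 * (a * ((N : ℝ) + 1) ^ s)), fun x =>
      ⟨((g1 N x).trans (upN N x)).trans (le_max_right _ _),
        ((g2 N x).trans (upN N x)).trans (le_max_right _ _),
        ((g3 N x).trans (upN N x)).trans (le_max_right _ _), (hB x).trans (le_max_left _ _)⟩⟩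
  · exact continuous_const.mul (continuous_const.mul
      (continuous_radSq.rpow_const fun x => Or.inl (radSq_pos x).ne'))
  · refine squeeze_zero (fun x => by have := radSq_pos x; positivity) (fun x => ?_)
      (by simpa using hθ.const_mul (1 + 48 * a))
    have h1 : 1 ≤ radSq x ^ s := Real.one_le_rpow (one_le_radSq x) hs0
    have h2 := abs_nonneg (θ x)
    have h3 := mul_le_mul_of_nonneg_right h1 h2
    have h4 : (1 + 48 * a) * (radSq x ^ s * |θ x|) =
      radSq x ^ s * |θ x| + 48 * (a * radSq x ^ s) * |θ x| := by ring
    rw [h4, add_mul]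
    linarith
  · have ht : Tendsto (fun x : Euc n => (48 * a + (48 * a) ^ 2) * radSq x ^ (-(1 / 2) : ℝ))
        (cocompact (Euc n)) (𝓝 0) := by
      simpa using ((tendsto_rpow_neg_atTop (by norm_num : (0 : ℝ) < 1 / 2)).comp
        tendsto_radSq).const_mul (48 * a + (48 * a) ^ 2)
    refine squeeze_zero (fun x => by have := radSq_pos x; positivity) (fun x => ?_) ht
    have hy := radSq_pos x
    have hy1 := one_le_radSq x
    change _ / radSq x ≤ _
    rw [div_le_iff₀ hy, mul_assoc, ← Real.rpow_add_one hy.ne']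
    have h1 : radSq x ^ s ≤ radSq x ^ (-(1 / 2) + 1 : ℝ) :=
      Real.rpow_le_rpow_of_exponent_le hy1 (by linarith)
    have h2 : (radSq x ^ s) ^ 2 ≤ radSq x ^ (-(1 / 2) + 1 : ℝ) := by
      rw [← Real.rpow_mul_natCast hy.le]
      exact Real.rpow_le_rpow_of_exponent_le hy1 (by push_cast; linarith)
    have h3 := mul_le_mul_of_nonneg_left h1 (show 0 ≤ 48 * a by positivity)
    have h4 := mul_le_mul_of_nonneg_left h2 (show 0 ≤ (48 * a) ^ 2 by positivity)
    nlinarith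

end Weights

/-! ### Polynomial moments, pointwise decay, exponential moments -/

section Decay

/-- The logarithmic weight has bounded A, so θ → 0 is all the decay needed, and every polynomial
moment is finite. -/
theorem IsLocalizedSolution.integrable_radSq_rpow {g : ℝ → ℝ} {θ : Euc n → ℝ} {k C : ℝ}
    (H : IsLocalizedSolution g θ k C) {a : ℝ} (ha : 0 ≤ a) :
    Integrable fun x => Real.exp (2 * (a * Real.log (radSq x))) * (gradSq θ x + θ x ^ 2) := by
  have hS : ∀ N : ℕ, (0 : ℝ) < N + 1 := fun N => by positivity
  have hpos : ∀ (N : ℕ) (x : Euc n), 0 < radSq x * cutoffRatio ((N : ℝ) + 1) (radSq x) :=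
    fun N x => mul_pos (radSq_pos x) (cutoffRatio_pos (hS N) (radSq_pos x))
  have cu : ∀ N : ℕ, ContDiff ℝ ∞ fun x : Euc n =>
      radSq x * cutoffRatio ((N : ℝ) + 1) (radSq x) := fun N =>
    contDiff_radSq.mul (contDiff_const.div (contDiff_const.add contDiff_radSq)
      fun x => by have := radSq_pos x; positivity)
  refine H.integrable_of_cutoffWeights (a := a) (s := 0) ha le_rfl (by norm_num)
    (F := fun N x => a * Real.log (radSq x * cutoffRatio ((N : ℝ) + 1) (radSq x)))
    (fun N => contDiff_const.mul ((cu N).log fun x => (hpos N x).ne')) ?_ ?_ ?_ ?_ ?_ ?_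
  · intro N i x
    have hy := radSq_pos x
    have hσ := cutoffRatio_pos (hS N) hy
    have hd : HasDerivAt (fun y => a * Real.log (y * cutoffRatio ((N : ℝ) + 1) y))
        (a * (cutoffRatio ((N : ℝ) + 1) (radSq x) / radSq x)) (radSq x) := by
      have h1 := ((hasDerivAt_id (radSq x)).mul (hasDerivAt_cutoffRatio (hS N) hy)).log
        (by exact (hpos N x).ne')
      refine (h1.const_mul a).congr_deriv ?_
      simp only [id, Pi.mul_apply]
      field_simp
      ring
    rw [pd_comp_radSq (f := fun y => a * Real.log (y * cutoffRatio ((N : ℝ) + 1) y)) hd]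
    simp only [cutoffWeight, Real.rpow_zero, pow_one, mul_one]
    ring
  · exact fun N => ⟨a * Real.log ((N : ℝ) + 1), fun x => mul_le_mul_of_nonneg_left
      (Real.log_le_log (hpos N x) (mul_cutoffRatio_le (hS N) (radSq_pos x))) ha⟩
  · exact fun N x => mul_le_mul_of_nonneg_left (Real.log_le_log (hpos N x)
      (mul_le_of_le_one_right (radSq_pos x).le (cutoffRatio_le_one (hS N) (radSq_pos x)))) ha
  · intro x
    have h1 : Tendsto (fun N : ℕ => radSq x * cutoffRatio ((N : ℝ) + 1) (radSq x)) atTop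
        (𝓝 (radSq x)) := by simpa using (tendsto_cutoffRatio (radSq x)).const_mul (radSq x)
    exact (h1.log (radSq_pos x).ne').const_mul a
  · exact continuous_const.mul (continuous_radSq.log fun x => (radSq_pos x).ne')
  · simpa using H.tendsto.abs

/-- A moment bound and a gradient bound give pointwise decay. -/
theorem exists_decay_of_integrable {θ : Euc n → ℝ} (sθ : ContDiff ℝ ∞ θ)
    (hb : ∃ M, ∀ x, |θ x| ≤ M) (hg : ∃ L, ∀ x, gradSq θ x ≤ L)
    (hi : Integrable fun x => radSq x ^ (n + 2) * θ x ^ 2) :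
    ∃ D, ∀ x, radSq x * |θ x| ≤ D := by
  obtain ⟨M, hM⟩ := hb
  obtain ⟨L₀, hL₀⟩ := hg
  set L := max 1 (max M √L₀) with hL
  have hL1 : 1 ≤ L := le_max_left _ _
  have hL0 : 0 < L := by linarith
  have hML : ∀ x, |θ x| ≤ L := fun x =>
    (hM x).trans ((le_max_left _ _).trans (le_max_right _ _))
  have hlip : ∀ x y, |θ x - θ y| ≤ L * ‖x - y‖ := fun x y =>
    Convex.norm_image_sub_le_of_norm_fderiv_le (𝕜 := ℝ) (s := Set.univ)
      (fun x _ => Smooth.differentiable sθ x) (fun z _ => by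
        rw [norm_fderiv_eq]
        exact (Real.sqrt_le_sqrt (hL₀ z)).trans ((le_max_right _ _).trans (le_max_right _ _)))
      convex_univ (Set.mem_univ y) (Set.mem_univ x)
  set v := volume.real (Metric.ball (0 : Euc n) 1) with hv
  have hv0 : 0 < v := ENNReal.toReal_pos (Metric.measure_ball_pos volume _ one_pos).ne'
    measure_ball_lt_top.ne
  set I := ∫ x, radSq x ^ (n + 2) * θ x ^ 2 with hI
  -- On the ball of radius r = |θ x₀|/(2L) ≤ 1 the Lipschitz bound keeps |θ| ≥ |θ x₀|/2, and the
  -- weight loses at most a factor 3. The volume contributes |θ x₀|^n and the integrand |θ x₀|²,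
  -- which explains the exponent n + 2 of the weight.
  set K := (1 / 3 : ℝ) ^ (n + 2) * (1 / 4) * (1 / (2 * L)) ^ n * v with hK
  have hK0 : 0 < K := by positivity
  refine ⟨1 + I / K, fun x₀ => ?_⟩
  set δ := |θ x₀| with hδ
  have hδ0 : 0 ≤ δ := abs_nonneg _
  set r := δ / (2 * L) with hr
  have hr0 : 0 ≤ r := by positivity
  have hr1 : r ≤ 1 := by
    rw [hr, div_le_one (by positivity)]
    linarith [hML x₀]
  set Bl := Metric.closedBall x₀ r with hBl
  have hvol : volume.real Bl = r ^ n * v := by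
    rw [hBl, measureReal_def, Measure.addHaar_closedBall _ _ hr0, ENNReal.toReal_mul,
      ENNReal.toReal_ofReal (by positivity)]
    simp [hv, measureReal_def]
  have hcB : IsCompact Bl := isCompact_closedBall _ _
  have hpt : ∀ x ∈ Bl, (radSq x₀ / 3) ^ (n + 2) * (δ / 2) ^ 2 ≤ radSq x ^ (n + 2) * θ x ^ 2 := by
    intro x hx
    rw [hBl, Metric.mem_closedBall, dist_eq_norm] at hx
    have h1 : radSq x₀ / 3 ≤ radSq x := by
      have h2 : ‖x₀‖ ≤ ‖x‖ + 1 := by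
        have := norm_sub_norm_le x₀ x
        rw [norm_sub_rev] at this
        linarith
      have h3 : ‖x₀‖ ^ 2 ≤ (‖x‖ + 1) ^ 2 := pow_le_pow_left₀ (norm_nonneg _) h2 2
      unfold radSq
      nlinarith [sq_nonneg (‖x‖ - 1)]
    have h4 : δ / 2 ≤ |θ x| := by
      have h5 := hlip x x₀
      have h6 : L * ‖x - x₀‖ ≤ δ / 2 := by
        calc L * ‖x - x₀‖ ≤ L * r := by gcongr
          _ = δ / 2 := by rw [hr]; field_simp
      have h7 := abs_sub_abs_le_abs_sub (θ x₀) (θ x)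
      rw [abs_sub_comm] at h7
      linarith
    have h8 : (δ / 2) ^ 2 ≤ θ x ^ 2 := by
      rw [← sq_abs (θ x)]
      exact pow_le_pow_left₀ (by positivity) h4 2
    have h9 := radSq_pos x₀
    have h10 := radSq_pos x
    gcongr
  have hint : r ^ n * v * ((radSq x₀ / 3) ^ (n + 2) * (δ / 2) ^ 2) ≤ I := by
    have h1 := setIntegral_mono_on (integrableOn_const hcB.measure_lt_top.ne) hi.integrableOn
      hcB.measurableSet hpt
    rw [setIntegral_const, smul_eq_mul, hvol] at h1
    refine h1.trans (setIntegral_le_integral hi (ae_of_all _ fun x => ?_))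
    have := radSq_pos x
    positivity
  have hKI : K * (radSq x₀ * δ) ^ (n + 2) ≤ I := by
    refine le_of_eq_of_le ?_ hint
    rw [hK, hr]
    simp only [div_pow, mul_pow, pow_add]
    ring
  have hI0 : 0 ≤ I / K := by
    have : 0 ≤ I := le_trans (by have := radSq_pos x₀; positivity) hKI
    positivity
  by_cases ht : radSq x₀ * δ ≤ 1
  · linarith
  · push Not at ht
    have h1 : radSq x₀ * δ ≤ (radSq x₀ * δ) ^ (n + 2) := le_self_pow₀ ht.le (by omega)
    have h2 : (radSq x₀ * δ) ^ (n + 2) ≤ I / K := by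
      rw [le_div_iff₀ hK0]
      linarith
    linarith

theorem IsLocalizedSolution.exists_decay {g : ℝ → ℝ} {θ : Euc n → ℝ} {k C : ℝ}
    (H : IsLocalizedSolution g θ k C) : ∃ D, ∀ x, radSq x * |θ x| ≤ D := by
  have hb := bdd_of_tendsto_zero H.smooth.continuous H.tendsto
  have hB := bddDeriv_of_semilinear H.smooth_g H.smooth H.lap_eq hb 1
  choose B hB' using fun i => (hB.2 i).bdd
  refine exists_decay_of_integrable H.smooth hb ⟨∑ i, B i ^ 2, fun x => ?_⟩ ?_
  · refine Finset.sum_le_sum fun i _ => ?_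
    rw [← sq_abs]
    exact pow_le_pow_left₀ (abs_nonneg _) (hB' i x) 2
  · refine (H.integrable_radSq_rpow (a := (n + 2 : ℕ) / 2) (by positivity)).mono'
      (((continuous_radSq.pow _).mul (H.smooth.continuous.pow 2)).aestronglyMeasurable)
      (ae_of_all _ fun x => ?_)
    have hy := radSq_pos x
    have e : Real.exp (2 * ((n + 2 : ℕ) / 2 * Real.log (radSq x))) = radSq x ^ (n + 2) := by
      rw [← mul_assoc, mul_div_cancel₀ _ (two_ne_zero' ℝ), Real.exp_nat_mul, Real.exp_log hy]
    rw [e, Real.norm_of_nonneg (by positivity)]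
    have := gradSq_nonneg θ x
    gcongr
    linarith

/-- The decay |θ| ≤ D/(1+|x|²) makes (1+|x|²)^(1/4)|θ| tend to 0, which admits the weight for every
τ. -/
theorem IsLocalizedSolution.integrable_exp {g : ℝ → ℝ} {θ : Euc n → ℝ} {k C : ℝ}
    (H : IsLocalizedSolution g θ k C) {τ : ℝ} (hτ : 0 ≤ τ) :
    Integrable fun x => Real.exp (2 * (τ * radSq x ^ (1 / 4 : ℝ))) *
      (gradSq θ x + θ x ^ 2) := by
  obtain ⟨D, hD⟩ := H.exists_decay
  have hS : ∀ N : ℕ, (0 : ℝ) < N + 1 := fun N => by positivity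
  have hpos : ∀ (N : ℕ) (x : Euc n), 0 < radSq x * cutoffRatio ((N : ℝ) + 1) (radSq x) :=
    fun N x => mul_pos (radSq_pos x) (cutoffRatio_pos (hS N) (radSq_pos x))
  refine H.integrable_of_cutoffWeights (a := τ / 4) (s := 1 / 4) (by positivity) (by norm_num)
    le_rfl (F := fun N => cutoffWeight τ (1 / 4) ((N : ℝ) + 1) (fun _ => 1) 0)
    (fun N => contDiff_cutoffWeight _ _ (hS N) contDiff_const 0) ?_ ?_ ?_ ?_ ?_ ?_
  · intro N i x
    rw [pd_cutoffWeight _ _ (hS N) (differentiable_const _)]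
    simp only [cutoffWeight, deriv_const']
    push_cast
    ring
  · refine fun N => ⟨τ * ((N : ℝ) + 1) ^ (1 / 4 : ℝ), fun x => ?_⟩
    have := (hpos N x).le
    simp only [cutoffWeight, mul_one, pow_zero, div_one]
    gcongr
    exact mul_cutoffRatio_le (hS N) (radSq_pos x)
  · intro N x
    have := (hpos N x).le
    simp only [cutoffWeight, mul_one, pow_zero, div_one]
    gcongr
    exact mul_le_of_le_one_right (radSq_pos x).le (cutoffRatio_le_one (hS N) (radSq_pos x))
  · intro x
    have h1 : Tendsto (fun N : ℕ => radSq x * cutoffRatio ((N : ℝ) + 1) (radSq x)) atTop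
        (𝓝 (radSq x)) := by simpa using (tendsto_cutoffRatio (radSq x)).const_mul (radSq x)
    simp only [cutoffWeight, mul_one, pow_zero, div_one]
    exact (h1.rpow_const (Or.inl (radSq_pos x).ne')).const_mul τ
  · exact continuous_const.mul (continuous_radSq.rpow_const fun x => Or.inl (radSq_pos x).ne')
  · have ht : Tendsto (fun x : Euc n => D * radSq x ^ (-(3 / 4) : ℝ)) (cocompact (Euc n))
        (𝓝 0) := by
      simpa using ((tendsto_rpow_neg_atTop (by norm_num : (0 : ℝ) < 3 / 4)).comp
        tendsto_radSq).const_mul D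
    refine squeeze_zero (fun x => by have := radSq_pos x; positivity) (fun x => ?_) ht
    have hy := radSq_pos x
    have e : radSq x ^ (1 / 4 : ℝ) = radSq x ^ (-(3 / 4) : ℝ) * radSq x := by
      rw [← Real.rpow_add_one hy.ne']; norm_num
    rw [e, mul_assoc, mul_comm D]
    exact mul_le_mul_of_nonneg_left (hD x) (by positivity)

end Decay

/-! ### Large weights force the solution to vanish -/

section Vanishing

theorem contDiff_radSq_rpow (c s : ℝ) : ContDiff ℝ ∞ fun x : Euc n => c * radSq x ^ s :=
  contDiff_const.mul (contDiff_radSq.rpow_const_of_ne fun x => (radSq_pos x).ne')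

theorem pd_radSq_rpow (c s : ℝ) (i : Fin n) (x : Euc n) :
    pd i (fun x => c * radSq x ^ s) x = 2 * (c * s) * radSq x ^ (s - 1) * x i := by
  have h := (Real.hasDerivAt_rpow_const (p := s) (Or.inl (radSq_pos x).ne')).const_mul c
  rw [pd_comp_radSq (f := fun y => c * y ^ s) h]
  ring

theorem radSq_rpow_mul_pow (x : Euc n) (s : ℝ) (j : ℕ) :
    radSq x ^ (s - j) * radSq x ^ j = radSq x ^ s := by
  rw [← Real.rpow_natCast, ← Real.rpow_add (radSq_pos x)]
  congr 1
  ring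

/-- The virial identity with the weight `exp (2 τ (1 + |x|²)^(1/4))`. -/
theorem IsLocalizedSolution.integral_virial_exp {g : ℝ → ℝ} {θ : Euc n → ℝ} {k C : ℝ}
    (H : IsLocalizedSolution g θ k C) {τ : ℝ} (hτ : 0 ≤ τ) :
    let V := fun x => Real.exp (2 * (τ * radSq x ^ (1 / 4 : ℝ))) *
      virialDensity g θ (fun x => τ / 2 * radSq x ^ (1 / 4 - 1 : ℝ))
        (fun x => -(3 / 4 * τ) * radSq x ^ (1 / 4 - 1 - 1 : ℝ))
        (fun x => 21 / 8 * τ * radSq x ^ (1 / 4 - 1 - 1 - 1 : ℝ)) x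
    Integrable V ∧ ∫ x, V x = 0 := by
  have e0 : ∀ x : Euc n, 1 + ‖x‖ ^ 2 = radSq x := fun x => rfl
  refine H.integral_virial (A := fun x => 3 * τ * radSq x ^ (1 / 4 : ℝ))
    (contDiff_radSq_rpow _ _) (contDiff_radSq_rpow _ _) (contDiff_radSq_rpow _ _) ?_ ?_ ?_ ?_ ?_ ?_ ?_
  · intro i x
    rw [pd_radSq_rpow]; ring
  · intro i x
    rw [pd_radSq_rpow]; ring
  · intro i x
    rw [pd_radSq_rpow]; ring
  · intro x
    have hy := radSq_pos x
    have h := radSq_rpow_mul_pow x (1 / 4) 1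
    have h0 : 0 ≤ τ * radSq x ^ (1 / 4 : ℝ) := by positivity
    rw [e0, abs_of_nonneg (by positivity)]
    push_cast at h
    rw [pow_one] at h
    rw [mul_assoc, h]
    linarith
  · intro x
    have hy := radSq_pos x
    have h := radSq_rpow_mul_pow x (1 / 4) 2
    have h0 : 0 ≤ τ * radSq x ^ (1 / 4 : ℝ) := by positivity
    rw [e0, neg_mul, abs_neg, abs_of_nonneg (by positivity), mul_assoc,
      show (1 / 4 - 1 - 1 : ℝ) = 1 / 4 - (2 : ℕ) by norm_num, h]
    linarith
  · intro x
    have hy := radSq_pos x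
    have h := radSq_rpow_mul_pow x (1 / 4) 3
    have h0 : 0 ≤ τ * radSq x ^ (1 / 4 : ℝ) := by positivity
    rw [e0, abs_of_nonneg (by positivity), mul_assoc,
      show (1 / 4 - 1 - 1 - 1 : ℝ) = 1 / 4 - (3 : ℕ) by norm_num, h]
    linarith
  · have hc : Continuous fun x : Euc n => radSq x ^ (1 / 4 : ℝ) :=
      continuous_radSq.rpow_const fun x => Or.inl (radSq_pos x).ne'
    have cθ := H.smooth.continuous
    have cg := H.smooth.gradSq.continuous
    -- The extra 3/2 supplies the factor exp(3z) that dominates the polynomial (1 + 3τz)³.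
    refine ((H.integrable_exp (τ := τ + 3 / 2) (by positivity)).const_mul ((1 + 3 * τ) ^ 3)).mono'
      (by fun_prop : Continuous _).aestronglyMeasurable (ae_of_all _ fun x => ?_)
    have hy := radSq_pos x
    have hE : 0 ≤ gradSq θ x + θ x ^ 2 := add_nonneg (gradSq_nonneg θ x) (sq_nonneg _)
    set z := radSq x ^ (1 / 4 : ℝ) with hz
    have hz0 : 0 ≤ z := by positivity
    rw [Real.norm_of_nonneg (by positivity)]
    have h1 : (1 + 3 * τ * z) ^ 3 ≤ (1 + 3 * τ) ^ 3 * Real.exp (3 * z) := by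
      have e : Real.exp (3 * z) = Real.exp z ^ 3 := by rw [← Real.exp_nat_mul]; norm_num
      rw [e, ← mul_pow]
      gcongr
      have h2 := Real.add_one_le_exp z
      have h3 := mul_le_mul_of_nonneg_left h2 (show 0 ≤ 1 + 3 * τ by positivity)
      nlinarith
    calc _ ≤ Real.exp (2 * (τ * z)) * (((1 + 3 * τ) ^ 3 * Real.exp (3 * z)) *
          (gradSq θ x + θ x ^ 2)) := by gcongr
      _ = _ := by
        rw [show 2 * ((τ + 3 / 2) * z) = 2 * (τ * z) + 3 * z by ring, Real.exp_add]
        ring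

/-- Put t = τ(1+|x|²)^(-3/4). The part of `virialCoeff` quadratic in t is at least t²|x|²/16,
because 7/8 - 3/4 = 1/8. All other errors are at most linear in t, the nonlinear one thanks to
(1+|x|²)|θ| ≤ D. -/
theorem IsLocalizedSolution.virialDensity_exp_ge {g : ℝ → ℝ} {θ : Euc n → ℝ} {k C : ℝ}
    (H : IsLocalizedSolution g θ k C) {D : ℝ} (hD : ∀ x, radSq x * |θ x| ≤ D) {τ : ℝ}
    (hτ : 0 ≤ τ) (x : Euc n) :
    1 / 8 * gradSq θ x + (7 / 8 * k - C * (n + 2) * |θ x| -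
      (C * (n + 2) * D + 2 + n ^ 2) * (τ * radSq x ^ (1 / 4 - 1 : ℝ)) +
      (τ * radSq x ^ (1 / 4 - 1 : ℝ)) ^ 2 * ‖x‖ ^ 2 / 16) * θ x ^ 2 ≤
    virialDensity g θ (fun x => τ / 2 * radSq x ^ (1 / 4 - 1 : ℝ))
        (fun x => -(3 / 4 * τ) * radSq x ^ (1 / 4 - 1 - 1 : ℝ))
        (fun x => 21 / 8 * τ * radSq x ^ (1 / 4 - 1 - 1 - 1 : ℝ)) x := by
  have hy := radSq_pos x
  have hC := H.C_nonneg
  have hn0 : (0 : ℝ) ≤ n := Nat.cast_nonneg n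
  have hr : ‖x‖ ^ 2 ≤ radSq x := by unfold radSq; linarith
  have hr0 := sq_nonneg ‖x‖
  have hγ0 : 0 ≤ τ / 2 * radSq x ^ (1 / 4 - 1 : ℝ) := by positivity
  refine le_trans ?_ (H.virialDensity_ge
    (A := τ / 2 * radSq x ^ (1 / 4 - 1 : ℝ) * radSq x) hγ0
    (mul_le_mul_of_nonneg_left hr hγ0))
  simp only [virialCoeff]
  have e1 : radSq x ^ (1 / 4 - 1 - 1 : ℝ) = radSq x ^ (1 / 4 - 1 : ℝ) / radSq x :=
    Real.rpow_sub_one hy.ne' _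
  have e2 : radSq x ^ (1 / 4 - 1 - 1 - 1 : ℝ) = radSq x ^ (1 / 4 - 1 : ℝ) / radSq x / radSq x := by
    rw [Real.rpow_sub_one hy.ne' (1 / 4 - 1 - 1 : ℝ), e1]
  rw [e1, e2]
  have hD' := hD x
  set y := radSq x
  set w := y ^ (1 / 4 - 1 : ℝ)
  set t := τ * w with ht
  have ht0 : 0 ≤ t := by positivity
  set q := ‖x‖ ^ 2 / y with hq
  have hq0 : 0 ≤ q := by positivity
  have hq1 : q ≤ 1 := (div_le_one hy).2 hr
  have hry : ‖x‖ ^ 2 = q * y := by rw [hq]; field_simp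
  have e3 : τ / 2 * w * ‖x‖ ^ 2 * (-(3 / 4 * τ) * (w / y) * ‖x‖ ^ 2 + 7 / 4 * (τ / 2 * w)) -
      1 / 2 * (21 / 8 * τ * (w / y / y)) * ‖x‖ ^ 4 -
      (n + 9 / 8) * (-(3 / 4 * τ) * (w / y)) * ‖x‖ ^ 2 - n * (n / 2 + 1 / 8) * (τ / 2 * w) =
      t / 2 * ‖x‖ ^ 2 * (t * (7 / 8 - 3 / 4 * q)) - 21 / 16 * t * q ^ 2 +
        (n + 9 / 8) * (3 / 4) * t * q - n * (n / 2 + 1 / 8) / 2 * t := by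
    rw [show ‖x‖ ^ 4 = (‖x‖ ^ 2) ^ 2 by ring, ht, hry]
    field_simp
    ring
  rw [e3]
  have h1 : t ^ 2 * ‖x‖ ^ 2 / 16 ≤ t / 2 * ‖x‖ ^ 2 * (t * (7 / 8 - 3 / 4 * q)) := by
    have : 0 ≤ t ^ 2 * ‖x‖ ^ 2 * (1 - q) := by
      have : 0 ≤ 1 - q := by linarith
      positivity
    nlinarith
  have h2 : 21 / 16 * t * q ^ 2 ≤ 2 * t := by
    have : q ^ 2 ≤ 1 := pow_le_one₀ hq0 hq1
    nlinarith
  have h3 : 0 ≤ (n + 9 / 8) * (3 / 4) * t * q := by positivity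
  have h4 : n * (n / 2 + 1 / 8) / 2 * t ≤ n ^ 2 * t := by
    refine mul_le_mul_of_nonneg_right ?_ ht0
    have : (n : ℝ) ≤ n ^ 2 := by exact_mod_cast Nat.le_self_pow two_ne_zero n
    nlinarith
  have h5 : C * (n + 2) * (1 + τ / 2 * w * y) * |θ x| ≤
      C * (n + 2) * |θ x| + C * (n + 2) * D * t := by
    have h6 : τ / 2 * w * y * |θ x| ≤ D * t := by
      have h7 := mul_le_mul_of_nonneg_left hD' ht0
      have h8 : 0 ≤ t * (y * |θ x|) := by positivity
      have e : τ / 2 * w * y * |θ x| = t * (y * |θ x|) / 2 := by rw [ht]; ring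
      rw [e]
      linarith
    have := mul_le_mul_of_nonneg_left h6 (show 0 ≤ C * (n + 2) by positivity)
    linarith
  have key : 7 / 8 * k - C * (n + 2) * |θ x| - (C * (n + 2) * D + 2 + n ^ 2) * t +
      t ^ 2 * ‖x‖ ^ 2 / 16 ≤ (7 / 8 * k - C * (n + 2) * (1 + τ / 2 * w * y) * |θ x|) +
      (t / 2 * ‖x‖ ^ 2 * (t * (7 / 8 - 3 / 4 * q)) - 21 / 16 * t * q ^ 2 +
        (n + 9 / 8) * (3 / 4) * t * q - n * (n / 2 + 1 / 8) / 2 * t) := by linarith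
  have := mul_le_mul_of_nonneg_right key (sq_nonneg (θ x))
  linarith

theorem quadratic_nonneg_of_sq_le {a b r t : ℝ} (hr : 0 < r) (h : 4 * b ^ 2 ≤ a * r) :
    0 ≤ a - b * t + t ^ 2 * r / 16 := by
  refine (mul_nonneg_iff_of_pos_left hr).1 ?_
  rw [show r * (a - b * t + t ^ 2 * r / 16) = a * r - 4 * b ^ 2 + (t * r / 4 - 2 * b) ^ 2 by ring]
  linarith [sq_nonneg (t * r / 4 - 2 * b)]

/-- For large `τ` the density of the virial identity is nonnegative outside a small ball. -/
theorem IsLocalizedSolution.exists_virialDensity_lower {g : ℝ → ℝ} {θ : Euc n → ℝ} {k C : ℝ}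
    (H : IsLocalizedSolution g θ k C) {ε : ℝ} (hε : 0 < ε) :
    ∃ K τ₀ : ℝ, 0 ≤ K ∧ 1 ≤ τ₀ ∧ ∀ τ, τ₀ ≤ τ → ∀ x,
      (ε ≤ ‖x‖ → 1 / 8 * gradSq θ x ≤
        virialDensity g θ (fun x => τ / 2 * radSq x ^ (1 / 4 - 1 : ℝ))
          (fun x => -(3 / 4 * τ) * radSq x ^ (1 / 4 - 1 - 1 : ℝ))
          (fun x => 21 / 8 * τ * radSq x ^ (1 / 4 - 1 - 1 - 1 : ℝ)) x) ∧
      -(K * τ) ≤ virialDensity g θ (fun x => τ / 2 * radSq x ^ (1 / 4 - 1 : ℝ))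
          (fun x => -(3 / 4 * τ) * radSq x ^ (1 / 4 - 1 - 1 : ℝ))
          (fun x => 21 / 8 * τ * radSq x ^ (1 / 4 - 1 - 1 - 1 : ℝ)) x := by
  obtain ⟨D, hD⟩ := H.exists_decay
  obtain ⟨M, hM⟩ := bdd_of_tendsto_zero H.smooth.continuous H.tendsto
  have hM0 : 0 ≤ M := (abs_nonneg _).trans (hM 0)
  have hD0 : 0 ≤ D := le_trans (mul_nonneg (radSq_pos 0).le (abs_nonneg _)) (hD 0)
  have hk := H.k_pos
  have hC := H.C_nonneg
  set C₁ := C * (n + 2) with hC₁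
  set C₂ := C * (n + 2) * D + 2 + (n : ℝ) ^ 2 with hC₂
  have hC₁0 : 0 ≤ C₁ := by positivity
  have hC₂0 : 0 ≤ C₂ := by positivity
  have hev1 : ∀ᶠ x in cocompact (Euc n), C₁ * |θ x| < 7 / 16 * k := by
    have : Tendsto (fun x => C₁ * |θ x|) (cocompact (Euc n)) (𝓝 0) := by
      simpa using H.tendsto.abs.const_mul C₁
    exact this.eventually (gt_mem_nhds (by positivity))
  obtain ⟨R, hR⟩ := exists_norm_gt_of_eventually hev1
  -- Beyond R₀ the discriminant is nonpositive: 4C₂² ≤ (7/16)k‖x‖², so the term linear in t is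
  -- absorbed for every τ.
  set R₀ := max R (4 * C₂ ^ 2 / (7 / 16 * k) + 1) with hR₀
  set w₀ := (1 + R₀ ^ 2) ^ (1 / 4 - 1 : ℝ) with hw₀
  have hw₀0 : 0 < w₀ := by positivity
  -- On the shell ε ≤ ‖x‖ ≤ R₀ large τ makes t ≥ t₀, and then the quadratic term t²ε²/16 wins.
  set t₀ := 16 * (C₂ + C₁ * M + 1) / ε ^ 2 + 1 with ht₀
  have ht₀1 : 1 ≤ t₀ := by rw [ht₀]; have : 0 ≤ 16 * (C₂ + C₁ * M + 1) / ε ^ 2 := by positivity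
                           linarith
  refine ⟨(C₁ * M + C₂) * M ^ 2, max 1 (t₀ / w₀), by positivity, le_max_left _ _,
    fun τ hτ x => ?_⟩
  have hτ1 : 1 ≤ τ := (le_max_left _ _).trans hτ
  have hτ2 : t₀ ≤ τ * w₀ := by
    rw [← div_le_iff₀ hw₀0]
    exact (le_max_right _ _).trans hτ
  have hge := H.virialDensity_exp_ge hD (show 0 ≤ τ by linarith) x
  rw [← hC₁, ← hC₂] at hge
  have hy := radSq_pos x
  have hw1 : radSq x ^ (1 / 4 - 1 : ℝ) ≤ 1 :=
    Real.rpow_le_one_of_one_le_of_nonpos (one_le_radSq x) (by norm_num)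
  set t := τ * radSq x ^ (1 / 4 - 1 : ℝ) with ht
  have ht0 : 0 ≤ t := by positivity
  have htτ : t ≤ τ := mul_le_of_le_one_right (by linarith) hw1
  have hT := gradSq_nonneg θ x
  have hθ2 : θ x ^ 2 ≤ M ^ 2 := by
    rw [← sq_abs]; exact pow_le_pow_left₀ (abs_nonneg _) (hM x) 2
  have hC₁M : C₁ * |θ x| ≤ C₁ * M := mul_le_mul_of_nonneg_left (hM x) hC₁0
  constructor
  · intro hx
    suffices h : 0 ≤ 7 / 8 * k - C₁ * |θ x| - C₂ * t + t ^ 2 * ‖x‖ ^ 2 / 16 by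
      have := mul_nonneg h (sq_nonneg (θ x))
      linarith
    by_cases hxR : R₀ < ‖x‖
    · have h1 := hR x ((le_max_left _ _).trans_lt hxR)
      have h2 : 4 * C₂ ^ 2 / (7 / 16 * k) + 1 < ‖x‖ := (le_max_right _ _).trans_lt hxR
      have h3 : 4 * C₂ ^ 2 / (7 / 16 * k) ≤ ‖x‖ ^ 2 := by
        have h7 : 0 ≤ 4 * C₂ ^ 2 / (7 / 16 * k) := by positivity
        have h8 : 1 ≤ ‖x‖ := by linarith
        linarith [le_self_pow₀ h8 two_ne_zero]
      have hx0 : 0 < ‖x‖ ^ 2 := by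
        have : 0 < ‖x‖ := hε.trans_le hx
        positivity
      have h4 : 4 * C₂ ^ 2 ≤ 7 / 16 * k * ‖x‖ ^ 2 := by
        rw [div_le_iff₀ (by positivity)] at h3
        linarith
      have h6 := quadratic_nonneg_of_sq_le (t := t) hx0 h4
      linarith
    · push Not at hxR
      have h1 : w₀ ≤ radSq x ^ (1 / 4 - 1 : ℝ) := by
        refine Real.rpow_le_rpow_of_nonpos hy ?_ (by norm_num)
        unfold radSq
        gcongr
      have h2 : t₀ ≤ t := hτ2.trans (mul_le_mul_of_nonneg_left h1 (by linarith))
      have h3 : 16 * (C₂ + C₁ * M + 1) ≤ t * ε ^ 2 := by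
        have : 16 * (C₂ + C₁ * M + 1) / ε ^ 2 ≤ t := by linarith
        rwa [div_le_iff₀ (by positivity)] at this
      have h4 : t * ε ^ 2 ≤ t * ‖x‖ ^ 2 := by gcongr
      have h5 : t * (16 * (C₂ + C₁ * M + 1)) ≤ t * (t * ‖x‖ ^ 2) :=
        mul_le_mul_of_nonneg_left (h3.trans h4) ht0
      have h6 : C₁ * M + 1 ≤ t * (C₁ * M + 1) :=
        le_mul_of_one_le_left (by positivity) (ht₀1.trans h2)
      linarith
  · have h1 : -((C₁ * M + C₂) * τ) ≤ 7 / 8 * k - C₁ * |θ x| - C₂ * t + t ^ 2 * ‖x‖ ^ 2 / 16 := by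
      have h2 : C₂ * t ≤ C₂ * τ := mul_le_mul_of_nonneg_left htτ hC₂0
      have h3 : C₁ * M ≤ C₁ * M * τ := le_mul_of_one_le_right (by positivity) hτ1
      have h4 : 0 ≤ t ^ 2 * ‖x‖ ^ 2 / 16 := by positivity
      linarith
    have h5 := mul_le_mul_of_nonneg_right h1 (sq_nonneg (θ x))
    have h6 : (C₁ * M + C₂) * τ * θ x ^ 2 ≤ (C₁ * M + C₂) * τ * M ^ 2 :=
      mul_le_mul_of_nonneg_left hθ2 (by positivity)
    linarith

/-- A Carleman argument. The negative part of the density lives in ‖x‖ < ε and costs at most Kτ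
exp(2τd₁), while the gradient outside 2ε is weighted by exp(2τd₂) with d₂ > d₁. As τ → ∞ it must
vanish there, and 2ε = ‖p‖/2. -/
theorem IsLocalizedSolution.gradSq_eq_zero {g : ℝ → ℝ} {θ : Euc n → ℝ} {k C : ℝ}
    (H : IsLocalizedSolution g θ k C) {p : Euc n} (hp : p ≠ 0) : gradSq θ p = 0 := by
  set ε := ‖p‖ / 4 with hεdef
  have hp0 : 0 < ‖p‖ := norm_pos_iff.2 hp
  have hε : 0 < ε := by positivity
  obtain ⟨K, τ₀, hK, hτ₀, hlow⟩ := H.exists_virialDensity_lower hε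
  set U := {x : Euc n | 2 * ε < ‖x‖} with hU
  have oU : IsOpen U := isOpen_lt continuous_const continuous_norm
  set B := Metric.ball (0 : Euc n) ε with hB
  have cg := H.smooth.gradSq.continuous
  have hT : Integrable (gradSq θ) := H.integrable.mono' cg.aestronglyMeasurable
    (ae_of_all _ fun x => by
      rw [Real.norm_of_nonneg (gradSq_nonneg θ x)]
      linarith [sq_nonneg (θ x)])
  set J := ∫ x in U, gradSq θ x with hJ
  have hJ0 : 0 ≤ J := integral_nonneg fun x => gradSq_nonneg θ x
  set d₁ := (1 + ε ^ 2) ^ (1 / 4 : ℝ) with hd₁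
  set d₂ := (1 + (2 * ε) ^ 2) ^ (1 / 4 : ℝ) with hd₂
  have hd : d₁ < d₂ := Real.rpow_lt_rpow (by positivity) (by nlinarith [pow_pos hε 2]) (by norm_num)
  set v := volume.real B with hv
  have hv0 : 0 ≤ v := measureReal_nonneg
  have hmain : ∀ τ, τ₀ ≤ τ → J ≤ 8 * K * v * (τ ^ (1 : ℝ) * Real.exp (-(2 * (d₂ - d₁)) * τ)) := by
    intro τ hτ
    have hτ0 : 0 ≤ τ := by linarith
    obtain ⟨hi, h0⟩ := H.integral_virial_exp hτ0
    have hle : ∀ x, U.indicator (fun x => Real.exp (2 * (τ * d₂)) * (1 / 8) * gradSq θ x) x -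
        B.indicator (fun _ => Real.exp (2 * (τ * d₁)) * (K * τ)) x ≤
        Real.exp (2 * (τ * radSq x ^ (1 / 4 : ℝ))) *
        virialDensity g θ (fun x => τ / 2 * radSq x ^ (1 / 4 - 1 : ℝ))
          (fun x => -(3 / 4 * τ) * radSq x ^ (1 / 4 - 1 - 1 : ℝ))
          (fun x => 21 / 8 * τ * radSq x ^ (1 / 4 - 1 - 1 - 1 : ℝ)) x := by
      intro x
      obtain ⟨l1, l2⟩ := hlow τ hτ x
      have hE := Real.exp_pos (2 * (τ * radSq x ^ (1 / 4 : ℝ)))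
      by_cases hxB : x ∈ B
      · have hx : ‖x‖ < ε := by simpa [hB] using hxB
        have hxU : x ∉ U := fun h => by
          have : 2 * ε < ‖x‖ := h
          linarith
        rw [Set.indicator_of_mem hxB, Set.indicator_of_notMem hxU, zero_sub]
        have h1 : Real.exp (2 * (τ * radSq x ^ (1 / 4 : ℝ))) ≤ Real.exp (2 * (τ * d₁)) := by
          have := radSq_pos x
          refine Real.exp_le_exp.2 ?_
          unfold radSq
          rw [hd₁]
          gcongr
        have h2 := mul_le_mul_of_nonneg_left l2 hE.le
        have h3 := mul_le_mul_of_nonneg_right h1 (show 0 ≤ K * τ by positivity)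
        linarith
      · have hx : ε ≤ ‖x‖ := by simpa [hB] using hxB
        have h1 := mul_le_mul_of_nonneg_left (l1 hx) hE.le
        have hTx := gradSq_nonneg θ x
        rw [Set.indicator_of_notMem hxB, sub_zero]
        refine le_trans ?_ h1
        by_cases hxU : x ∈ U
        · rw [Set.indicator_of_mem hxU, mul_assoc]
          refine mul_le_mul_of_nonneg_right (Real.exp_le_exp.2 ?_) (by positivity)
          have hx2 : 2 * ε < ‖x‖ := hxU
          unfold radSq
          rw [hd₂]
          gcongr
        · rw [Set.indicator_of_notMem hxU]
          positivity
    have i1 : Integrable (U.indicator fun x => Real.exp (2 * (τ * d₂)) * (1 / 8) * gradSq θ x) :=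
      (hT.const_mul _).indicator oU.measurableSet
    have i2 : Integrable (B.indicator fun _ => Real.exp (2 * (τ * d₁)) * (K * τ)) :=
      (integrable_indicator_iff measurableSet_ball).2 (integrableOn_const measure_ball_lt_top.ne)
    have i3 : Integrable fun x => U.indicator
        (fun x => Real.exp (2 * (τ * d₂)) * (1 / 8) * gradSq θ x) x -
        B.indicator (fun _ => Real.exp (2 * (τ * d₁)) * (K * τ)) x := i1.sub i2
    have h1 := integral_mono i3 hi hle
    rw [h0, integral_sub i1 i2, integral_indicator oU.measurableSet, integral_const_mul,
      integral_indicator measurableSet_ball, setIntegral_const, smul_eq_mul, ← hJ, ← hv] at h1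
    have e : Real.exp (-(2 * (d₂ - d₁)) * τ) = Real.exp (2 * (τ * d₁)) / Real.exp (2 * (τ * d₂)) := by
      rw [← Real.exp_sub]
      congr 1
      ring
    rw [e, Real.rpow_one, mul_div_assoc', mul_div_assoc', le_div_iff₀ (Real.exp_pos _)]
    linarith
  have hlim := (tendsto_rpow_mul_exp_neg_mul_atTop_nhds_zero 1 (2 * (d₂ - d₁))
    (by linarith)).const_mul (8 * K * v)
  rw [mul_zero] at hlim
  have hJle : J ≤ 0 := ge_of_tendsto hlim
    ((eventually_ge_atTop τ₀).mono fun τ hτ => hmain τ hτ)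
  have hJz : J = 0 := le_antisymm hJle hJ0
  rw [hJ, integral_eq_zero_iff_of_nonneg (fun x => gradSq_nonneg θ x) hT.integrableOn] at hJz
  exact Measure.eqOn_open_of_ae_eq hJz oU cg.continuousOn continuousOn_const
    (show 2 * ε < ‖p‖ by rw [hεdef]; linarith)

/-- A localized finite-energy solution of `Δθ = g(θ)` vanishes if `g' (0) < 0`. -/
theorem eq_zero_of_deriv_neg {g : ℝ → ℝ} (hg : ContDiff ℝ ∞ g) {θ : Euc n → ℝ} (hn : 1 ≤ n)
    (sθ : ContDiff ℝ ∞ θ) (hlap : ∀ x, lap θ x = g (θ x)) (hgrad : Integrable (gradSq θ))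
    (hG : Integrable fun x => nlwPotential g (θ x))
    (hloc : Tendsto θ (cocompact (Euc n)) (𝓝 0)) (hm : deriv g 0 < 0) : θ = 0 := by
  have h0 := nonlinearity_zero hn hg sθ hlap hloc
  obtain ⟨M, hM⟩ := bdd_of_tendsto_zero sθ.continuous hloc
  obtain ⟨C, hC0, hC⟩ := exists_nonlinearity_bound hg h0 M
  have H : IsLocalizedSolution g θ (-deriv g 0) C :=
    { smooth_g := hg
      smooth := sθ
      lap_eq := hlap
      tendsto := hloc
      k_pos := by linarith
      C_nonneg := hC0
      cubic := fun x => by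
        have := (hC (θ x) (hM x)).1
        rwa [neg_mul, ← sub_eq_add_neg]
      cubic_potential := fun x => (hC (θ x) (hM x)).2
      integrable := hgrad.add (integrable_sq_of_potential hg h0 hm sθ.continuous hloc hG) }
  have : Nonempty (Fin n) := ⟨⟨0, hn⟩⟩
  -- The gradient vanishes off the origin, hence everywhere by continuity, since n ≥ 1 makes the
  -- complement of a point dense.
  have hz : gradSq θ = fun _ => 0 :=
    Continuous.ext_on (dense_compl_singleton (0 : Euc n)) sθ.gradSq.continuous continuous_const
      fun p hp => H.gradSq_eq_zero hp
  refine eq_zero_of_pd_nonneg sθ hloc ⟨0, hn⟩ fun x => ?_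
  have := sq_pd_le_gradSq θ ⟨0, hn⟩ x
  rw [hz] at this
  exact (pow_eq_zero_iff two_ne_zero |>.1 (le_antisymm this (sq_nonneg _))).ge

end Vanishing

/-! ### Eigenvectors of the linearization -/

section Linearization

theorem MemHInfty.clm_comp {F F' : Type*} [NormedAddCommGroup F] [NormedSpace ℝ F]
    [NormedAddCommGroup F'] [NormedSpace ℝ F'] {u : Euc n → F} (hu : MemHInfty u) (A : F →L[ℝ] F') :
    MemHInfty fun x => A (u x) := by
  have su : ContDiff ℝ ∞ fun x => A (u x) := A.contDiff.comp hu.1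
  refine ⟨su, fun k => (hu.2 k).of_le_mul (c := ‖A‖)
    (su.continuous_iteratedFDeriv (by exact_mod_cast le_top)).aestronglyMeasurable
    (ae_of_all _ fun x => ?_)⟩
  exact A.norm_iteratedFDeriv_comp_left hu.1.contDiffAt (by exact_mod_cast le_top)

theorem schrodingerOp_clm_comp {F F' : Type*} [NormedAddCommGroup F] [NormedSpace ℝ F]
    [NormedAddCommGroup F'] [NormedSpace ℝ F'] (g : ℝ → ℝ) (θ : Euc n → ℝ) {u : Euc n → F}
    (su : ContDiff ℝ ∞ u) (A : F →L[ℝ] F') (x : Euc n) :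
    schrodingerOp g θ (fun x => A (u x)) x = A (schrodingerOp g θ u x) := by
  have h : Laplacian.laplacian (fun x => A (u x)) x = A (Laplacian.laplacian u x) :=
    ContDiffAt.laplacian_CLM_comp_left (f := u) (l := A)
      (contDiff_infty.1 su 2).contDiffAt
  simp only [schrodingerOp, h, map_add, map_neg, map_smul]

theorem schrodingerOp_apply_of_lap_eq {g : ℝ → ℝ} {θ χ : Euc n → ℝ} (sχ : ContDiff ℝ ∞ χ)
    {μ : ℝ} (h : ∀ x, lap χ x = (deriv g (θ x) - μ) * χ x) : schrodingerOp g θ χ = μ • χ := by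
  ext x
  rw [schrodingerOp, laplacian_eq_lap sχ, h, Pi.smul_apply, smul_eq_mul, smul_eq_mul]
  ring

/-- The eigenvector is (χ, cχ). No sign of c is assumed, so the lemma serves both c and -c. -/
theorem isLinearizationEigenvalue_of_schrodingerOp_eq {g : ℝ → ℝ} {θ χ : Euc n → ℝ}
    (hχ : MemHInfty χ) (h0 : χ ≠ 0) {c : ℝ} (h : schrodingerOp g θ χ = (-c ^ 2) • χ) :
    IsLinearizationEigenvalue g θ (c : ℂ) := by
  have h1 : MemHInfty fun x => (χ x : ℂ) := hχ.clm_comp Complex.ofRealCLM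
  refine ⟨(fun x => (χ x : ℂ), fun x => (c : ℂ) * (χ x : ℂ)), h1,
    h1.clm_comp ((ContinuousLinearMap.mul ℂ ℂ (c : ℂ)).restrictScalars ℝ), fun hw => h0 ?_, ?_⟩
  · ext x
    have := congrFun (congrArg Prod.fst hw) x
    simpa using this
  · refine Prod.ext ?_ ?_
    · ext x
      simp [linearizedOp]
    · ext x
      have := schrodingerOp_clm_comp g θ hχ.1 Complex.ofRealCLM x
      rw [h] at this
      simp only [linearizedOp, Pi.neg_apply, Prod.smul_snd, Pi.smul_apply, smul_eq_mul]
      refine (congrArg Neg.neg this).trans ?_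
      simp
      ring

end Linearization

end NonlinearWave

/-! ### Proof of instability -/

theorem mainTheorem4 (n : ℕ) (hn : 1 ≤ n) (g : ℝ → ℝ) (hg : ContDiff ℝ ∞ g)
    (θ : EuclideanSpace ℝ (Fin n) → ℝ) (hθ : ContDiff ℝ ∞ θ)
    (hstat : IsStationarySolution g θ)
    (henergy : HasFiniteEnergy g θ 0)
    (hloc : Tendsto θ (cocompact (EuclideanSpace ℝ (Fin n))) (𝓝 0))
    (hne : θ ≠ 0) :
    IsLinearlyUnstable g θ ∧
    (IsSchrodingerEigenfunction g θ 0 (firstPartial hn θ) ∧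
      (∃ x, 0 < firstPartial hn θ x) ∧ (∃ x, firstPartial hn θ x < 0)) ∧
    ∃ c : ℝ, 0 < c ∧
      (∃ χ : EuclideanSpace ℝ (Fin n) → ℝ,
        (∀ x, χ x ≠ 0) ∧ IsSchrodingerEigenfunction g θ (-c ^ 2) χ) ∧
      IsLinearizationEigenvalue g θ (c : ℂ) ∧ IsLinearizationEigenvalue g θ (-c : ℂ) := by
  have hlap : ∀ x, lap θ x = g (θ x) := by
    intro x
    have := hstat.2 x 0
    simp only [iteratedDeriv_const, laplacian_eq_lap hθ] at this
    simp at this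
    linarith
  have hgrad : Integrable (gradSq θ) := by
    have := henergy.2.1.const_mul 2
    refine this.congr (ae_of_all _ fun x => ?_)
    simp only [norm_gradient_sq]
    ring
  have hb := bdd_of_tendsto_zero hθ.continuous hloc
  have hm : 0 ≤ deriv g 0 := by
    by_contra! hm
    exact hne (eq_zero_of_deriv_neg hg hn hθ hlap hgrad henergy.2.2 hloc hm)
  set i₀ : Fin n := ⟨0, hn⟩
  have sV : ContDiff ℝ ∞ fun x => deriv g (θ x) := (contDiff_deriv hg).comp hθ
  have hV : ∀ k, BddDeriv k fun x => deriv g (θ x) := fun k =>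
    BddDeriv.comp (contDiff_deriv hg) hθ (bddDeriv_of_semilinear hg hθ hlap hb k)
  have hVlim : Tendsto (fun x => deriv g (θ x)) (cocompact (Euc n)) (𝓝 (deriv g 0)) :=
    ((contDiff_deriv hg).continuous.tendsto 0).comp hloc
  have su : ContDiff ℝ ∞ (pd i₀ θ) := hθ.pd i₀
  have hulap : ∀ x, lap (pd i₀ θ) x = deriv g (θ x) * pd i₀ θ x := by
    intro x
    rw [lap_pd hθ, show lap θ = fun x => g (θ x) from funext hlap, pd_fun_comp hg hθ]
  -- The zero mode is in L² because the gradient energy is finite; elliptic regularity then puts it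
  -- in H^∞.
  have hu2 : MemLp (pd i₀ θ) 2 volume := by
    rw [memLp_two_iff_integrable_sq su.continuous.aestronglyMeasurable]
    refine hgrad.mono' (su.continuous.pow 2).aestronglyMeasurable (ae_of_all _ fun x => ?_)
    rw [Real.norm_of_nonneg (sq_nonneg _)]
    exact sq_pd_le_gradSq θ i₀ x
  have hu := l2Deriv_of_lap_eq sV hV su hulap hu2
  have hup : ∃ x, 0 < pd i₀ θ x := by
    by_contra! h
    refine hne (neg_eq_zero.1 (eq_zero_of_pd_nonneg (θ := -θ) hθ.neg (neg_zero (G := ℝ) ▸ hloc.neg) i₀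
      fun x => ?_))
    have : pd i₀ (-θ) x = - pd i₀ θ x := pd_neg θ i₀ x
    rw [this]
    linarith [h x]
  have hun : ∃ x, pd i₀ θ x < 0 := by
    by_contra! h
    exact hne (eq_zero_of_pd_nonneg hθ hloc i₀ h)
  obtain ⟨c, hc, χ, sχ, hχ, hpos, hχlap⟩ :=
    exists_pos_eigenfunction sV hV hm hVlim su hu hulap hup hun
  have hχH := memHInfty_of_l2Deriv sχ hχ
  have hχ0 : χ ≠ 0 := fun h => (hpos 0).ne' (congrFun h 0)
  have hop : schrodingerOp g θ χ = (-c ^ 2) • χ :=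
    schrodingerOp_apply_of_lap_eq sχ fun x => by rw [hχlap, sub_neg_eq_add]
  have e1 : IsLinearizationEigenvalue g θ (c : ℂ) :=
    isLinearizationEigenvalue_of_schrodingerOp_eq hχH hχ0 hop
  have e2 : IsLinearizationEigenvalue g θ (-c : ℂ) := by
    have := isLinearizationEigenvalue_of_schrodingerOp_eq (c := -c) hχH hχ0 (by rwa [neg_sq])
    rwa [Complex.ofReal_neg] at this
  refine ⟨⟨c, by simpa using hc, e1⟩, ⟨⟨memHInfty_of_l2Deriv su hu, ?_, ?_⟩, hup, hun⟩, c, hc,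
    ⟨χ, fun x => (hpos x).ne', hχH, hχ0, hop⟩, e1, e2⟩
  · obtain ⟨x, hx⟩ := hup
    exact fun h => hx.ne' (congrFun h x)
  · exact schrodingerOp_apply_of_lap_eq su fun x => by rw [hulap, sub_zero]
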